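/- Let $k$ be a field, $\otimes=\otimes_k$, and let $H$ be a quasi-Hopf algebra over $k$ with invertible antipode: a unital $k$-algebra with algebra maps $\Delta:H\to H\otimes H$ and $\epsilon:H\to k$, an invertible $\phi\in H^{\otimes 3}$, a bijective linear algebra-antihomomorphism $S:H\to H$, and $\alpha,\beta\in H$. Write $\phi=X\otimes Y\otimes Z$, $\phi^{-1}=\bar X\otimes\bar Y\otimes\bar Z$ and $\Delta(a)=a_{(1)}\otimes a_{(2)}$ (sums suppressed). For all $a\in H$ it is required that $$(\mathrm{id}\otimes\Delta)(\Delta(a))\,\phi=\phi\,(\Delta\otimes\mathrm{id})(\Delta(a)),\qquad (\epsilon\otimes\mathrm{id})\Delta=\mathrm{id}=(\mathrm{id}\otimes\epsilon)\Delta,\qquad (\mathrm{id}\otimes\epsilon\otimes\mathrm{id})(\phi)=1\otimes 1,$$ $$(\mathrm{id}\otimes\mathrm{id}\otimes\Delta)(\phi)\,(\Delta\otimes\mathrm{id}\otimes\mathrm{id})(\phi)=(1\otimes\phi)\,(\mathrm{id}\otimes\Delta\otimes\mathrm{id})(\phi)\,(\phi\otimes1),$$ $$S(a_{(1)})\alpha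 a_{(2)}=\epsilon(a)\alpha,\quad a_{(1)}\beta S(a_{(2)})=\epsilon(a)\beta,\quad X\beta S(Y)\alpha Z=1=S(\bar X)\alpha\bar Y\beta S(\bar Z).$$ Tensor powers of $H$ act factorwise on tensor products of $H$-bimodules. A right quasi-Hopf $H$-bimodule $(M,\rho_M)$ is an $H$-bimodule $M$ with a linear map $\rho_M:M\to M\otimes H$ satisfying $\rho_M(a\cdot m\cdot b)=\Delta(a)\cdot\rho_M(m)\cdot\Delta(b)$, $(\mathrm{id}\otimes\epsilon)\rho_M=\mathrm{id}$ and $\phi\cdot(\rho_M\otimes\mathrm{id})(\rho_M(m))=(\mathrm{id}\otimes\Delta)(\rho_M(m))\cdot\phi$. A left one $(K,\Lambda_K)$ is an $H$-bimodule $K$ with a linear map $\Lambda_K:K\to H\otimes K$ satisfying $\Lambda_K(a\cdot x\cdot b)=\Delta(a)\cdot\Lambda_K(x)\cdot\Delta(b)$, $(\epsilon\otimes\mathrm{id})\Lambda_K=\mathrm{id}$ and $(\mathrm{id}\otimes\Lambda_K)(\Lambda_K(x))\cdot\phi=\phi\cdot(\Delta\otimes\mathrm{id})(\Lambda_K(x))$.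 A morphism of right quasi-Hopf $H$-bimodules is an $H$-bimodule map $f$ that intertwines the coactions, $(f\otimes\mathrm{id})\circ\rho=\rho'\circ f$. Put $$q_R=X\otimes S^{-1}(\alpha Z)Y,\quad p_R=\bar X\otimes\bar Y\beta S(\bar Z),\quad q_L=S(\bar X)\alpha\bar Y\otimes\bar Z,\quad p_L=YS^{-1}(X\beta)\otimes Z.$$ For a left quasi-Hopf $H$-bimodule $(K,\Lambda_K)$ let $K^*=\mathrm{Hom}_k(K,k)$ be the $H$-bimodule with $\langle a\cdot\psi\cdot b\mid x\rangle=\langle\psi\mid S^{-1}(a)\cdot x\cdot S(b)\rangle$. If $H$ or $K$ is finite-dimensional, $K^*\otimes H\cong\mathrm{Hom}_k(K,H)$, and $K^*$ carries the right coaction $\rho_{K^*}$ given by $[\rho_{K^*}(\psi)](x)=(\mathrm{id}\otimes\psi)(V\cdot\Lambda_K(x)\cdot U)$. Here $U=f_H^{-1}\,(S\otimes S)(q_R^{21})$ and $V=(S^{-1}\otimes S^{-1})(p_R^{21})\,(S^{-1}\otimes S^{-1})(f_H^{21})$ (products in $H\otimes H$), the exponent $21$ denotes the flip of the two factors, and $f_H\in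 H\otimes H$ is Drinfeld's (invertible) twist $$f_H=(S\otimes S)(\Delta^{op}(\bar X))\,\gamma\,\Delta(\bar Y\beta S(\bar Z)),\qquad \gamma=S(B)\alpha C\otimes S(A)\alpha D,\qquad A\otimes B\otimes C\otimes D=(1\otimes\phi^{-1})(\mathrm{id}\otimes\mathrm{id}\otimes\Delta)(\phi).$$ A linear form $\Sigma:K\otimes M\to k$ is called biinvariant if $\Sigma((x\otimes m)\cdot\Delta(a))=\epsilon(a)\Sigma(x\otimes m)=\Sigma(\Delta(a)\cdot(x\otimes m))$ for all $a\in H$, $x\in K$, $m\in M$, and cocentral if, for all $x\in K$, $m\in M$, $$(\mathrm{id}\otimes\Sigma)\big(\phi\cdot[\Lambda_K(x)\otimes m]\cdot\phi^{-1}\big)=(\Sigma\otimes\mathrm{id})\big(\phi^{-1}\cdot[x\otimes\rho_M(m)]\cdot\phi\big).$$ **Theorem.** Let $(K,\Lambda_K)$ be a left and $(M,\rho_M)$ a right quasi-Hopf $H$-bimodule. (i) The assignment $f\mapsto\Sigma_f$, $\Sigma_f(x\otimes m)=\langle f(m)\mid S^{-1}(\alpha)\cdot x\cdot\beta\rangle$,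 is a bijection from the $H$-bimodule maps $f:M\to K^*$ onto the biinvariant forms on $K\otimes M$. Its inverse is $\Sigma\mapsto f_\Sigma$, $\langle f_\Sigma(m)\mid x\rangle=\Sigma(p\cdot(x\otimes m)\cdot q)$, for each choice of $p\in\{p_L,p_R\}$ and $q\in\{q_L,q_R\}$; the map $f_\Sigma$ does not depend on these choices. (ii) If $H$ or $K$ is finite-dimensional, then for every $H$-bimodule map $f:M\to K^*$ the form $\Sigma_f$ is cocentral if and only if $f:(M,\rho_M)\to(K^*,\rho_{K^*})$ is a morphism of quasi-Hopf $H$-bimodules, i.e. $(f\otimes\mathrm{id})\circ\rho_M=\rho_{K^*}\circ f$. -/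

import Mathlib

open scoped TensorProduct MulOpposite

/-- A quasi-bialgebra `(H, Δ, ε, φ)` over a field `k`. Triple tensor powers are nested to the
right, `H ⊗ (H ⊗ H)`, and the associativity isomorphisms are written out. -/
class QuasiBialgebra (k H : Type*) [Field k] [Ring H] [Algebra k H] where
  /-- the coproduct `Δ` -/
  comul : H →ₐ[k] H ⊗[k] H
  /-- the counit `ε` -/
  counit : H →ₐ[k] k
  /-- the reassociator `φ` -/
  reassoc : (H ⊗[k] (H ⊗[k] H))ˣ
  /-- `(id ⊗ Δ)(Δ a) φ = φ (Δ ⊗ id)(Δ a)` -/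
  quasi_coassoc : ∀ a : H,
    Algebra.TensorProduct.map (AlgHom.id k H) comul (comul a) * (reassoc : H ⊗[k] (H ⊗[k] H)) =
      (reassoc : H ⊗[k] (H ⊗[k] H)) * TensorProduct.assoc k H H H
        (Algebra.TensorProduct.map comul (AlgHom.id k H) (comul a))
  /-- `(id ⊗ id ⊗ Δ)(φ) (Δ ⊗ id ⊗ id)(φ) = (1 ⊗ φ) (id ⊗ Δ ⊗ id)(φ) (φ ⊗ 1)` -/
  pentagon :
    (Algebra.TensorProduct.map (AlgHom.id k H)
        (Algebra.TensorProduct.map (AlgHom.id k H) comul) (reassoc : H ⊗[k] (H ⊗[k] H)) :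
          H ⊗[k] (H ⊗[k] (H ⊗[k] H))) *
      TensorProduct.assoc k H H (H ⊗[k] H)
        (Algebra.TensorProduct.map comul (AlgHom.id k (H ⊗[k] H))
          (reassoc : H ⊗[k] (H ⊗[k] H))) =
    ((1 : H) ⊗ₜ[k] (reassoc : H ⊗[k] (H ⊗[k] H))) *
      TensorProduct.map LinearMap.id (TensorProduct.assoc k H H H).toLinearMap
        (Algebra.TensorProduct.map (AlgHom.id k H)
          (Algebra.TensorProduct.map comul (AlgHom.id k H)) (reassoc : H ⊗[k] (H ⊗[k] H))) *
      TensorProduct.map LinearMap.id (TensorProduct.assoc k H H H).toLinearMap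
        (TensorProduct.assoc k H (H ⊗[k] H) H
          ((reassoc : H ⊗[k] (H ⊗[k] H)) ⊗ₜ[k] (1 : H)))
  /-- `(ε ⊗ id)(Δ a) = a` -/
  counit_left : ∀ a : H,
    TensorProduct.lid k H (TensorProduct.map counit.toLinearMap LinearMap.id (comul a)) = a
  /-- `(id ⊗ ε)(Δ a) = a` -/
  counit_right : ∀ a : H,
    TensorProduct.rid k H (TensorProduct.map LinearMap.id counit.toLinearMap (comul a)) = a
  /-- `(id ⊗ ε ⊗ id)(φ) = 1 ⊗ 1` -/
  counit_reassoc :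
    TensorProduct.map LinearMap.id
      ((TensorProduct.lid k H).toLinearMap ∘ₗ TensorProduct.map counit.toLinearMap LinearMap.id)
      (reassoc : H ⊗[k] (H ⊗[k] H)) = (1 : H ⊗[k] H)

/-- A quasi-Hopf algebra with invertible antipode `S`. -/
class QuasiHopfAlgebra (k H : Type*) [Field k] [Ring H] [Algebra k H] extends
    QuasiBialgebra k H where
  /-- the antipode `S`, a bijective linear antimorphism -/
  antipode : H ≃ₗ[k] H
  /-- the element `α` -/
  alpha : H
  /-- the element `β` -/
  beta : H
  antipode_one : antipode 1 = 1
  antipode_mul : ∀ a b : H, antipode (a * b) = antipode b * antipode a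
  /-- `S(a₁) α a₂ = ε(a) α` -/
  antipode_alpha : ∀ a : H,
    LinearMap.mul' k H (TensorProduct.map antipode.toLinearMap (LinearMap.mulLeft k alpha)
      (comul a)) = counit a • alpha
  /-- `a₁ β S(a₂) = ε(a) β` -/
  antipode_beta : ∀ a : H,
    LinearMap.mul' k H (TensorProduct.map LinearMap.id
      (LinearMap.mulLeft k beta ∘ₗ antipode.toLinearMap) (comul a)) = counit a • beta
  /-- `X β S(Y) α Z = 1` for `φ = X ⊗ Y ⊗ Z` -/
  reassoc_antipode :
    LinearMap.mul' k H (TensorProduct.map LinearMap.id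
      (LinearMap.mul' k H ∘ₗ TensorProduct.map
        (LinearMap.mulLeft k beta ∘ₗ antipode.toLinearMap) (LinearMap.mulLeft k alpha))
      (reassoc : H ⊗[k] (H ⊗[k] H))) = 1
  /-- `S(X) α Y β S(Z) = 1` for `φ⁻¹ = X ⊗ Y ⊗ Z` -/
  reassoc_inv_antipode :
    LinearMap.mul' k H (TensorProduct.map antipode.toLinearMap
      (LinearMap.mul' k H ∘ₗ TensorProduct.map
        (LinearMap.mulLeft k alpha) (LinearMap.mulLeft k beta ∘ₗ antipode.toLinearMap))
      ((reassoc⁻¹ : (H ⊗[k] (H ⊗[k] H))ˣ) : H ⊗[k] (H ⊗[k] H))) = 1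

namespace QuasiHopf

section Elements

variable (k H : Type*) [Field k] [Ring H] [Algebra k H] [QuasiHopfAlgebra k H]

/-- the coproduct `Δ` -/
noncomputable def Δ : H →ₐ[k] H ⊗[k] H := QuasiBialgebra.comul

/-- the counit `ε` -/
noncomputable def ε : H →ₐ[k] k := QuasiBialgebra.counit

/-- the reassociator `φ` -/
noncomputable def φ : H ⊗[k] (H ⊗[k] H) :=
  ((QuasiBialgebra.reassoc : (H ⊗[k] (H ⊗[k] H))ˣ) : H ⊗[k] (H ⊗[k] H))

/-- the inverse `φ⁻¹` of the reassociator -/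
noncomputable def φInv : H ⊗[k] (H ⊗[k] H) :=
  (((QuasiBialgebra.reassoc : (H ⊗[k] (H ⊗[k] H))ˣ)⁻¹ : (H ⊗[k] (H ⊗[k] H))ˣ) :
    H ⊗[k] (H ⊗[k] H))

/-- the antipode `S` -/
noncomputable def S : H ≃ₗ[k] H := QuasiHopfAlgebra.antipode

/-- the element `α` -/
def α : H := QuasiHopfAlgebra.alpha k

/-- the element `β` -/
def β : H := QuasiHopfAlgebra.beta k

/-- `S ⊗ S` -/
noncomputable def SS : H ⊗[k] H →ₗ[k] H ⊗[k] H :=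
  TensorProduct.map (S k H).toLinearMap (S k H).toLinearMap

/-- `S⁻¹ ⊗ S⁻¹` -/
noncomputable def SSInv : H ⊗[k] H →ₗ[k] H ⊗[k] H :=
  TensorProduct.map (S k H).symm.toLinearMap (S k H).symm.toLinearMap

/-- the flip `x = x¹ ⊗ x² ↦ x²¹ = x² ⊗ x¹` -/
noncomputable def swap : H ⊗[k] H →ₗ[k] H ⊗[k] H :=
  (TensorProduct.comm k H H).toLinearMap

/-- `q_R = X ⊗ S⁻¹(α Z) Y`, where `φ = X ⊗ Y ⊗ Z` -/
noncomputable def qR : H ⊗[k] H :=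
  TensorProduct.map LinearMap.id
    (LinearMap.mul' k H ∘ₗ
      TensorProduct.map ((S k H).symm.toLinearMap ∘ₗ LinearMap.mulLeft k (α k H)) LinearMap.id ∘ₗ
      (TensorProduct.comm k H H).toLinearMap)
    (φ k H)

/-- `p_R = X ⊗ Y β S(Z)`, where `φ⁻¹ = X ⊗ Y ⊗ Z` -/
noncomputable def pR : H ⊗[k] H :=
  TensorProduct.map LinearMap.id
    (LinearMap.mul' k H ∘ₗ
      TensorProduct.map LinearMap.id (LinearMap.mulLeft k (β k H) ∘ₗ (S k H).toLinearMap))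
    (φInv k H)

/-- `q_L = S(X) α Y ⊗ Z`, where `φ⁻¹ = X ⊗ Y ⊗ Z` -/
noncomputable def qL : H ⊗[k] H :=
  TensorProduct.map
    (LinearMap.mul' k H ∘ₗ
      TensorProduct.map (S k H).toLinearMap (LinearMap.mulLeft k (α k H)))
    LinearMap.id
    ((TensorProduct.assoc k H H H).symm (φInv k H))

/-- `p_L = Y S⁻¹(X β) ⊗ Z`, where `φ = X ⊗ Y ⊗ Z` -/
noncomputable def pL : H ⊗[k] H :=
  TensorProduct.map
    (LinearMap.mul' k H ∘ₗ
      TensorProduct.map LinearMap.id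
        ((S k H).symm.toLinearMap ∘ₗ LinearMap.mulRight k (β k H)) ∘ₗ
      (TensorProduct.comm k H H).toLinearMap)
    LinearMap.id
    ((TensorProduct.assoc k H H H).symm (φ k H))

/-- `γ = (S(U) ⊗ S(T)) (α ⊗ α) (V ⊗ W)`, where
`T ⊗ U ⊗ V ⊗ W = (1 ⊗ φ⁻¹) (id ⊗ id ⊗ Δ)(φ)` -/
noncomputable def γ : H ⊗[k] H :=
  LinearMap.mul' k (H ⊗[k] H)
    (TensorProduct.map
      (SS k H ∘ₗ swap k H)
      (LinearMap.mulLeft k (α k H ⊗ₜ[k] α k H))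
      ((TensorProduct.assoc k H H (H ⊗[k] H)).symm
        (((1 : H) ⊗ₜ[k] φInv k H) *
          Algebra.TensorProduct.map (AlgHom.id k H)
            (Algebra.TensorProduct.map (AlgHom.id k H) (Δ k H)) (φ k H))))

/-- Drinfeld's twist `f = (S ⊗ S)(Δᵒᵖ(X)) γ Δ(Y β S(Z))`, where `φ⁻¹ = X ⊗ Y ⊗ Z`; recall that
`X ⊗ Y β S(Z) = p_R`. -/
noncomputable def twist : H ⊗[k] H :=
  LinearMap.mul' k (H ⊗[k] H)
    (TensorProduct.map
      (SS k H ∘ₗ swap k H ∘ₗ (Δ k H).toLinearMap)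
      (LinearMap.mulLeft k (γ k H) ∘ₗ (Δ k H).toLinearMap)
      (pR k H))

/-- the inverse `f⁻¹` of the Drinfeld twist (which is always invertible) in the algebra `H ⊗ H` -/
noncomputable def twistInv : H ⊗[k] H := Ring.inverse (twist k H)

/-- `h = (S⁻¹ ⊗ S⁻¹)(f²¹)` -/
noncomputable def twistH : H ⊗[k] H := SSInv k H (swap k H (twist k H))

/-- `U = f⁻¹ (S ⊗ S)(q_R²¹)` -/
noncomputable def U : H ⊗[k] H := twistInv k H * SS k H (swap k H (qR k H))

/-- `V = (S⁻¹ ⊗ S⁻¹)(p_R²¹) h` -/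
noncomputable def V : H ⊗[k] H := SSInv k H (swap k H (pR k H)) * twistH k H

end Elements

section Actions

/-- Two linear families of operators `A → End P`, `B → End Q` give `A ⊗ B → End (P ⊗ Q)`,
`(a ⊗ b)(x ⊗ y) = a x ⊗ b y`. -/
noncomputable def tensorAct {k A B P Q : Type*} [Field k] [Ring A] [Algebra k A]
    [Ring B] [Algebra k B] [AddCommGroup P] [Module k P] [AddCommGroup Q] [Module k Q]
    (l : A →ₗ[k] P →ₗ[k] P) (r : B →ₗ[k] Q →ₗ[k] Q) :
    A ⊗[k] B →ₗ[k] P ⊗[k] Q →ₗ[k] P ⊗[k] Q :=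
  TensorProduct.homTensorHomMap (.id k) P Q P Q ∘ₗ TensorProduct.map l r

variable (k H M : Type*) [Field k] [Ring H] [Algebra k H] [AddCommGroup M] [Module k M]

/-- the left action `a ↦ (m ↦ a · m)` -/
def lAct [Module H M] [IsScalarTower k H M] : H →ₗ[k] M →ₗ[k] M :=
  (Algebra.lsmul k k M : H →ₐ[k] Module.End k M).toLinearMap

/-- the right action `b ↦ (m ↦ m · b)`; a right `H`-module is a module over `Hᵐᵒᵖ` -/
def rAct [Module Hᵐᵒᵖ M] [IsScalarTower k Hᵐᵒᵖ M] : H →ₗ[k] M →ₗ[k] M :=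
  (Algebra.lsmul k k M : Hᵐᵒᵖ →ₐ[k] Module.End k M).toLinearMap ∘ₗ
    (MulOpposite.opLinearEquiv k : H ≃ₗ[k] Hᵐᵒᵖ).toLinearMap

end Actions

/-- `f` is a map of `H`-bimodules. -/
def IsBimoduleMap {k : Type*} (H : Type*) {M N : Type*} [Field k] [Ring H]
    [AddCommGroup M] [Module k M] [Module H M] [Module Hᵐᵒᵖ M]
    [AddCommGroup N] [Module k N] [Module H N] [Module Hᵐᵒᵖ N] (f : M →ₗ[k] N) : Prop :=
  (∀ (a : H) (m : M), f (a • m) = a • f m) ∧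
    ∀ (b : H) (m : M), f (MulOpposite.op b • m) = MulOpposite.op b • f m

/-- A right `H`-coaction `ρ : M → M ⊗ H` that makes the `H`-bimodule `M` a (right) quasi-Hopf
`H`-bimodule. -/
structure RightCoaction (k H M : Type*) [Field k] [Ring H] [Algebra k H] [QuasiHopfAlgebra k H]
    [AddCommGroup M] [Module k M] [Module H M] [Module Hᵐᵒᵖ M] [SMulCommClass H Hᵐᵒᵖ M]
    [IsScalarTower k H M] [IsScalarTower k Hᵐᵒᵖ M] where
  /-- the coaction -/
  coact : M →ₗ[k] M ⊗[k] H
  /-- `ρ(a · m) = Δ(a) · ρ(m)` -/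
  coact_smul : ∀ (a : H) (m : M),
    coact (a • m) = tensorAct (lAct k H M) (lAct k H H) (Δ k H a) (coact m)
  /-- `ρ(m · b) = ρ(m) · Δ(b)` -/
  coact_op_smul : ∀ (b : H) (m : M),
    coact (MulOpposite.op b • m) = tensorAct (rAct k H M) (rAct k H H) (Δ k H b) (coact m)
  /-- `(id ⊗ ε) ∘ ρ = id` -/
  counit_coact : ∀ m : M,
    TensorProduct.rid k M (TensorProduct.map LinearMap.id (ε k H).toLinearMap (coact m)) = m
  /-- `φ · (ρ ⊗ id)(ρ(m)) = (id ⊗ Δ)(ρ(m)) · φ` -/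
  quasi_coassoc : ∀ m : M,
    tensorAct (lAct k H M) (tensorAct (lAct k H H) (lAct k H H)) (φ k H)
        (TensorProduct.assoc k M H H (TensorProduct.map coact LinearMap.id (coact m))) =
      tensorAct (rAct k H M) (tensorAct (rAct k H H) (rAct k H H)) (φ k H)
        (TensorProduct.map LinearMap.id (Δ k H).toLinearMap (coact m))

/-- A left `H`-coaction `Λ : K → H ⊗ K` that makes the `H`-bimodule `K` a left quasi-Hopf
`H`-bimodule. -/
structure LeftCoaction (k H K : Type*) [Field k] [Ring H] [Algebra k H] [QuasiHopfAlgebra k H]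
    [AddCommGroup K] [Module k K] [Module H K] [Module Hᵐᵒᵖ K] [SMulCommClass H Hᵐᵒᵖ K]
    [IsScalarTower k H K] [IsScalarTower k Hᵐᵒᵖ K] where
  /-- the coaction -/
  coact : K →ₗ[k] H ⊗[k] K
  /-- `Λ(a · x) = Δ(a) · Λ(x)` -/
  coact_smul : ∀ (a : H) (x : K),
    coact (a • x) = tensorAct (lAct k H H) (lAct k H K) (Δ k H a) (coact x)
  /-- `Λ(x · b) = Λ(x) · Δ(b)` -/
  coact_op_smul : ∀ (b : H) (x : K),
    coact (MulOpposite.op b • x) = tensorAct (rAct k H H) (rAct k H K) (Δ k H b) (coact x)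
  /-- `(ε ⊗ id) ∘ Λ = id` -/
  counit_coact : ∀ x : K,
    TensorProduct.lid k K (TensorProduct.map (ε k H).toLinearMap LinearMap.id (coact x)) = x
  /-- `(id ⊗ Λ)(Λ(x)) · φ = φ · (Δ ⊗ id)(Λ(x))` -/
  quasi_coassoc : ∀ x : K,
    tensorAct (rAct k H H) (tensorAct (rAct k H H) (rAct k H K)) (φ k H)
        (TensorProduct.map LinearMap.id coact (coact x)) =
      tensorAct (lAct k H H) (tensorAct (lAct k H H) (lAct k H K)) (φ k H)
        (TensorProduct.assoc k H H K
          (TensorProduct.map (Δ k H).toLinearMap LinearMap.id (coact x)))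

/-- `f : M → N` is a morphism of (right) quasi-Hopf `H`-bimodules with coactions `ρM`, `ρN`:
a map of `H`-bimodules with `(f ⊗ id) ∘ ρM = ρN ∘ f`. -/
def IsQuasiHopfMorphism {k H M N : Type*} [Field k] [Ring H] [Algebra k H]
    [AddCommGroup M] [Module k M] [Module H M] [Module Hᵐᵒᵖ M]
    [AddCommGroup N] [Module k N] [Module H N] [Module Hᵐᵒᵖ N]
    (ρM : M →ₗ[k] M ⊗[k] H) (ρN : N →ₗ[k] N ⊗[k] H) (f : M →ₗ[k] N) : Prop :=
  IsBimoduleMap H f ∧ TensorProduct.map f LinearMap.id ∘ₗ ρM = ρN ∘ₗ f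

/-- The linear dual `K* = Hom_k(K, k)`, as a type of its own that carries the `H`-bimodule
structure `⟨a · ψ · b | x⟩ = ⟨ψ | S⁻¹(a) · x · S(b)⟩`. -/
def BimodDual (k : Type*) (_H K : Type*) [Field k] [AddCommGroup K] [Module k K] : Type _ :=
  Module.Dual k K

namespace BimodDual

section Linear

variable (k H K : Type*) [Field k] [AddCommGroup K] [Module k K]

instance : AddCommGroup (BimodDual k H K) := inferInstanceAs (AddCommGroup (Module.Dual k K))

instance : Module k (BimodDual k H K) := inferInstanceAs (Module k (Module.Dual k K))

/-- the identity, `K* = Hom_k(K, k)` -/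
def equiv : BimodDual k H K ≃ₗ[k] Module.Dual k K := LinearEquiv.refl k (Module.Dual k K)

end Linear

section Bimodule

set_option linter.unusedSectionVars false

variable {k H K : Type*} [Field k] [Ring H] [Algebra k H] [QuasiHopfAlgebra k H]
  [AddCommGroup K] [Module k K] [Module H K] [Module Hᵐᵒᵖ K] [SMulCommClass H Hᵐᵒᵖ K]
  [IsScalarTower k H K] [IsScalarTower k Hᵐᵒᵖ K]

/-- `⟨a · ψ | x⟩ = ⟨ψ | S⁻¹(a) · x⟩` -/
noncomputable instance : SMul H (BimodDual k H K) where
  smul a ψ := (equiv k H K).symm (equiv k H K ψ ∘ₗ lAct k H K ((S k H).symm a))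

/-- `⟨ψ · b | x⟩ = ⟨ψ | x · S(b)⟩` -/
noncomputable instance : SMul Hᵐᵒᵖ (BimodDual k H K) where
  smul b ψ := (equiv k H K).symm (equiv k H K ψ ∘ₗ rAct k H K (S k H b.unop))

theorem smul_apply (a : H) (ψ : BimodDual k H K) (x : K) :
    equiv k H K (a • ψ) x = equiv k H K ψ ((S k H).symm a • x) := rfl

theorem op_smul_apply (b : Hᵐᵒᵖ) (ψ : BimodDual k H K) (x : K) :
    equiv k H K (b • ψ) x = equiv k H K ψ (MulOpposite.op (S k H b.unop) • x) := rfl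

theorem ext_equiv {ψ χ : BimodDual k H K} (e : ∀ x, equiv k H K ψ x = equiv k H K χ x) :
    ψ = χ :=
  (equiv k H K).injective (LinearMap.ext e)

theorem S_one : S k H 1 = 1 := QuasiHopfAlgebra.antipode_one

theorem S_mul (a b : H) : S k H (a * b) = S k H b * S k H a := QuasiHopfAlgebra.antipode_mul a b

theorem S_symm_one : (S k H).symm 1 = 1 := by
  rw [LinearEquiv.symm_apply_eq, S_one]

theorem S_symm_mul (a b : H) : (S k H).symm (a * b) = (S k H).symm b * (S k H).symm a := by
  rw [LinearEquiv.symm_apply_eq, S_mul, LinearEquiv.apply_symm_apply, LinearEquiv.apply_symm_apply]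

noncomputable instance : Module H (BimodDual k H K) where
  one_smul ψ := ext_equiv fun x => by rw [smul_apply, S_symm_one, one_smul]
  mul_smul a b ψ := ext_equiv fun x => by
    rw [smul_apply, smul_apply, smul_apply, S_symm_mul, mul_smul]
  smul_zero a := ext_equiv fun x => by simp [smul_apply]
  smul_add a ψ χ := ext_equiv fun x => by simp [smul_apply]
  add_smul a b ψ := ext_equiv fun x => by simp [smul_apply, add_smul]
  zero_smul ψ := ext_equiv fun x => by simp [smul_apply]

noncomputable instance : Module Hᵐᵒᵖ (BimodDual k H K) where
  one_smul ψ := ext_equiv fun x => by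
    rw [op_smul_apply, MulOpposite.unop_one, S_one, MulOpposite.op_one, one_smul]
  mul_smul a b ψ := ext_equiv fun x => by
    rw [op_smul_apply, op_smul_apply, op_smul_apply, MulOpposite.unop_mul, S_mul,
      MulOpposite.op_mul, mul_smul]
  smul_zero a := ext_equiv fun x => by simp [op_smul_apply]
  smul_add a ψ χ := ext_equiv fun x => by simp [op_smul_apply]
  add_smul a b ψ := ext_equiv fun x => by simp [op_smul_apply, add_smul]
  zero_smul ψ := ext_equiv fun x => by simp [op_smul_apply]

instance : SMulCommClass H Hᵐᵒᵖ (BimodDual k H K) where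
  smul_comm a b ψ := ext_equiv fun x => by
    rw [smul_apply, op_smul_apply, op_smul_apply, smul_apply]
    exact congrArg _ (smul_comm _ _ _).symm

instance : IsScalarTower k H (BimodDual k H K) where
  smul_assoc c a ψ := ext_equiv fun x => by simp [smul_apply]

instance : IsScalarTower k Hᵐᵒᵖ (BimodDual k H K) where
  smul_assoc c a ψ := ext_equiv fun x => by simp [op_smul_apply]

end Bimodule

end BimodDual

section DualCoaction

variable {k H K : Type*} [Field k] [Ring H] [Algebra k H]
  [AddCommGroup K] [Module k K]

theorem bijective_dualTensorHom (fin : Module.Finite k H ∨ Module.Finite k K) :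
    Function.Bijective (dualTensorHom k K H) := by
  rcases fin with _ | _
  · exact dualTensorHom_bijective_of_finite_projective_right
  · exact dualTensorHom_bijective

/-- If `H` or `K` is finite-dimensional, the canonical map `K* ⊗ H → Hom_k(K, H)`,
`ψ ⊗ a ↦ (x ↦ ψ(x) a)`, is an isomorphism. -/
noncomputable def dualTensorEquiv (fin : Module.Finite k H ∨ Module.Finite k K) :
    BimodDual k H K ⊗[k] H ≃ₗ[k] (K →ₗ[k] H) :=
  TensorProduct.congr (BimodDual.equiv k H K) (LinearEquiv.refl k H) ≪≫ₗ
    LinearEquiv.ofBijective (dualTensorHom k K H) (bijective_dualTensorHom fin)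

variable [QuasiHopfAlgebra k H] [Module H K] [Module Hᵐᵒᵖ K] [SMulCommClass H Hᵐᵒᵖ K]
  [IsScalarTower k H K] [IsScalarTower k Hᵐᵒᵖ K]

/-- `Λ̄(x) = V · Λ(x) · U` -/
noncomputable def barCoaction (Λ : LeftCoaction k H K) : K →ₗ[k] H ⊗[k] K :=
  tensorAct (lAct k H H) (lAct k H K) (V k H) ∘ₗ
    tensorAct (rAct k H H) (rAct k H K) (U k H) ∘ₗ Λ.coact

/-- The dual coaction `ρ_{K*} : K* → K* ⊗ H ≅ Hom_k(K, H)`,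
`[ρ_{K*}(ψ)](x) = (id ⊗ ψ)(Λ̄(x))`. -/
noncomputable def dualCoaction (Λ : LeftCoaction k H K)
    (fin : Module.Finite k H ∨ Module.Finite k K) :
    BimodDual k H K →ₗ[k] BimodDual k H K ⊗[k] H :=
  (dualTensorEquiv fin).symm.toLinearMap ∘ₗ
    { toFun := fun ψ =>
        (TensorProduct.rid k H).toLinearMap ∘ₗ
          TensorProduct.map LinearMap.id (BimodDual.equiv k H K ψ) ∘ₗ barCoaction Λ
      map_add' := fun ψ χ => by
        rw [map_add, TensorProduct.map_add_right, LinearMap.add_comp, LinearMap.comp_add]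
      map_smul' := fun c ψ => by
        rw [map_smul, TensorProduct.map_smul_right, LinearMap.smul_comp, LinearMap.comp_smul,
          RingHom.id_apply] }

end DualCoaction

section Forms

variable {k H K M : Type*} [Field k] [Ring H] [Algebra k H] [QuasiHopfAlgebra k H]
  [AddCommGroup K] [Module k K] [Module H K] [Module Hᵐᵒᵖ K] [SMulCommClass H Hᵐᵒᵖ K]
  [IsScalarTower k H K] [IsScalarTower k Hᵐᵒᵖ K]
  [AddCommGroup M] [Module k M] [Module H M] [Module Hᵐᵒᵖ M] [SMulCommClass H Hᵐᵒᵖ M]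
  [IsScalarTower k H M] [IsScalarTower k Hᵐᵒᵖ M]

variable (H) in
/-- `H`-biinvariance of a bilinear form `σ : K ⊗ M → k`:
`σ((x ⊗ m) · Δ(a)) = ε(a) σ(x ⊗ m) = σ(Δ(a) · (x ⊗ m))`. -/
def IsBiinvariant (σ : K ⊗[k] M →ₗ[k] k) : Prop :=
  ∀ (a : H) (x : K) (m : M),
    σ (tensorAct (rAct k H K) (rAct k H M) (Δ k H a) (x ⊗ₜ[k] m)) =
        ε k H a * σ (x ⊗ₜ[k] m) ∧
      ε k H a * σ (x ⊗ₜ[k] m) =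
        σ (tensorAct (lAct k H K) (lAct k H M) (Δ k H a) (x ⊗ₜ[k] m))

/-- `H`-cocentrality of a bilinear form `σ : K ⊗ M → k`:
`(id ⊗ σ)(φ · [Λ(x) ⊗ m] · φ⁻¹) = (σ ⊗ id)(φ⁻¹ · [x ⊗ ρ(m)] · φ)` in `H`. -/
def IsCocentral (Λ : LeftCoaction k H K) (ρ : RightCoaction k H M)
    (σ : K ⊗[k] M →ₗ[k] k) : Prop :=
  ∀ (x : K) (m : M),
    TensorProduct.rid k H (TensorProduct.map LinearMap.id σ
      (tensorAct (lAct k H H) (tensorAct (lAct k H K) (lAct k H M)) (φ k H)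
        (tensorAct (rAct k H H) (tensorAct (rAct k H K) (rAct k H M)) (φInv k H)
          (TensorProduct.assoc k H K M (Λ.coact x ⊗ₜ[k] m))))) =
    TensorProduct.lid k H (TensorProduct.map σ LinearMap.id
      ((TensorProduct.assoc k K M H).symm
        (tensorAct (lAct k H K) (tensorAct (lAct k H M) (lAct k H H)) (φInv k H)
          (tensorAct (rAct k H K) (tensorAct (rAct k H M) (rAct k H H)) (φ k H)
            (x ⊗ₜ[k] ρ.coact m)))))

/-- `Σ_f(x ⊗ m) = ⟨f(m) | S⁻¹(α) · x · β⟩` -/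
noncomputable def formOfMap (f : M →ₗ[k] BimodDual k H K) : K ⊗[k] M →ₗ[k] k :=
  TensorProduct.lift
    (LinearMap.flip ((BimodDual.equiv k H K).toLinearMap ∘ₗ f) ∘ₗ
      lAct k H K ((S k H).symm (α k H)) ∘ₗ rAct k H K (β k H))

/-- For `p, q ∈ H ⊗ H`, the map `f_σ : M → K*`, `⟨f_σ(m) | x⟩ = σ(p · (x ⊗ m) · q)`. -/
noncomputable def mapOfForm (p q : H ⊗[k] H) (σ : K ⊗[k] M →ₗ[k] k) :
    M →ₗ[k] BimodDual k H K :=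
  (BimodDual.equiv k H K).symm.toLinearMap ∘ₗ
    LinearMap.flip (TensorProduct.curry
      (σ ∘ₗ tensorAct (lAct k H K) (lAct k H M) p ∘ₗ tensorAct (rAct k H K) (rAct k H M) q))

end Forms

end QuasiHopf

open QuasiHopf

/-!
The proof is a calculation with elements of tensor powers of `H`, organized by *legs*: an algebra
map `H → R` is a leg of `R`, `Φ f g h` is the reassociator placed on three commuting legs, and
`conv f g` places `Δ(a)` on two of them. In this language quasi-coassociativity and the pentagon hold
for arbitrary commuting legs (`conv_assoc_mul_Φ`, `pentagon`). The antipode axioms enter through linear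
maps `E : R → V` that *collapse* a pair of legs, that is, replace `a₁ ⊗ a₂` on these legs by `ε(a)`.
Under such an `E`, a reassociator with `Δ` on a collapsed pair of legs disappears, as `φ` is
normalized, and each identity between `φ`, `S`, `α`, `β` becomes a pentagon with some of its factors
dropped.

Four families of identities come out. First, `p_R`, `p_L`, `q_R`, `q_L` satisfy commutation rules such
as `Δ(a₁) p_R (1 ⊗ S(a₂)) = p_R (a ⊗ 1)` (`opR_comul` and its three variants) and cancel each other,
as in `Δ(q_R¹) p_R (1 ⊗ S(q_R²)) = 1` (`opR_qR`, `oqR_pR`, `opL_qL`, `oqL_pL`). Applied to a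
biinvariant form `σ`, which turns `Δ(a)` into `ε(a)`, they say that `f_σ` is a bimodule map with
`Σ_{f_σ} = σ`; the equality `f_{Σ_f} = f` only needs the antipode axioms for `φ`. That is part (i), and
independence of `p` and `q` follows, as every `σ ↦ f_σ` inverts `f ↦ Σ_f`.

For part (ii) let `F` be the Drinfeld twist and `τ(x ⊗ y) = S(y) ⊗ S(x)`. Then `F Δ(S(a)) = τ(Δ(a)) F`
and `F Δ(α) = γ` (`twist_mul_comul`, `twist_mul_comul_alpha`), and a five-leg identity gives
`F Δ(q_L¹) p_R (1 ⊗ S(q_L²)) = τ(q_R)` (`twist_mul_opR_qL`). This yields a right inverse of `F`, and a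
six-leg identity yields a left inverse (`deltaMul_qR_mul_twist`). So `F` is a unit, and the elements
`U`, `V` of the dual coaction take the form `U = Δ(q_L¹) p_R (1 ⊗ S(q_L²))` and
`V = (1 ⊗ S⁻¹(p_L²)) q_R Δ(p_L¹)` (`U_eq`, `V_eq`), from which the twist has disappeared. With these
expressions the commutation and cancellation rules show that `ρ_{K*}` is compatible with the bimodule
structure and that cocentrality of `Σ_f` reads
`q_L · ρ_{K*}(f(m)) · p_L = q_L · (f ⊗ id)(ρ(m)) · p_L` for all `m` (`evalAt_act_dualCoaction`,
`cocentral_right_formOfMap`). Here `q_L` and `p_L` can be cancelled, because both sides come from maps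
`W` with `W(a · m · b) = Δ(a) · W(m) · Δ(b)` (`eq_of_qL_act_pL`).
-/

namespace QuasiHopf

/-! ### Tensors placed on commuting legs of an algebra -/

section Induction

variable {k H : Type*} [Field k] [Ring H] [Algebra k H]

theorem tensor_induction₂ {P : H ⊗[k] H → Prop}
    (pure : ∀ a b, P (a ⊗ₜ b)) (add : ∀ s t, P s → P t → P (s + t)) (t) : P t := by
  induction t using TensorProduct.induction_on with
  | zero => simpa using pure 0 0
  | add s t hs ht => exact add s t hs ht
  | tmul a t => exact pure a t

theorem tensor_induction₃ {P : H ⊗[k] (H ⊗[k] H) → Prop}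
    (pure : ∀ a b c, P (a ⊗ₜ (b ⊗ₜ c))) (add : ∀ s t, P s → P t → P (s + t)) (t) : P t := by
  induction t using TensorProduct.induction_on with
  | zero => simpa using pure 0 0 0
  | add s t hs ht => exact add s t hs ht
  | tmul a t =>
    induction t using TensorProduct.induction_on with
    | zero => simpa using pure a 0 0
    | add s t hs ht => rw [TensorProduct.tmul_add]; exact add _ _ hs ht
    | tmul b c => exact pure a b c

end Induction

section Legs

variable {k H R V : Type*} [Field k] [Ring H] [Algebra k H] [Ring R] [Algebra k R]

/-- The images of the algebra maps `f` and `g` commute elementwise. -/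
def Commuting (f g : H →ₐ[k] R) : Prop := ∀ a b, Commute (f a) (g b)

theorem Commuting.symm {f g : H →ₐ[k] R} (c : Commuting f g) : Commuting g f :=
  fun a b => (c b a).symm

/-- `a ⊗ b ⊗ c ↦ f(a) g(b) h(c)`. It is an algebra map when the images of `f`, `g`, `h` commute
(`tri_mul`), but the definition does not ask for that. -/
noncomputable def tri (f g h : H →ₐ[k] R) : H ⊗[k] (H ⊗[k] H) →ₗ[k] R :=
  LinearMap.mul' k R ∘ₗ TensorProduct.map f.toLinearMap
    (LinearMap.mul' k R ∘ₗ TensorProduct.map g.toLinearMap h.toLinearMap)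

@[simp]
theorem tri_tmul (f g h : H →ₐ[k] R) (a b c : H) :
    tri f g h (a ⊗ₜ (b ⊗ₜ c)) = f a * (g b * h c) := rfl

variable {f g h i : H →ₐ[k] R}

theorem tri_mul (fg : Commuting f g) (fh : Commuting f h) (gh : Commuting g h)
    (s t : H ⊗[k] (H ⊗[k] H)) : tri f g h (s * t) = tri f g h s * tri f g h t := by
  induction s using tensor_induction₃ with
  | add s s' hs hs' => rw [add_mul, map_add, map_add, hs, hs', add_mul]
  | pure a b c =>
    induction t using tensor_induction₃ with
    | add s s' hs hs' => rw [mul_add, map_add, map_add, hs, hs', mul_add]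
    | pure a' b' c' =>
      simp only [Algebra.TensorProduct.tmul_mul_tmul, tri_tmul, map_mul]
      have h1 := (gh b' c).eq
      have h2 := (fg a' b).eq
      have h3 := (fh a' c).eq
      calc f a * f a' * (g b * g b' * (h c * h c'))
          = f a * (f a' * g b) * (g b' * h c) * h c' := by simp only [mul_assoc]
        _ = f a * g b * (f a' * h c) * g b' * h c' := by rw [h1, h2]; simp only [mul_assoc]
        _ = _ := by rw [h3]; simp only [mul_assoc]

theorem tri_commute {u : R} (hf : ∀ a, Commute u (f a)) (hg : ∀ a, Commute u (g a))
    (hh : ∀ a, Commute u (h a)) (t) : Commute u (tri f g h t) := by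
  induction t using tensor_induction₃ with
  | add s t hs ht => rw [map_add]; exact hs.add_right ht
  | pure a b c => exact (hf a).mul_right ((hg b).mul_right (hh c))

theorem tri_intertwine {f' g' h' : H →ₐ[k] R} {u : R} (hf : ∀ a, u * f a = f' a * u)
    (hg : ∀ a, u * g a = g' a * u) (hh : ∀ a, u * h a = h' a * u) (t) :
    u * tri f g h t = tri f' g' h' t * u := by
  induction t using tensor_induction₃ with
  | add s t hs ht => rw [map_add, map_add, mul_add, add_mul, hs, ht]
  | pure a b c =>
    rw [tri_tmul, tri_tmul, ← mul_assoc, hf, mul_assoc, ← mul_assoc u, hg, mul_assoc, hh]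
    simp only [mul_assoc]

/-- `a ⊗ b ↦ f(a) g(b)` for algebra maps `f`, `g` with commuting images. -/
noncomputable def pair (f g : H →ₐ[k] R) (c : Commuting f g) : H ⊗[k] H →ₐ[k] R :=
  Algebra.TensorProduct.lift f g c

@[simp]
theorem pair_tmul (c : Commuting f g) (a b : H) : pair f g c (a ⊗ₜ b) = f a * g b :=
  Algebra.TensorProduct.lift_tmul f g c a b

/-- `a ⊗ b ⊗ c ⊗ d ↦ f(a) g(b) h(c) i(d)` for four algebra maps with pairwise commuting images. -/
noncomputable def quad (fg : Commuting f g) (fh : Commuting f h) (fi : Commuting f i)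
    (gh : Commuting g h) (gi : Commuting g i) (hi : Commuting h i) :
    H ⊗[k] (H ⊗[k] (H ⊗[k] H)) →ₐ[k] R :=
  Algebra.TensorProduct.lift f (Algebra.TensorProduct.lift g (pair h i hi)
    fun a t => by
      induction t using tensor_induction₂ with
      | add s t hs ht => rw [map_add]; exact hs.add_right ht
      | pure x y => rw [pair_tmul]; exact (gh a x).mul_right (gi a y))
    fun a t => by
      induction t using tensor_induction₃ with
      | add s t hs ht => rw [map_add]; exact hs.add_right ht
      | pure x y z =>
        rw [Algebra.TensorProduct.lift_tmul, pair_tmul]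
        exact (fg a x).mul_right ((fh a y).mul_right (fi a z))

@[simp]
theorem quad_tmul (fg : Commuting f g) (fh : Commuting f h) (fi : Commuting f i)
    (gh : Commuting g h) (gi : Commuting g i) (hi : Commuting h i) (a b c d : H) :
    quad fg fh fi gh gi hi (a ⊗ₜ (b ⊗ₜ (c ⊗ₜ d))) = f a * (g b * (h c * i d)) := by
  rw [quad, Algebra.TensorProduct.lift_tmul, Algebra.TensorProduct.lift_tmul, pair_tmul]

variable {R' : Type*} [Ring R'] [Algebra k R']

theorem map_tri (G : R →ₐ[k] R') {f' g' h' : H →ₐ[k] R'} (hf : G.comp f = f')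
    (hg : G.comp g = g') (hh : G.comp h = h')
    (t : H ⊗[k] (H ⊗[k] H)) : G (tri f g h t) = tri f' g' h' t := by
  subst hf hg hh
  induction t using tensor_induction₃ with
  | add s t hs ht => simp only [map_add, hs, ht]
  | pure a b c => simp

end Legs

/-! ### The quasi-bialgebra axioms on commuting legs -/

section QuasiLegs

variable {k H R V : Type*} [Field k] [Ring H] [Algebra k H] [QuasiHopfAlgebra k H]
  [Ring R] [Algebra k R]

/-- The algebra map `a ↦ f(a₁) g(a₂)` for algebra maps `f`, `g` with commuting images: the
element `a` is put by `Δ` on the two legs `f` and `g`. -/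
noncomputable def conv (f g : H →ₐ[k] R) (c : Commuting f g) : H →ₐ[k] R :=
  (pair f g c).comp (Δ k H)

variable (k H R) in
/-- The trivial algebra map `a ↦ ε(a) 1`. -/
noncomputable def triv : H →ₐ[k] R := (Algebra.ofId k R).comp (ε k H)

/-- The reassociator `φ` put on the legs `f`, `g`, `h`. -/
noncomputable def Φ (f g h : H →ₐ[k] R) : R := tri f g h (φ k H)

/-- The inverse reassociator `φ⁻¹` put on the legs `f`, `g`, `h`. -/
noncomputable def Φi (f g h : H →ₐ[k] R) : R := tri f g h (φInv k H)

theorem φ_mul_φInv : φ k H * φInv k H = 1 := Units.mul_inv _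

theorem φInv_mul_φ : φInv k H * φ k H = 1 := Units.inv_mul _

variable {f g h i : H →ₐ[k] R}

theorem conv_apply (c : Commuting f g) (a : H) :
    conv f g c a = pair f g c (Δ k H a) := rfl

theorem triv_apply (a : H) : triv k H R a = algebraMap k R (ε k H a) := rfl

theorem Commuting.conv_right (fg : Commuting f g) (fh : Commuting f h) {c : Commuting g h} :
    Commuting f (conv g h c) := by
  intro a b
  rw [conv_apply]
  induction Δ k H b using tensor_induction₂ with
  | add s t hs ht => rw [map_add]; exact hs.add_right ht
  | pure x y => rw [pair_tmul]; exact (fg a x).mul_right (fh a y)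

theorem Commuting.conv_left (fh : Commuting f h) (gh : Commuting g h) {c : Commuting f g} :
    Commuting (conv f g c) h :=
  (fh.symm.conv_right gh.symm).symm

theorem commuting_triv_left : Commuting (triv k H R) f := fun a b =>
  Algebra.commutes (ε k H a) (f b)

theorem commuting_triv_right : Commuting f (triv k H R) := commuting_triv_left.symm

theorem Φ_mul_Φi (fg : Commuting f g) (fh : Commuting f h) (gh : Commuting g h) :
    Φ f g h * Φi f g h = 1 := by
  rw [Φ, Φi, ← tri_mul fg fh gh, φ_mul_φInv]
  simp [Algebra.TensorProduct.one_def]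

theorem Φi_mul_Φ (fg : Commuting f g) (fh : Commuting f h) (gh : Commuting g h) :
    Φi f g h * Φ f g h = 1 := by
  rw [Φ, Φi, ← tri_mul fg fh gh, φInv_mul_φ]
  simp [Algebra.TensorProduct.one_def]

/-- Quasi-coassociativity on three legs. -/
theorem conv_assoc_mul_Φ (fg : Commuting f g) (fh : Commuting f h) (gh : Commuting g h) (a : H) :
    conv f (conv g h gh) (fg.conv_right fh) a * Φ f g h =
      Φ f g h * conv (conv f g fg) h (fh.conv_left gh) a := by
  have := congrArg (tri f g h) (QuasiBialgebra.quasi_coassoc (k := k) a)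
  rw [tri_mul fg fh gh, tri_mul fg fh gh] at this
  have e1 : ∀ v : H ⊗[k] H, tri f g h (Algebra.TensorProduct.map (AlgHom.id k H) (Δ k H) v) =
      pair f (conv g h gh) (fg.conv_right fh) v := by
    intro v
    induction v using tensor_induction₂ with
    | add s t hs ht => simp only [map_add, hs, ht]
    | pure x y =>
      simp only [Algebra.TensorProduct.map_tmul, AlgHom.id_apply,
        pair_tmul, conv_apply]
      induction Δ k H y using tensor_induction₂ with
      | add s t hs ht => simp only [map_add, TensorProduct.tmul_add, mul_add, hs, ht]
      | pure z w => simp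
  have e2 : ∀ v : H ⊗[k] H, tri f g h (TensorProduct.assoc k H H H
      (Algebra.TensorProduct.map (Δ k H) (AlgHom.id k H) v)) =
      pair (conv f g fg) h (fh.conv_left gh) v := by
    intro v
    induction v using tensor_induction₂ with
    | add s t hs ht => simp only [map_add, hs, ht]
    | pure x y =>
      simp only [Algebra.TensorProduct.map_tmul, AlgHom.id_apply,
        pair_tmul, conv_apply]
      induction Δ k H x using tensor_induction₂ with
      | add s t hs ht => simp only [map_add, TensorProduct.add_tmul, add_mul, hs, ht]
      | pure z w => simp [mul_assoc]
  exact (congrArg₂ (· * ·) (e1 _).symm rfl).trans (this.trans (congrArg₂ (· * ·) rfl (e2 _)))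

/-- The pentagon identity on four legs. -/
theorem pentagon (fg : Commuting f g) (fh : Commuting f h) (fi : Commuting f i)
    (gh : Commuting g h) (gi : Commuting g i) (hi : Commuting h i) :
    Φ f g (conv h i hi) * Φ (conv f g fg) h i =
      Φ g h i * Φ f (conv g h gh) i * Φ f g h := by
  have := congrArg (quad fg fh fi gh gi hi) (QuasiBialgebra.pentagon (k := k) (H := H))
  rw [map_mul, map_mul, map_mul] at this
  have e1 : ∀ t : H ⊗[k] (H ⊗[k] H), quad fg fh fi gh gi hi
      (Algebra.TensorProduct.map (AlgHom.id k H)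
        (Algebra.TensorProduct.map (AlgHom.id k H) (Δ k H)) t) = tri f g (conv h i hi) t := by
    intro t
    induction t using tensor_induction₃ with
    | add s t hs ht => simp only [map_add, hs, ht]
    | pure a b c =>
      simp only [Algebra.TensorProduct.map_tmul, AlgHom.id_apply, tri_tmul, conv_apply]
      induction Δ k H c using tensor_induction₂ with
      | add s t hs ht => simp only [map_add, TensorProduct.tmul_add, mul_add, hs, ht]
      | pure z w => simp
  have e2 : ∀ t : H ⊗[k] (H ⊗[k] H), quad fg fh fi gh gi hi
      (TensorProduct.assoc k H H (H ⊗[k] H)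
        (Algebra.TensorProduct.map (Δ k H) (AlgHom.id k (H ⊗[k] H)) t)) =
          tri (conv f g fg) h i t := by
    intro t
    induction t using tensor_induction₃ with
    | add s t hs ht => simp only [map_add, hs, ht]
    | pure a b c =>
      simp only [Algebra.TensorProduct.map_tmul, AlgHom.id_apply, tri_tmul, conv_apply]
      induction Δ k H a using tensor_induction₂ with
      | add s t hs ht => simp only [map_add, TensorProduct.add_tmul, add_mul, hs, ht]
      | pure z w => simp [mul_assoc]
  have e3 : ∀ t : H ⊗[k] (H ⊗[k] H), quad fg fh fi gh gi hi ((1 : H) ⊗ₜ[k] t) = tri g h i t := by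
    intro t
    induction t using tensor_induction₃ with
    | add s t hs ht => simp only [map_add, TensorProduct.tmul_add, hs, ht]
    | pure a b c => simp
  have e4 : ∀ t : H ⊗[k] (H ⊗[k] H), quad fg fh fi gh gi hi
      (TensorProduct.map LinearMap.id (TensorProduct.assoc k H H H).toLinearMap
        (Algebra.TensorProduct.map (AlgHom.id k H)
          (Algebra.TensorProduct.map (Δ k H) (AlgHom.id k H)) t)) =
          tri f (conv g h gh) i t := by
    intro t
    induction t using tensor_induction₃ with
    | add s t hs ht => simp only [map_add, hs, ht]
    | pure a b c =>
      simp only [Algebra.TensorProduct.map_tmul, AlgHom.id_apply, tri_tmul, conv_apply]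
      induction Δ k H b using tensor_induction₂ with
      | add s t hs ht =>
        simp only [map_add, TensorProduct.add_tmul, TensorProduct.tmul_add, add_mul, mul_add, hs, ht]
      | pure z w => simp [mul_assoc]
  have e5 : ∀ t : H ⊗[k] (H ⊗[k] H), quad fg fh fi gh gi hi
      (TensorProduct.map LinearMap.id (TensorProduct.assoc k H H H).toLinearMap
        (TensorProduct.assoc k H (H ⊗[k] H) H (t ⊗ₜ[k] (1 : H)))) = tri f g h t := by
    intro t
    induction t using tensor_induction₃ with
    | add s t hs ht => simp only [map_add, TensorProduct.add_tmul, hs, ht]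
    | pure a b c => simp
  exact (congrArg₂ (· * ·) (e1 _).symm (e2 _).symm).trans (this.trans
    (congrArg₂ (· * ·) (congrArg₂ (· * ·) (e3 _) (e4 _)) (e5 _)))

end QuasiLegs
/-! ### Normalization and rearrangements of the pentagon -/

section Normalization

variable {k H R : Type*} [Field k] [Ring H] [Algebra k H] [QuasiHopfAlgebra k H]
  [Ring R] [Algebra k R] {f g h i : H →ₐ[k] R}

theorem pair_triv_left (c : Commuting (triv k H R) f) (v : H ⊗[k] H) :
    pair (triv k H R) f c v =
      f (TensorProduct.lid k H (TensorProduct.map (ε k H).toLinearMap LinearMap.id v)) := by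
  induction v using tensor_induction₂ with
  | add s t hs ht => simp only [map_add, hs, ht]
  | pure x y => simp [triv_apply, Algebra.smul_def]

theorem pair_triv_right (c : Commuting f (triv k H R)) (v : H ⊗[k] H) :
    pair f (triv k H R) c v =
      f (TensorProduct.rid k H (TensorProduct.map LinearMap.id (ε k H).toLinearMap v)) := by
  induction v using tensor_induction₂ with
  | add s t hs ht => simp only [map_add, hs, ht]
  | pure x y => simp [triv_apply, Algebra.smul_def, Algebra.commutes]

theorem conv_triv_left (c : Commuting (triv k H R) f) : conv (triv k H R) f c = f := by
  ext a
  rw [conv_apply, pair_triv_left]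
  exact congrArg f (QuasiBialgebra.counit_left a)

theorem conv_triv_right (c : Commuting f (triv k H R)) : conv f (triv k H R) c = f := by
  ext a
  rw [conv_apply, pair_triv_right]
  exact congrArg f (QuasiBialgebra.counit_right a)

theorem Φ_triv_middle (f h : H →ₐ[k] R) : Φ f (triv k H R) h = 1 := by
  have e : ∀ t : H ⊗[k] (H ⊗[k] H), tri f (triv k H R) h t =
      LinearMap.mul' k R (TensorProduct.map f.toLinearMap h.toLinearMap
        (TensorProduct.map LinearMap.id ((TensorProduct.lid k H).toLinearMap ∘ₗ
          TensorProduct.map (ε k H).toLinearMap LinearMap.id) t)) := by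
    intro t
    induction t using tensor_induction₃ with
    | add s t hs ht => simp only [map_add, hs, ht]
    | pure a b c => simp [triv_apply, Algebra.smul_def]
  refine (e _).trans ((congrArg _ (congrArg _ QuasiBialgebra.counit_reassoc)).trans ?_)
  simp [Algebra.TensorProduct.one_def]

/-- Normalization in the outer leg follows from the pentagon: with the counit on its first two
legs, it says that the invertible element `(ε ⊗ id ⊗ id)(φ)` is idempotent. -/
theorem Φ_triv_left (gh : Commuting g h) : Φ (triv k H R) g h = 1 := by
  have p := pentagon (f := triv k H R) (g := triv k H R) commuting_triv_left commuting_triv_left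
    commuting_triv_left commuting_triv_left commuting_triv_left gh
  rw [conv_triv_left, conv_triv_left, Φ_triv_middle, Φ_triv_middle, one_mul, mul_one] at p
  have q := Φ_mul_Φi (k := k) (commuting_triv_left (f := g)) commuting_triv_left gh
  calc Φ (triv k H R) g h
      = Φ (triv k H R) g h * (Φ (triv k H R) g h * Φi (triv k H R) g h) := by rw [q, mul_one]
    _ = 1 := by rw [← mul_assoc, ← p, q]

/-- Normalization in the last leg, as in `Φ_triv_left`. -/
theorem Φ_triv_right (fg : Commuting f g) : Φ f g (triv k H R) = 1 := by
  have p := pentagon (h := triv k H R) (i := triv k H R) fg commuting_triv_right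
    commuting_triv_right commuting_triv_right commuting_triv_right commuting_triv_right
  rw [conv_triv_right, conv_triv_right, Φ_triv_middle, Φ_triv_middle, mul_one, one_mul] at p
  have q := Φ_mul_Φi (k := k) fg (commuting_triv_right (f := f)) commuting_triv_right
  calc Φ f g (triv k H R)
      = Φ f g (triv k H R) * (Φ f g (triv k H R) * Φi f g (triv k H R)) := by rw [q, mul_one]
    _ = 1 := by
      rw [← mul_assoc, ← p, q]

theorem eq_one_of_mul_eq_one {x y : R} (h : x * y = 1) (hx : x = 1) : y = 1 := by
  rw [hx, one_mul] at h; exact h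

theorem Φi_triv_left (gh : Commuting g h) : Φi (triv k H R) g h = 1 :=
  eq_one_of_mul_eq_one (Φ_mul_Φi commuting_triv_left commuting_triv_left gh) (Φ_triv_left gh)

theorem Φi_triv_middle (fh : Commuting f h) : Φi f (triv k H R) h = 1 :=
  eq_one_of_mul_eq_one (Φ_mul_Φi commuting_triv_right fh commuting_triv_left) (Φ_triv_middle f h)

theorem Φi_triv_right (fg : Commuting f g) : Φi f g (triv k H R) = 1 :=
  eq_one_of_mul_eq_one (Φ_mul_Φi fg commuting_triv_right commuting_triv_right) (Φ_triv_right fg)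

section Pentagon

variable (fg : Commuting f g) (fh : Commuting f h) (fi : Commuting f i)
    (gh : Commuting g h) (gi : Commuting g i) (hi : Commuting h i)
include fg fh fi gh gi hi

theorem pentagon_left : Φ (conv f g fg) h i * Φi f g h =
    Φi f g (conv h i hi) * Φ g h i * Φ f (conv g h gh) i := by
  have p := pentagon fg fh fi gh gi hi
  have q := Φi_mul_Φ fg (fh.conv_right fi (c := hi)) (gh.conv_right gi)
  have q' := Φ_mul_Φi fg fh gh
  calc _ = Φi f g (conv h i hi) * Φ f g (conv h i hi) * Φ (conv f g fg) h i * Φi f g h := by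
        rw [q, one_mul]
    _ = Φi f g (conv h i hi) * (Φ g h i * Φ f (conv g h gh) i * Φ f g h) * Φi f g h := by
        rw [← p]; simp only [mul_assoc]
    _ = _ := by simp only [mul_assoc, q', mul_one]

theorem pentagon_left_inv : Φ f g h * Φi (conv f g fg) h i =
    Φi f (conv g h gh) i * Φi g h i * Φ f g (conv h i hi) := by
  have p := pentagon fg fh fi gh gi hi
  have q := Φ_mul_Φi (fh.conv_left gh (c := fg)) (fi.conv_left gi) hi
  have q' := Φi_mul_Φ (fg.conv_right fh (c := gh)) fi (gi.conv_left hi)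
  have q'' := Φi_mul_Φ gh gi hi
  calc _ = Φi f (conv g h gh) i * Φi g h i * (Φ g h i * Φ f (conv g h gh) i * Φ f g h) *
          Φi (conv f g fg) h i := by
        rw [mul_assoc _ (Φi g h i), ← mul_assoc (Φi g h i), ← mul_assoc (Φi g h i), q'', one_mul,
          ← mul_assoc (Φi f _ i), q', one_mul]
    _ = _ := by rw [← p]; simp only [mul_assoc, q, mul_one]

theorem pentagon_right : Φi f g (conv h i hi) * Φ g h i =
    Φ (conv f g fg) h i * Φi f g h * Φi f (conv g h gh) i := by
  rw [pentagon_left fg fh fi gh gi hi, mul_assoc,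
    Φ_mul_Φi (fg.conv_right fh (c := gh)) fi (gi.conv_left hi), mul_one]

theorem pentagon_right_inv : Φi g h i * Φ f g (conv h i hi) =
    Φ f (conv g h gh) i * Φ f g h * Φi (conv f g fg) h i := by
  rw [mul_assoc, pentagon_left_inv fg fh fi gh gi hi, ← mul_assoc, ← mul_assoc,
    Φ_mul_Φi (fg.conv_right fh (c := gh)) fi (gi.conv_left hi), one_mul]

theorem pentagon_inv : Φi f g h * Φi f (conv g h gh) i * Φi g h i =
    Φi (conv f g fg) h i * Φi f g (conv h i hi) := by
  have p := pentagon_left_inv fg fh fi gh gi hi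
  have q := Φ_mul_Φi fg (fh.conv_right fi (c := hi)) (gh.conv_right gi)
  have q' := Φi_mul_Φ fg fh gh
  calc _ = Φi f g h * (Φi f (conv g h gh) i * Φi g h i * Φ f g (conv h i hi)) *
        Φi f g (conv h i hi) := by simp only [mul_assoc, q, mul_one]
    _ = _ := by rw [← p, ← mul_assoc, q', one_mul]

end Pentagon

end Normalization

/-! ### Linear maps that collapse pairs of legs -/

section Exchange

variable {k H R V : Type*} [Field k] [Ring H] [Algebra k H] [Ring R] [Algebra k R]
  [AddCommGroup V] [Module k V]

/-- `x` and `y` may be exchanged for each other under `E`, between a left factor in `C` and a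
right factor in `D`. -/
def EqUnder (E : R →ₗ[k] V) (C D : Submonoid R) (x y : R) : Prop :=
  ∀ u ∈ C, ∀ v ∈ D, E (u * x * v) = E (u * y * v)

/-- The elements that commute with the leg `c`. -/
def cent (c : H →ₐ[k] R) : Submonoid R := Submonoid.centralizer (Set.range c)

variable {E : R →ₗ[k] V} {C D : Submonoid R} {c f g h f' g' h' : H →ₐ[k] R}

theorem mem_cent {x : R} : x ∈ cent c ↔ ∀ a, Commute (c a) x := by
  simp [cent, Submonoid.mem_centralizer_iff, Commute, SemiconjBy]

theorem Commuting.mem_cent (fc : Commuting f c) (a : H) : f a ∈ cent c :=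
  QuasiHopf.mem_cent.2 fun b => (fc a b).symm

theorem tri_mem_cent (fc : Commuting f c) (gc : Commuting g c) (hc : Commuting h c) (t) :
    tri f g h t ∈ cent c :=
  QuasiHopf.mem_cent.2 fun b => tri_commute (fun a => (fc a b).symm) (fun a => (gc a b).symm)
    (fun a => (hc a b).symm) t

theorem EqUnder.mul_mul {x y u v : R} (e : EqUnder E C D x y) (hu : u ∈ C) (hv : v ∈ D) :
    EqUnder E C D (u * x * v) (u * y * v) := by
  intro u' hu' v' hv'
  have := e (u' * u) (C.mul_mem hu' hu) (v * v') (D.mul_mem hv hv')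
  simpa only [mul_assoc] using this

theorem EqUnder.mul_left {x y u : R} (e : EqUnder E C D x y) (hu : u ∈ C) :
    EqUnder E C D (u * x) (u * y) := by
  simpa using e.mul_mul hu D.one_mem

theorem EqUnder.mul_right {x y v : R} (e : EqUnder E C D x y) (hv : v ∈ D) :
    EqUnder E C D (x * v) (y * v) := by
  simpa using e.mul_mul C.one_mem hv

theorem EqUnder.add {x y x' y' : R} (e : EqUnder E C D x y) (e' : EqUnder E C D x' y') :
    EqUnder E C D (x + x') (y + y') := by
  intro u hu v hv
  simp only [mul_add, add_mul, map_add, e u hu v hv, e' u hu v hv]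

theorem EqUnder.tri₁ (e : ∀ a, EqUnder E C D (f a) (f' a)) (hg : ∀ a, g a ∈ D)
    (hh : ∀ a, h a ∈ D) (t) : EqUnder E C D (tri f g h t) (tri f' g h t) := by
  induction t using tensor_induction₃ with
  | add s t hs ht => rw [map_add, map_add]; exact hs.add ht
  | pure x y z => exact (e x).mul_right (D.mul_mem (hg y) (hh z))

theorem EqUnder.tri₂ (e : ∀ a, EqUnder E C D (g a) (g' a)) (hf : ∀ a, f a ∈ C)
    (hh : ∀ a, h a ∈ D) (t) : EqUnder E C D (tri f g h t) (tri f g' h t) := by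
  induction t using tensor_induction₃ with
  | add s t hs ht => rw [map_add, map_add]; exact hs.add ht
  | pure x y z => exact ((e y).mul_right (hh z)).mul_left (hf x)

theorem EqUnder.tri₃ (e : ∀ a, EqUnder E C D (h a) (h' a)) (hf : ∀ a, f a ∈ C)
    (hg : ∀ a, g a ∈ C) (t) : EqUnder E C D (tri f g h t) (tri f g h' t) := by
  induction t using tensor_induction₃ with
  | add s t hs ht => rw [map_add, map_add]; exact hs.add ht
  | pure x y z => exact ((e z).mul_left (hg y)).mul_left (hf x)

end Exchange

section Collapse

variable {k H R V : Type*} [Field k] [Ring H] [Algebra k H] [QuasiHopfAlgebra k H]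
  [Ring R] [Algebra k R] [AddCommGroup V] [Module k V]

/-- `E(t c(a)) = ε(a) E(t)`. Typically `c = conv f g` and `E` contains a factor `f(x) β S(g(y))`,
so that this is `a₁ β S(a₂) = ε(a) β`. -/
def RightCollapse (E : R →ₗ[k] V) (c : H →ₐ[k] R) : Prop :=
  ∀ (t : R) (a : H), E (t * c a) = ε k H a • E t

/-- `E(c(a) t) = ε(a) E(t)`. Typically `c = conv f g` and `E` contains a factor `S(f(x)) α g(y)`,
so that this is `S(a₁) α a₂ = ε(a) α`. -/
def LeftCollapse (E : R →ₗ[k] V) (c : H →ₐ[k] R) : Prop :=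
  ∀ (t : R) (a : H), E (c a * t) = ε k H a • E t

variable {E : R →ₗ[k] V} {C D : Submonoid R} {c f g h f' g' h' : H →ₐ[k] R}

theorem Φ_mem_cent (fc : Commuting f c) (gc : Commuting g c) (hc : Commuting h c) :
    Φ f g h ∈ cent c := tri_mem_cent fc gc hc _

theorem Φi_mem_cent (fc : Commuting f c) (gc : Commuting g c) (hc : Commuting h c) :
    Φi f g h ∈ cent c := tri_mem_cent fc gc hc _

/-- A leg that `E` collapses on the right may be replaced by the counit wherever only elements that
commute with it stand to its right. -/
theorem RightCollapse.eqUnder (hE : RightCollapse E c) (a : H) :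
    EqUnder E ⊤ (cent c) (c a) (triv k H R a) := by
  intro u _ v hv
  rw [mul_assoc, (QuasiHopf.mem_cent.1 hv a).eq, ← mul_assoc, hE, triv_apply, mul_assoc,
    ← Algebra.smul_def, mul_smul_comm, map_smul]

/-- A leg that `E` collapses on the left may be replaced by the counit wherever only elements that
commute with it stand to its left. -/
theorem LeftCollapse.eqUnder (hE : LeftCollapse E c) (a : H) :
    EqUnder E (cent c) ⊤ (c a) (triv k H R a) := by
  intro u hu v _
  rw [← (QuasiHopf.mem_cent.1 hu a).eq, mul_assoc, hE, triv_apply, mul_assoc,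
    ← Algebra.smul_def, mul_smul_comm, map_smul]

theorem EqUnder.conv₁ (e : ∀ a, EqUnder E C D (f a) (f' a)) (hg : ∀ a, g a ∈ D)
    (fg : Commuting f g) (fg' : Commuting f' g) (a : H) :
    EqUnder E C D (conv f g fg a) (conv f' g fg' a) := by
  rw [conv_apply, conv_apply]
  induction Δ k H a using tensor_induction₂ with
  | add s t hs ht => rw [map_add, map_add]; exact hs.add ht
  | pure x y => rw [pair_tmul, pair_tmul]; exact (e x).mul_right (hg y)

theorem EqUnder.conv₂ (e : ∀ a, EqUnder E C D (g a) (g' a)) (hf : ∀ a, f a ∈ C)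
    (fg : Commuting f g) (fg' : Commuting f g') (a : H) :
    EqUnder E C D (conv f g fg a) (conv f g' fg' a) := by
  rw [conv_apply, conv_apply]
  induction Δ k H a using tensor_induction₂ with
  | add s t hs ht => rw [map_add, map_add]; exact hs.add ht
  | pure x y => rw [pair_tmul, pair_tmul]; exact (e y).mul_left (hf x)

theorem EqUnder.conv_left (e : ∀ a, EqUnder E C D (c a) (triv k H R a)) (hf : ∀ a, f a ∈ D)
    (cf : Commuting c f) (a : H) : EqUnder E C D (conv c f cf a) (f a) := by
  have := EqUnder.conv₁ e hf cf commuting_triv_left a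
  rwa [conv_triv_left] at this

theorem EqUnder.conv_right (e : ∀ a, EqUnder E C D (c a) (triv k H R a)) (hf : ∀ a, f a ∈ C)
    (fc : Commuting f c) (a : H) : EqUnder E C D (conv f c fc a) (f a) := by
  have := EqUnder.conv₂ e hf fc commuting_triv_right a
  rwa [conv_triv_right] at this

theorem EqUnder.apply_right {x y : R} (e : EqUnder E ⊤ D x y) (u : R) :
    E (u * x) = E (u * y) := by
  simpa using e u (Submonoid.mem_top _) 1 D.one_mem

theorem EqUnder.apply_left {x y : R} (e : EqUnder E C ⊤ x y) (v : R) :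
    E (x * v) = E (y * v) := by
  simpa using e 1 C.one_mem v (Submonoid.mem_top _)

/-- A reassociator one of whose legs is collapsed disappears under `E`, by normalization. -/
theorem EqUnder.Φ₁ (e : ∀ a, EqUnder E C D (c a) (triv k H R a)) (hg : ∀ a, g a ∈ D)
    (hh : ∀ a, h a ∈ D) (gh : Commuting g h) : EqUnder E C D (Φ c g h) 1 := by
  rw [← Φ_triv_left gh]
  exact EqUnder.tri₁ e hg hh _

theorem EqUnder.Φ₂ (e : ∀ a, EqUnder E C D (c a) (triv k H R a)) (hf : ∀ a, f a ∈ C)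
    (hh : ∀ a, h a ∈ D) : EqUnder E C D (Φ f c h) 1 := by
  rw [← Φ_triv_middle f h]
  exact EqUnder.tri₂ e hf hh _

theorem EqUnder.Φ₃ (e : ∀ a, EqUnder E C D (c a) (triv k H R a)) (hf : ∀ a, f a ∈ C)
    (hg : ∀ a, g a ∈ C) (fg : Commuting f g) : EqUnder E C D (Φ f g c) 1 := by
  rw [← Φ_triv_right fg]
  exact EqUnder.tri₃ e hf hg _

theorem EqUnder.Φi₁ (e : ∀ a, EqUnder E C D (c a) (triv k H R a)) (hg : ∀ a, g a ∈ D)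
    (hh : ∀ a, h a ∈ D) (gh : Commuting g h) : EqUnder E C D (Φi c g h) 1 := by
  rw [← Φi_triv_left gh]
  exact EqUnder.tri₁ e hg hh _

theorem EqUnder.Φi₂ (e : ∀ a, EqUnder E C D (c a) (triv k H R a)) (hf : ∀ a, f a ∈ C)
    (hh : ∀ a, h a ∈ D) (fh : Commuting f h) : EqUnder E C D (Φi f c h) 1 := by
  rw [← Φi_triv_middle fh]
  exact EqUnder.tri₂ e hf hh _

theorem EqUnder.Φi₃ (e : ∀ a, EqUnder E C D (c a) (triv k H R a)) (hf : ∀ a, f a ∈ C)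
    (hg : ∀ a, g a ∈ C) (fg : Commuting f g) : EqUnder E C D (Φi f g c) 1 := by
  rw [← Φi_triv_right fg]
  exact EqUnder.tri₃ e hf hg _

end Collapse
/-! ### Identities for four, three, five and six legs under a collapsing map -/

section FourLegs

variable {k H R V : Type*} [Field k] [Ring H] [Algebra k H] [QuasiHopfAlgebra k H]
  [Ring R] [Algebra k R] [AddCommGroup V] [Module k V] {E : R →ₗ[k] V} {f g h i : H →ₐ[k] R}

/-- If `E` collapses `g ⊗ h` on the right and `h ⊗ i` on the left, then two of the five factors of
the pentagon disappear under `E`. The next three lemmas are variants of this. -/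
theorem apply_pentagon_left (fg : Commuting f g) (fh : Commuting f h) (fi : Commuting f i)
    (gh : Commuting g h) (gi : Commuting g i) (hi : Commuting h i)
    (hR : RightCollapse E (conv g h gh)) (hL : LeftCollapse E (conv h i hi)) :
    E (Φ (conv f g fg) h i * Φi f g h) = E (Φ g h i) := by
  have e1 := EqUnder.Φ₂ hR.eqUnder (f := f) (h := i) (fun _ => Submonoid.mem_top _)
    (gi.conv_left hi).symm.mem_cent
  have e2 := EqUnder.Φi₃ hL.eqUnder (fh.conv_right fi).mem_cent (gh.conv_right gi).mem_cent fg
  rw [pentagon_left fg fh fi gh gi hi, e1.apply_right, mul_one, e2.apply_left, one_mul]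

theorem apply_pentagon_left_inv (fg : Commuting f g) (fh : Commuting f h) (fi : Commuting f i)
    (gh : Commuting g h) (gi : Commuting g i) (hi : Commuting h i)
    (hL : LeftCollapse E (conv g h gh)) (hR : RightCollapse E (conv h i hi)) :
    E (Φ f g h * Φi (conv f g fg) h i) = E (Φi g h i) := by
  have e1 := EqUnder.Φi₂ hL.eqUnder (fg.conv_right fh).mem_cent
    (fun _ => Submonoid.mem_top _) fi
  have e2 := EqUnder.Φ₃ hR.eqUnder (fun _ => Submonoid.mem_top _)
    (fun _ => Submonoid.mem_top _) fg
  rw [pentagon_left_inv fg fh fi gh gi hi, e2.apply_right, mul_one, e1.apply_left, one_mul]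

theorem apply_pentagon_right (fg : Commuting f g) (fh : Commuting f h) (fi : Commuting f i)
    (gh : Commuting g h) (gi : Commuting g i) (hi : Commuting h i)
    (hL : LeftCollapse E (conv f g fg)) (hR : RightCollapse E (conv g h gh)) :
    E (Φi f g (conv h i hi) * Φ g h i) = E (Φi f g h) := by
  have e1 := EqUnder.Φ₁ hL.eqUnder (fun _ => Submonoid.mem_top _)
    (fun _ => Submonoid.mem_top _) hi
  have e2 := EqUnder.Φi₂ hR.eqUnder (f := f) (fun _ => Submonoid.mem_top _)
    (gi.conv_left hi).symm.mem_cent fi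
  rw [pentagon_right fg fh fi gh gi hi, e2.apply_right, mul_one, e1.apply_left, one_mul]

theorem apply_pentagon_right_inv (fg : Commuting f g) (fh : Commuting f h) (fi : Commuting f i)
    (gh : Commuting g h) (gi : Commuting g i) (hi : Commuting h i)
    (hL : LeftCollapse E (conv g h gh)) (hR : RightCollapse E (conv f g fg)) :
    E (Φi g h i * Φ f g (conv h i hi)) = E (Φ f g h) := by
  have e1 := EqUnder.Φ₂ hL.eqUnder (h := i) (fg.conv_right fh).mem_cent
    (fun _ => Submonoid.mem_top _)
  have e2 := EqUnder.Φi₁ hR.eqUnder (fh.conv_left gh).symm.mem_cent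
    (fi.conv_left gi).symm.mem_cent hi
  rw [pentagon_right_inv fg fh fi gh gi hi, e2.apply_right, mul_one, e1.apply_left, one_mul]

end FourLegs

section ThreeLegs

variable {k H R V : Type*} [Field k] [Ring H] [Algebra k H] [QuasiHopfAlgebra k H]
  [Ring R] [Algebra k R] [AddCommGroup V] [Module k V] {E : R →ₗ[k] V} {f g h : H →ₐ[k] R}

theorem conv_assoc_mul_Φi (fg : Commuting f g) (fh : Commuting f h) (gh : Commuting g h) (a : H) :
    conv (conv f g fg) h (fh.conv_left gh) a * Φi f g h =
      Φi f g h * conv f (conv g h gh) (fg.conv_right fh) a := by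
  have e := conv_assoc_mul_Φ fg fh gh a
  have q := Φi_mul_Φ fg fh gh
  have q' := Φ_mul_Φi fg fh gh
  calc _ = Φi f g h * (Φ f g h * conv (conv f g fg) h (fh.conv_left gh) a) * Φi f g h := by
        rw [← mul_assoc, q, one_mul]
    _ = _ := by rw [← e]; simp only [mul_assoc, q', mul_one]

theorem conv_intertwine {f' g' : H →ₐ[k] R} {u : R} (hf : ∀ a, u * f a = f' a * u)
    (hg : ∀ a, u * g a = g' a * u) (fg : Commuting f g) (fg' : Commuting f' g') (a : H) :
    u * conv f g fg a = conv f' g' fg' a * u := by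
  rw [conv_apply, conv_apply]
  induction Δ k H a using tensor_induction₂ with
  | add s t hs ht => rw [map_add, map_add, mul_add, add_mul, hs, ht]
  | pure x y => rw [pair_tmul, pair_tmul, ← mul_assoc, hf, mul_assoc, hg, mul_assoc]

/-- Quasi-coassociativity with two of the three legs collapsed. The next three lemmas are
variants. -/
theorem RightCollapse.apply_conv_mul_Φi (fg : Commuting f g) (fh : Commuting f h)
    (gh : Commuting g h) (hR : RightCollapse E (conv g h gh)) (a : H) :
    E (conv (conv f g fg) h (fh.conv_left gh) a * Φi f g h) = E (Φi f g h * f a) := by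
  have e := EqUnder.conv_right hR.eqUnder (fun _ => Submonoid.mem_top _) (fg.conv_right fh) a
  rw [conv_assoc_mul_Φi fg fh gh, e.apply_right]

theorem LeftCollapse.apply_Φi_mul_conv (fg : Commuting f g) (fh : Commuting f h)
    (gh : Commuting g h) (hL : LeftCollapse E (conv f g fg)) (a : H) :
    E (Φi f g h * conv f (conv g h gh) (fg.conv_right fh) a) = E (h a * Φi f g h) := by
  have e := EqUnder.conv_left hL.eqUnder (fun _ => Submonoid.mem_top _) (fh.conv_left gh) a
  rw [← conv_assoc_mul_Φi fg fh gh, e.apply_left]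

theorem RightCollapse.apply_Φ_mul_conv (fg : Commuting f g) (fh : Commuting f h)
    (gh : Commuting g h) (hR : RightCollapse E (conv f g fg)) (a : H) :
    E (conv f (conv g h gh) (fg.conv_right fh) a * Φ f g h) = E (Φ f g h * h a) := by
  have e := EqUnder.conv_left hR.eqUnder (fh.conv_left gh).symm.mem_cent (fh.conv_left gh) a
  rw [conv_assoc_mul_Φ fg fh gh, e.apply_right]

theorem LeftCollapse.apply_conv_mul_Φ (fg : Commuting f g) (fh : Commuting f h)
    (gh : Commuting g h) (hL : LeftCollapse E (conv g h gh)) (a : H) :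
    E (Φ f g h * conv (conv f g fg) h (fh.conv_left gh) a) = E (f a * Φ f g h) := by
  have e := EqUnder.conv_right hL.eqUnder (fg.conv_right fh).mem_cent (fg.conv_right fh) a
  rw [← conv_assoc_mul_Φ fg fh gh, e.apply_left]

end ThreeLegs

section FiveLegs

variable {k H R V : Type*} [Field k] [Ring H] [Algebra k H] [QuasiHopfAlgebra k H]
  [Ring R] [Algebra k R] [AddCommGroup V] [Module k V] {E : R →ₗ[k] V}
  {f₁ f₂ f₃ f₄ f₅ f₆ : H →ₐ[k] R}

/-- Two applications of the pentagon, with the reassociators that then sit on collapsed legs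
dropped. This is the identity behind `f Δ(q_L¹) p_R (1 ⊗ S(q_L²)) = τ(q_R)` for the Drinfeld twist `f`. -/
theorem apply_five (c12 : Commuting f₁ f₂) (c13 : Commuting f₁ f₃) (c14 : Commuting f₁ f₄)
    (c15 : Commuting f₁ f₅) (c23 : Commuting f₂ f₃) (c24 : Commuting f₂ f₄)
    (c25 : Commuting f₂ f₅) (c34 : Commuting f₃ f₄) (c35 : Commuting f₃ f₅)
    (c45 : Commuting f₄ f₅)
    (hL : LeftCollapse E (conv f₂ f₃ c23)) (hR : RightCollapse E (conv f₄ f₅ c45)) :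
    E (Φi f₂ f₃ f₄ * Φ f₁ f₂ (conv f₃ f₄ c34) * Φi (conv f₁ f₂ c12) (conv f₃ f₄ c34) f₅ *
      Φi f₃ f₄ f₅) = E (Φi f₁ f₄ f₅ * Φ f₁ f₂ f₃) := by
  have c1_34 : Commuting f₁ (conv f₃ f₄ c34) := c13.conv_right c14
  have c2_34 : Commuting f₂ (conv f₃ f₄ c34) := c23.conv_right c24
  have c34_5 : Commuting (conv f₃ f₄ c34) f₅ := c35.conv_left c45
  have c23_4 : Commuting (conv f₂ f₃ c23) f₄ := c24.conv_left c34
  have c1_23 : Commuting f₁ (conv f₂ f₃ c23) := c12.conv_right c13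
  have c23_5 : Commuting (conv f₂ f₃ c23) f₅ := c25.conv_left c35
  have c3_45 : Commuting f₃ (conv f₄ f₅ c45) := c34.conv_right c35
  have c2_45 : Commuting f₂ (conv f₄ f₅ c45) := c24.conv_right c25
  have c1_45 : Commuting f₁ (conv f₄ f₅ c45) := c14.conv_right c15
  have p := pentagon_left_inv c12 c1_34 c15 c2_34 c25 c34_5
  have i1 : Φi f₃ f₄ f₅ * Φ f₁ f₂ (conv f₃ (conv f₄ f₅ c45) c3_45) =
      Φ f₁ f₂ (conv (conv f₃ f₄ c34) f₅ c34_5) * Φi f₃ f₄ f₅ :=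
    tri_intertwine
      (fun a => (tri_commute (fun b => c13 a b) (fun b => c14 a b) (fun b => c15 a b) _).symm)
      (fun a => (tri_commute (fun b => c23 a b) (fun b => c24 a b) (fun b => c25 a b) _).symm)
      (fun a => (conv_assoc_mul_Φi c34 c35 c45 a).symm) _
  have i2 : Φi f₂ f₃ f₄ * Φi f₁ (conv f₂ (conv f₃ f₄ c34) c2_34) f₅ =
      Φi f₁ (conv (conv f₂ f₃ c23) f₄ c23_4) f₅ * Φi f₂ f₃ f₄ :=
    tri_intertwine
      (fun a => (tri_commute (fun b => c12 a b) (fun b => c13 a b) (fun b => c14 a b) _).symm)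
      (fun a => (conv_assoc_mul_Φi c23 c24 c34 a).symm)
      (fun a => (tri_commute (fun b => c25.symm a b) (fun b => c35.symm a b)
        (fun b => c45.symm a b) _).symm) _
  have p' := pentagon_inv c23 c24 c25 c34 c35 c45
  have e1 := EqUnder.tri₃ (f := f₁) (g := f₂) (EqUnder.conv_right hR.eqUnder
    (fun _ => Submonoid.mem_top _) c3_45) (fun _ => Submonoid.mem_top _)
    (fun _ => Submonoid.mem_top _) (φ k H)
  have e2 := EqUnder.Φi₃ hR.eqUnder (fun _ => Submonoid.mem_top _)
    (fun _ => Submonoid.mem_top _) c23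
  have e3 := EqUnder.tri₂ (f := f₁) (h := f₅) (EqUnder.conv_left hL.eqUnder
    (fun _ => Submonoid.mem_top _) c23_4) c1_23.mem_cent (fun _ => Submonoid.mem_top _) (φInv k H)
  have e4 := EqUnder.Φi₁ hL.eqUnder (fun _ => Submonoid.mem_top _)
    (fun _ => Submonoid.mem_top _) c45
  calc _ = E (Φi f₂ f₃ f₄ * (Φ f₁ f₂ (conv f₃ f₄ c34) *
        Φi (conv f₁ f₂ c12) (conv f₃ f₄ c34) f₅) * Φi f₃ f₄ f₅) := by simp only [mul_assoc]
    _ = E (Φi f₂ f₃ f₄ * Φi f₁ (conv f₂ (conv f₃ f₄ c34) c2_34) f₅ *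
        Φi f₂ (conv f₃ f₄ c34) f₅ * (Φ f₁ f₂ (conv (conv f₃ f₄ c34) f₅ c34_5) *
          Φi f₃ f₄ f₅)) := by rw [p]; simp only [mul_assoc]
    _ = E (Φi f₁ (conv (conv f₂ f₃ c23) f₄ c23_4) f₅ * (Φi f₂ f₃ f₄ *
        Φi f₂ (conv f₃ f₄ c34) f₅ * Φi f₃ f₄ f₅) *
          Φ f₁ f₂ (conv f₃ (conv f₄ f₅ c45) c3_45)) := by
        rw [i2, ← i1]; simp only [mul_assoc]
    _ = E (Φi f₁ (conv (conv f₂ f₃ c23) f₄ c23_4) f₅ * Φi (conv f₂ f₃ c23) f₄ f₅ *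
          Φi f₂ f₃ (conv f₄ f₅ c45) * Φ f₁ f₂ f₃) := by
        rw [p']; simp only [← mul_assoc]; exact e1.apply_right _
    _ = E (Φi f₁ (conv (conv f₂ f₃ c23) f₄ c23_4) f₅ * (Φi (conv f₂ f₃ c23) f₄ f₅ *
          Φ f₁ f₂ f₃)) := by
        rw [e2 _ (Submonoid.mem_top _) _ (Φ_mem_cent c1_45 c2_45 c3_45), mul_one, mul_assoc]
    _ = E (Φi f₁ f₄ f₅ * (Φi (conv f₂ f₃ c23) f₄ f₅ * Φ f₁ f₂ f₃)) := e3.apply_left _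
    _ = _ := by
        rw [← mul_assoc, e4 _ (Φi_mem_cent c1_23 c23_4.symm c23_5.symm) _
          (Submonoid.mem_top _), mul_one]

/-- Three applications of the pentagon, with the reassociators that then sit on collapsed legs
dropped. On the right `φ` appears twice, on disjoint sets of legs. This is the identity behind the
left inverse of the Drinfeld twist. -/
theorem apply_six (c12 : Commuting f₁ f₂) (c13 : Commuting f₁ f₃) (c14 : Commuting f₁ f₄)
    (c15 : Commuting f₁ f₅) (c16 : Commuting f₁ f₆) (c23 : Commuting f₂ f₃)
    (c24 : Commuting f₂ f₄) (c25 : Commuting f₂ f₅) (c26 : Commuting f₂ f₆)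
    (c34 : Commuting f₃ f₄) (c35 : Commuting f₃ f₅) (c36 : Commuting f₃ f₆)
    (c45 : Commuting f₄ f₅) (c46 : Commuting f₄ f₆) (c56 : Commuting f₅ f₆)
    (hL45 : LeftCollapse E (conv f₄ f₅ c45)) (hL36 : LeftCollapse E (conv f₃ f₆ c36))
    (hR23 : RightCollapse E (conv f₂ f₃ c23)) (hR14 : RightCollapse E (conv f₁ f₄ c14)) :
    E (Φi f₄ f₅ f₆ * Φ f₃ f₄ (conv f₅ f₆ c56) *
      Φ (conv f₁ f₂ c12) (conv f₃ f₄ c34) (conv f₅ f₆ c56) *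
      (Φ (conv f₁ f₂ c12) f₃ f₄ * Φi f₁ f₂ f₃)) = E (Φ f₂ f₃ f₆ * Φ f₁ f₄ f₅) := by
  have c12_3 : Commuting (conv f₁ f₂ c12) f₃ := c13.conv_left c23
  have c12_4 : Commuting (conv f₁ f₂ c12) f₄ := c14.conv_left c24
  have c12_5 : Commuting (conv f₁ f₂ c12) f₅ := c15.conv_left c25
  have c12_6 : Commuting (conv f₁ f₂ c12) f₆ := c16.conv_left c26
  have c3_56 : Commuting f₃ (conv f₅ f₆ c56) := c35.conv_right c36
  have c4_56 : Commuting f₄ (conv f₅ f₆ c56) := c45.conv_right c46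
  have c45_6 : Commuting (conv f₄ f₅ c45) f₆ := c46.conv_left c56
  have c1_23 : Commuting f₁ (conv f₂ f₃ c23) := c12.conv_right c13
  have c23_4 : Commuting (conv f₂ f₃ c23) f₄ := c24.conv_left c34
  have c23_5 : Commuting (conv f₂ f₃ c23) f₅ := c25.conv_left c35
  have c23_6 : Commuting (conv f₂ f₃ c23) f₆ := c26.conv_left c36
  have c23_45 : Commuting (conv f₂ f₃ c23) (conv f₄ f₅ c45) := c23_4.conv_right c23_5
  have c1_45 : Commuting f₁ (conv f₄ f₅ c45) := c14.conv_right c15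
  have c2_45 : Commuting f₂ (conv f₄ f₅ c45) := c24.conv_right c25
  have c3_45 : Commuting f₃ (conv f₄ f₅ c45) := c34.conv_right c35
  have p := pentagon c12_3 c12_4 (c12_5.conv_right c12_6 (c := c56)) c34 c3_56 c4_56
  have i1 : Φi f₄ f₅ f₆ * Φ (conv f₁ f₂ c12) f₃ (conv f₄ (conv f₅ f₆ c56) c4_56) =
      Φ (conv f₁ f₂ c12) f₃ (conv (conv f₄ f₅ c45) f₆ c45_6) * Φi f₄ f₅ f₆ :=
    tri_intertwine
      (fun a => (tri_commute (fun b => c12_4 a b) (fun b => c12_5 a b)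
        (fun b => c12_6 a b) _).symm)
      (fun a => (tri_commute (fun b => c34 a b) (fun b => c35 a b) (fun b => c36 a b) _).symm)
      (fun a => (conv_assoc_mul_Φi c45 c46 c56 a).symm) _
  have i2 : Φi f₁ f₂ f₃ * Φ (conv f₁ (conv f₂ f₃ c23) c1_23) f₄ (conv f₅ f₆ c56) =
      Φ (conv (conv f₁ f₂ c12) f₃ c12_3) f₄ (conv f₅ f₆ c56) * Φi f₁ f₂ f₃ :=
    tri_intertwine
      (fun a => (conv_assoc_mul_Φi c12 c13 c23 a).symm)
      (fun a => (tri_commute (fun b => c14.symm a b) (fun b => c24.symm a b)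
        (fun b => c34.symm a b) _).symm)
      (fun a => (tri_commute (fun b => (c15.conv_right c16).symm a b)
        (fun b => (c25.conv_right c26).symm a b) (fun b => c3_56.symm a b) _).symm) _
  have q1 := pentagon_left c12 c13 c16 c23 c26 c36
  have q2 := pentagon_right_inv c14 c15 c16 c45 c46 c56
  have cm : Commute (Φi f₄ f₅ f₆) (Φi f₁ f₂ f₃) :=
    tri_commute (fun a => (tri_commute (fun b => c14 a b) (fun b => c15 a b)
        (fun b => c16 a b) _).symm)
      (fun a => (tri_commute (fun b => c24 a b) (fun b => c25 a b) (fun b => c26 a b) _).symm)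
      (fun a => (tri_commute (fun b => c34 a b) (fun b => c35 a b) (fun b => c36 a b) _).symm) _
  have e1 := EqUnder.tri₃ (f := conv f₁ f₂ c12) (g := f₃) (EqUnder.conv_left hL45.eqUnder
    (fun _ => Submonoid.mem_top _) c45_6) (c12_4.conv_right c12_5).mem_cent c3_45.mem_cent (φ k H)
  have e2 := EqUnder.tri₁ (g := f₄) (h := conv f₅ f₆ c56) (EqUnder.conv_right hR23.eqUnder
    (fun _ => Submonoid.mem_top _) c1_23) c23_4.symm.mem_cent
    (c23_5.conv_right c23_6).symm.mem_cent (φ k H)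
  have e3 := EqUnder.Φi₁ hR14.eqUnder (c15.conv_left c45).symm.mem_cent
    (c16.conv_left c46).symm.mem_cent c56
  have e4 := EqUnder.Φi₃ hL36.eqUnder (c13.conv_right c16).mem_cent
    (c23.conv_right c26).mem_cent c12
  have e5 := EqUnder.Φ₂ hR23.eqUnder (f := f₁) (fun _ => Submonoid.mem_top _)
    c23_6.symm.mem_cent
  have e6 := EqUnder.Φ₂ hL45.eqUnder (h := f₆) c1_45.mem_cent (fun _ => Submonoid.mem_top _)
  calc _ = E (Φi f₄ f₅ f₆ * (Φ f₃ f₄ (conv f₅ f₆ c56) *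
        Φ (conv f₁ f₂ c12) (conv f₃ f₄ c34) (conv f₅ f₆ c56) * Φ (conv f₁ f₂ c12) f₃ f₄) *
          Φi f₁ f₂ f₃) := by simp only [mul_assoc]
    _ = E (Φi f₄ f₅ f₆ * Φ (conv f₁ f₂ c12) f₃ (conv f₄ (conv f₅ f₆ c56) c4_56) *
        (Φ (conv (conv f₁ f₂ c12) f₃ c12_3) f₄ (conv f₅ f₆ c56) * Φi f₁ f₂ f₃)) := by
        rw [← p]; simp only [mul_assoc]
    _ = E (Φ (conv f₁ f₂ c12) f₃ (conv (conv f₄ f₅ c45) f₆ c45_6) * (Φi f₄ f₅ f₆ *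
        Φi f₁ f₂ f₃ * Φ (conv f₁ (conv f₂ f₃ c23) c1_23) f₄ (conv f₅ f₆ c56))) := by
        rw [i1, ← i2]; simp only [mul_assoc]
    _ = E (Φ (conv f₁ f₂ c12) f₃ f₆ * (Φi f₄ f₅ f₆ *
        Φi f₁ f₂ f₃ * Φ (conv f₁ (conv f₂ f₃ c23) c1_23) f₄ (conv f₅ f₆ c56))) :=
        e1.apply_left _
    _ = E (Φ (conv f₁ f₂ c12) f₃ f₆ * (Φi f₄ f₅ f₆ *
        Φi f₁ f₂ f₃) * Φ f₁ f₄ (conv f₅ f₆ c56)) := by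
        rw [← mul_assoc, ← mul_assoc, mul_assoc _ (Φi f₄ f₅ f₆)]; exact e2.apply_right _
    _ = E ((Φ (conv f₁ f₂ c12) f₃ f₆ * Φi f₁ f₂ f₃) *
        (Φi f₄ f₅ f₆ * Φ f₁ f₄ (conv f₅ f₆ c56))) := by
        rw [cm.eq]; simp only [mul_assoc]
    _ = E (Φi f₁ f₂ (conv f₃ f₆ c36) * (Φ f₂ f₃ f₆ * Φ f₁ (conv f₂ f₃ c23) f₆ *
        (Φ f₁ (conv f₄ f₅ c45) f₆ * Φ f₁ f₄ f₅)) * Φi (conv f₁ f₄ c14) f₅ f₆) := by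
        rw [q1, q2]; simp only [mul_assoc]
    _ = E (Φ f₂ f₃ f₆ * Φ f₁ (conv f₂ f₃ c23) f₆ *
        (Φ f₁ (conv f₄ f₅ c45) f₆ * Φ f₁ f₄ f₅)) := by
        rw [e3.apply_right, mul_one, e4.apply_left, one_mul]
    _ = E (Φ f₂ f₃ f₆ * Φ f₁ (conv f₄ f₅ c45) f₆ * Φ f₁ f₄ f₅) := by
        rw [e5 _ (Submonoid.mem_top _) _ ((cent _).mul_mem
          (Φ_mem_cent c1_23 c23_45.symm c23_6.symm)
          (Φ_mem_cent c1_23 c23_4.symm c23_5.symm)), mul_one, mul_assoc]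
    _ = _ := by
        rw [e6 _ (Φ_mem_cent c2_45 c3_45 c45_6.symm) _ (Submonoid.mem_top _), mul_one]

end FiveLegs

section Naturality

variable {k H R R' : Type*} [Field k] [Ring H] [Algebra k H] [QuasiHopfAlgebra k H]
  [Ring R] [Algebra k R] [Ring R'] [Algebra k R'] (G : R →ₐ[k] R') {f g h : H →ₐ[k] R}
  {f' g' h' : H →ₐ[k] R'}

theorem comp_conv (hf : G.comp f = f') (hg : G.comp g = g') (c : Commuting f g)
    (c' : Commuting f' g') : G.comp (conv f g c) = conv f' g' c' := by
  subst hf hg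
  ext a
  rw [AlgHom.comp_apply, conv_apply, conv_apply]
  induction Δ k H a using tensor_induction₂ with
  | add s t hs ht => simp only [map_add, hs, ht]
  | pure a b => simp

end Naturality
/-! ### The legs of tensor powers -/

section ConcreteLegs

variable {k H T : Type*} [Field k] [Ring H] [Algebra k H] [Ring T] [Algebra k T]

/-- The first leg of a tensor power `H ⊗ T`. -/
noncomputable def inl : H →ₐ[k] H ⊗[k] T := Algebra.TensorProduct.includeLeft

/-- A leg of `T` as a leg of `H ⊗ T`. -/
noncomputable def inr (f : H →ₐ[k] T) : H →ₐ[k] H ⊗[k] T :=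
  (Algebra.TensorProduct.includeRight : T →ₐ[k] H ⊗[k] T).comp f

@[simp] theorem inl_apply (a : H) : inl (k := k) (T := T) a = a ⊗ₜ 1 := rfl

@[simp] theorem inr_apply (f : H →ₐ[k] T) (a : H) : inr f a = 1 ⊗ₜ f a := rfl

theorem commuting_inl_inr (f : H →ₐ[k] T) : Commuting inl (inr f) := by
  intro a b
  simp [Commute, SemiconjBy]

theorem Commuting.inr {f g : H →ₐ[k] T} (c : Commuting f g) : Commuting (inr f) (inr g) := by
  intro a b
  simp [Commute, SemiconjBy, (c a b).eq]

/-- If `E(u g(a) h(b) v)` factors through a linear map `m` of `a ⊗ b`, then so does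
`w ↦ E(u (g ⊗ h)(w) v)`. With `w = Δ(x)` this brings the values `m(Δ(x))` into play. -/
theorem pair_apply_eq {R V : Type*} [Ring R] [Algebra k R] [AddCommGroup V] [Module k V]
    {E : R →ₗ[k] V} {g h : H →ₐ[k] R} {c : Commuting g h}
    {W : Type*} [AddCommGroup W] [Module k W] {m : H ⊗[k] H →ₗ[k] W}
    (B : W →ₗ[k] V) (u v : R) (hB : ∀ a b, E (u * (g a * h b) * v) = B (m (a ⊗ₜ b)))
    (w : H ⊗[k] H) : E (u * pair g h c w * v) = B (m w) := by
  induction w using tensor_induction₂ with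
  | add s t hs ht => simp only [map_add, mul_add, add_mul, hs, ht]
  | pure a b => rw [pair_tmul, hB]

end ConcreteLegs

section Shortcuts

-- Instance synthesis does not reach these nested tensor powers within its default limits.

variable {k H : Type*} [Field k] [Ring H] [Algebra k H]

noncomputable instance : Ring (H ⊗[k] (H ⊗[k] (H ⊗[k] H))) :=
  Algebra.TensorProduct.instRing

noncomputable instance : Algebra k (H ⊗[k] (H ⊗[k] (H ⊗[k] H))) :=
  Algebra.TensorProduct.leftAlgebra

noncomputable instance : Ring (H ⊗[k] (H ⊗[k] (H ⊗[k] (H ⊗[k] H)))) :=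
  Algebra.TensorProduct.instRing

noncomputable instance : Algebra k (H ⊗[k] (H ⊗[k] (H ⊗[k] (H ⊗[k] H)))) :=
  Algebra.TensorProduct.leftAlgebra

noncomputable instance : Ring (H ⊗[k] (H ⊗[k] (H ⊗[k] (H ⊗[k] (H ⊗[k] H))))) :=
  Algebra.TensorProduct.instRing

noncomputable instance : Algebra k (H ⊗[k] (H ⊗[k] (H ⊗[k] (H ⊗[k] (H ⊗[k] H))))) :=
  Algebra.TensorProduct.leftAlgebra

end Shortcuts

section NamedLegs

/-! The `i`-th leg of the `n`-fold tensor power of `H` is `legₙᵢ`, and `commₙᵢⱼ` says that the legs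
`i` and `j` commute. -/

variable (k H : Type*) [Field k] [Ring H] [Algebra k H]

noncomputable abbrev leg₂₁ : H →ₐ[k] H ⊗[k] H := inl

noncomputable abbrev leg₂₂ : H →ₐ[k] H ⊗[k] H := inr (AlgHom.id k H)

theorem comm₂₁₂ : Commuting (leg₂₁ k H) (leg₂₂ k H) := commuting_inl_inr _

noncomputable abbrev leg₃₁ : H →ₐ[k] H ⊗[k] (H ⊗[k] H) := inl

noncomputable abbrev leg₃₂ : H →ₐ[k] H ⊗[k] (H ⊗[k] H) := inr (leg₂₁ k H)

noncomputable abbrev leg₃₃ : H →ₐ[k] H ⊗[k] (H ⊗[k] H) := inr (leg₂₂ k H)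

theorem comm₃₁₂ : Commuting (leg₃₁ k H) (leg₃₂ k H) := commuting_inl_inr _
theorem comm₃₁₃ : Commuting (leg₃₁ k H) (leg₃₃ k H) := commuting_inl_inr _
theorem comm₃₂₃ : Commuting (leg₃₂ k H) (leg₃₃ k H) := (comm₂₁₂ k H).inr

noncomputable abbrev leg₄₁ : H →ₐ[k] H ⊗[k] (H ⊗[k] (H ⊗[k] H)) := inl

noncomputable abbrev leg₄₂ : H →ₐ[k] H ⊗[k] (H ⊗[k] (H ⊗[k] H)) := inr (leg₃₁ k H)

noncomputable abbrev leg₄₃ : H →ₐ[k] H ⊗[k] (H ⊗[k] (H ⊗[k] H)) := inr (leg₃₂ k H)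

noncomputable abbrev leg₄₄ : H →ₐ[k] H ⊗[k] (H ⊗[k] (H ⊗[k] H)) := inr (leg₃₃ k H)

theorem comm₄₁₂ : Commuting (leg₄₁ k H) (leg₄₂ k H) := commuting_inl_inr _
theorem comm₄₁₃ : Commuting (leg₄₁ k H) (leg₄₃ k H) := commuting_inl_inr _
theorem comm₄₁₄ : Commuting (leg₄₁ k H) (leg₄₄ k H) := commuting_inl_inr _
theorem comm₄₂₃ : Commuting (leg₄₂ k H) (leg₄₃ k H) := (comm₃₁₂ k H).inr
theorem comm₄₂₄ : Commuting (leg₄₂ k H) (leg₄₄ k H) := (comm₃₁₃ k H).inr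
theorem comm₄₃₄ : Commuting (leg₄₃ k H) (leg₄₄ k H) := (comm₃₂₃ k H).inr

noncomputable abbrev leg₅₁ : H →ₐ[k] H ⊗[k] (H ⊗[k] (H ⊗[k] (H ⊗[k] H))) := inl

noncomputable abbrev leg₅₂ : H →ₐ[k] H ⊗[k] (H ⊗[k] (H ⊗[k] (H ⊗[k] H))) := inr (leg₄₁ k H)

noncomputable abbrev leg₅₃ : H →ₐ[k] H ⊗[k] (H ⊗[k] (H ⊗[k] (H ⊗[k] H))) := inr (leg₄₂ k H)

noncomputable abbrev leg₅₄ : H →ₐ[k] H ⊗[k] (H ⊗[k] (H ⊗[k] (H ⊗[k] H))) := inr (leg₄₃ k H)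

noncomputable abbrev leg₅₅ : H →ₐ[k] H ⊗[k] (H ⊗[k] (H ⊗[k] (H ⊗[k] H))) := inr (leg₄₄ k H)

theorem comm₅₁₂ : Commuting (leg₅₁ k H) (leg₅₂ k H) := commuting_inl_inr _
theorem comm₅₁₃ : Commuting (leg₅₁ k H) (leg₅₃ k H) := commuting_inl_inr _
theorem comm₅₁₄ : Commuting (leg₅₁ k H) (leg₅₄ k H) := commuting_inl_inr _
theorem comm₅₁₅ : Commuting (leg₅₁ k H) (leg₅₅ k H) := commuting_inl_inr _
theorem comm₅₂₃ : Commuting (leg₅₂ k H) (leg₅₃ k H) := (comm₄₁₂ k H).inr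
theorem comm₅₂₄ : Commuting (leg₅₂ k H) (leg₅₄ k H) := (comm₄₁₃ k H).inr
theorem comm₅₂₅ : Commuting (leg₅₂ k H) (leg₅₅ k H) := (comm₄₁₄ k H).inr
theorem comm₅₃₄ : Commuting (leg₅₃ k H) (leg₅₄ k H) := (comm₄₂₃ k H).inr
theorem comm₅₃₅ : Commuting (leg₅₃ k H) (leg₅₅ k H) := (comm₄₂₄ k H).inr
theorem comm₅₄₅ : Commuting (leg₅₄ k H) (leg₅₅ k H) := (comm₄₃₄ k H).inr

noncomputable abbrev leg₆₁ : H →ₐ[k] H ⊗[k] (H ⊗[k] (H ⊗[k] (H ⊗[k] (H ⊗[k] H)))) := inl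

noncomputable abbrev leg₆₂ : H →ₐ[k] H ⊗[k] (H ⊗[k] (H ⊗[k] (H ⊗[k] (H ⊗[k] H)))) :=
  inr (leg₅₁ k H)

noncomputable abbrev leg₆₃ : H →ₐ[k] H ⊗[k] (H ⊗[k] (H ⊗[k] (H ⊗[k] (H ⊗[k] H)))) :=
  inr (leg₅₂ k H)

noncomputable abbrev leg₆₄ : H →ₐ[k] H ⊗[k] (H ⊗[k] (H ⊗[k] (H ⊗[k] (H ⊗[k] H)))) :=
  inr (leg₅₃ k H)

noncomputable abbrev leg₆₅ : H →ₐ[k] H ⊗[k] (H ⊗[k] (H ⊗[k] (H ⊗[k] (H ⊗[k] H)))) :=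
  inr (leg₅₄ k H)

noncomputable abbrev leg₆₆ : H →ₐ[k] H ⊗[k] (H ⊗[k] (H ⊗[k] (H ⊗[k] (H ⊗[k] H)))) :=
  inr (leg₅₅ k H)

theorem comm₆₁₂ : Commuting (leg₆₁ k H) (leg₆₂ k H) := commuting_inl_inr _
theorem comm₆₁₃ : Commuting (leg₆₁ k H) (leg₆₃ k H) := commuting_inl_inr _
theorem comm₆₁₄ : Commuting (leg₆₁ k H) (leg₆₄ k H) := commuting_inl_inr _
theorem comm₆₁₅ : Commuting (leg₆₁ k H) (leg₆₅ k H) := commuting_inl_inr _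
theorem comm₆₁₆ : Commuting (leg₆₁ k H) (leg₆₆ k H) := commuting_inl_inr _
theorem comm₆₂₃ : Commuting (leg₆₂ k H) (leg₆₃ k H) := (comm₅₁₂ k H).inr
theorem comm₆₂₄ : Commuting (leg₆₂ k H) (leg₆₄ k H) := (comm₅₁₃ k H).inr
theorem comm₆₂₅ : Commuting (leg₆₂ k H) (leg₆₅ k H) := (comm₅₁₄ k H).inr
theorem comm₆₂₆ : Commuting (leg₆₂ k H) (leg₆₆ k H) := (comm₅₁₅ k H).inr
theorem comm₆₃₄ : Commuting (leg₆₃ k H) (leg₆₄ k H) := (comm₅₂₃ k H).inr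
theorem comm₆₃₅ : Commuting (leg₆₃ k H) (leg₆₅ k H) := (comm₅₂₄ k H).inr
theorem comm₆₃₆ : Commuting (leg₆₃ k H) (leg₆₆ k H) := (comm₅₂₅ k H).inr
theorem comm₆₄₅ : Commuting (leg₆₄ k H) (leg₆₅ k H) := (comm₅₃₄ k H).inr
theorem comm₆₄₆ : Commuting (leg₆₄ k H) (leg₆₆ k H) := (comm₅₃₅ k H).inr
theorem comm₆₅₆ : Commuting (leg₆₅ k H) (leg₆₆ k H) := (comm₅₄₅ k H).inr

variable {k H}

theorem tri_legs (t : H ⊗[k] (H ⊗[k] H)) :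
    tri (leg₃₁ k H) (leg₃₂ k H) (leg₃₃ k H) t = t := by
  induction t using tensor_induction₃ with
  | add s t hs ht => rw [map_add, hs, ht]
  | pure a b c => simp [Algebra.TensorProduct.one_def]

/-- `a ⊗ b ⊗ c ⊗ d ↦ (a ⊗ b ⊗ c) ⊗ d` -/
noncomputable def lastOut : H ⊗[k] (H ⊗[k] (H ⊗[k] H)) →ₗ[k] (H ⊗[k] (H ⊗[k] H)) ⊗[k] H :=
  (TensorProduct.assoc k H (H ⊗[k] H) H).symm.toLinearMap ∘ₗ
    TensorProduct.map LinearMap.id (TensorProduct.assoc k H H H).symm.toLinearMap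

theorem lastOut_tmul (a b c d : H) :
    lastOut (k := k) (a ⊗ₜ (b ⊗ₜ (c ⊗ₜ d))) = (a ⊗ₜ (b ⊗ₜ c)) ⊗ₜ d := rfl

theorem tri_leg₄_last (t : H ⊗[k] (H ⊗[k] H)) :
    tri (leg₄₂ k H) (leg₄₃ k H) (leg₄₄ k H) t = 1 ⊗ₜ t := by
  induction t using tensor_induction₃ with
  | add s t hs ht => rw [map_add, hs, ht, TensorProduct.tmul_add]
  | pure a b c => simp [Algebra.TensorProduct.one_def]

theorem lastOut_tri_leg₄ (t : H ⊗[k] (H ⊗[k] H)) :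
    lastOut (tri (leg₄₁ k H) (leg₄₂ k H) (leg₄₃ k H) t) = t ⊗ₜ 1 := by
  induction t using tensor_induction₃ with
  | add s t hs ht => rw [map_add, map_add, hs, ht, TensorProduct.add_tmul]
  | pure a b c => simp [Algebra.TensorProduct.one_def, lastOut_tmul]

end NamedLegs

/-! ### Recognizing collapsed legs -/

section ClosedForm

variable {k H V R : Type*} [Field k] [Ring H] [Algebra k H] [QuasiHopfAlgebra k H]
  [AddCommGroup V] [Module k V] [Ring R] [Algebra k R]

/-- `a ⊗ b ↦ a β S(b)` -/
noncomputable def betaMul : H ⊗[k] H →ₗ[k] H :=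
  LinearMap.mul' k H ∘ₗ TensorProduct.map LinearMap.id
    (LinearMap.mulLeft k (β k H) ∘ₗ (S k H).toLinearMap)

theorem betaMul_comul (a : H) : betaMul (Δ k H a) = ε k H a • β k H :=
  QuasiHopfAlgebra.antipode_beta a

theorem betaMul_tmul (a b : H) : betaMul (k := k) (a ⊗ₜ b) = a * β k H * S k H b := by
  simp [betaMul, mul_assoc]

/-- `a ⊗ b ↦ S(a) α b` -/
noncomputable def alphaMul : H ⊗[k] H →ₗ[k] H :=
  LinearMap.mul' k H ∘ₗ TensorProduct.map (S k H).toLinearMap (LinearMap.mulLeft k (α k H))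

theorem alphaMul_comul (a : H) : alphaMul (Δ k H a) = ε k H a • α k H :=
  QuasiHopfAlgebra.antipode_alpha a

theorem alphaMul_tmul (a b : H) : alphaMul (k := k) (a ⊗ₜ b) = S k H a * α k H * b := by
  simp [alphaMul, mul_assoc]

theorem betaMul_one : betaMul (1 : H ⊗[k] H) = β k H := by
  rw [Algebra.TensorProduct.one_def, betaMul_tmul, BimodDual.S_one, one_mul, mul_one]

theorem alphaMul_one : alphaMul (1 : H ⊗[k] H) = α k H := by
  rw [Algebra.TensorProduct.one_def, alphaMul_tmul, BimodDual.S_one, one_mul, mul_one]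

/-- To see that `E` collapses the legs `g ⊗ h` on the right, it is enough to look at a spanning
set `s`, on which `E(t g(a) h(b))` has to factor through a map `m` with `m(Δ(a)) = ε(a) m(1)`. -/
theorem rightCollapse_of_factor {W : Type*} [AddCommGroup W] [Module k W] {m : H ⊗[k] H →ₗ[k] W}
    (hm : ∀ a, m (Δ k H a) = ε k H a • m 1) {E : R →ₗ[k] V} {g h : H →ₐ[k] R}
    {c : Commuting g h} {s : Set R} (hs : Submodule.span k s = ⊤)
    (hB : ∀ t ∈ s, ∃ B : W →ₗ[k] V, ∀ a b, E (t * (g a * h b)) = B (m (a ⊗ₜ b))) :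
    RightCollapse E (conv g h c) := by
  intro t x
  have ht : t ∈ Submodule.span k s := hs ▸ Submodule.mem_top
  induction ht using Submodule.span_induction with
  | zero => simp
  | add s t _ _ hs ht => simp only [add_mul, map_add, hs, ht, smul_add]
  | smul r t _ ht => rw [smul_mul_assoc, map_smul, map_smul, ht, smul_comm]
  | mem t ht =>
    obtain ⟨B, hB⟩ := hB t ht
    have e := pair_apply_eq (c := c) B t 1 (fun a b => by rw [mul_one, hB]) (Δ k H x)
    have e1 := hB 1 1
    rw [map_one, map_one, mul_one, mul_one, ← Algebra.TensorProduct.one_def] at e1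
    rw [mul_one] at e
    rw [conv_apply, e, hm, map_smul, e1]

/-- The mirror image of `rightCollapse_of_factor`. -/
theorem leftCollapse_of_factor {W : Type*} [AddCommGroup W] [Module k W] {m : H ⊗[k] H →ₗ[k] W}
    (hm : ∀ a, m (Δ k H a) = ε k H a • m 1) {E : R →ₗ[k] V} {g h : H →ₐ[k] R}
    {c : Commuting g h} {s : Set R} (hs : Submodule.span k s = ⊤)
    (hB : ∀ t ∈ s, ∃ B : W →ₗ[k] V, ∀ a b, E (g a * h b * t) = B (m (a ⊗ₜ b))) :
    LeftCollapse E (conv g h c) := by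
  intro t x
  have ht : t ∈ Submodule.span k s := hs ▸ Submodule.mem_top
  induction ht using Submodule.span_induction with
  | zero => simp
  | add s t _ _ hs ht => simp only [mul_add, map_add, hs, ht, smul_add]
  | smul r t _ ht => rw [mul_smul_comm, map_smul, map_smul, ht, smul_comm]
  | mem t ht =>
    obtain ⟨B, hB⟩ := hB t ht
    have e := pair_apply_eq (c := c) B 1 t (fun a b => by rw [one_mul, hB]) (Δ k H x)
    have e1 := hB 1 1
    rw [map_one, map_one, one_mul, one_mul, ← Algebra.TensorProduct.one_def] at e1
    rw [one_mul] at e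
    rw [conv_apply, e, hm, map_smul, e1]

theorem rightCollapse_of {E : R →ₗ[k] V} {g h : H →ₐ[k] R} {c : Commuting g h} {s : Set R}
    (hs : Submodule.span k s = ⊤)
    (hB : ∀ t ∈ s, ∃ B : H →ₗ[k] V, ∀ a b, E (t * (g a * h b)) = B (a * β k H * S k H b)) :
    RightCollapse E (conv g h c) := by
  refine rightCollapse_of_factor (m := betaMul)
    (fun a => by rw [betaMul_comul, betaMul_one]) hs fun t ht => ?_
  obtain ⟨B, hB⟩ := hB t ht
  exact ⟨B, fun a b => by rw [hB, betaMul_tmul]⟩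

theorem leftCollapse_of {E : R →ₗ[k] V} {g h : H →ₐ[k] R} {c : Commuting g h} {s : Set R}
    (hs : Submodule.span k s = ⊤)
    (hB : ∀ t ∈ s, ∃ B : H →ₗ[k] V, ∀ a b, E (g a * h b * t) = B (S k H a * α k H * b)) :
    LeftCollapse E (conv g h c) := by
  refine leftCollapse_of_factor (m := alphaMul)
    (fun a => by rw [alphaMul_comul, alphaMul_one]) hs fun t ht => ?_
  obtain ⟨B, hB⟩ := hB t ht
  exact ⟨B, fun a b => by rw [hB, alphaMul_tmul]⟩

end ClosedForm

section Span

variable (k H : Type*) [Field k] [Ring H] [Algebra k H]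

/-- the pure tensors `a ⊗ b ⊗ c` -/
def pure₃ : Set (H ⊗[k] (H ⊗[k] H)) := {t | ∃ a b c, t = a ⊗ₜ (b ⊗ₜ c)}

/-- the pure tensors `a ⊗ b ⊗ c ⊗ d` -/
def pure₄ : Set (H ⊗[k] (H ⊗[k] (H ⊗[k] H))) := {t | ∃ a, ∃ s ∈ pure₃ k H, t = a ⊗ₜ s}

/-- the pure tensors `a ⊗ b ⊗ c ⊗ d ⊗ e` -/
def pure₅ : Set (H ⊗[k] (H ⊗[k] (H ⊗[k] (H ⊗[k] H)))) := {t | ∃ a, ∃ s ∈ pure₄ k H, t = a ⊗ₜ s}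

/-- the pure tensors `a ⊗ b ⊗ c ⊗ d ⊗ e ⊗ f` -/
def pure₆ : Set (H ⊗[k] (H ⊗[k] (H ⊗[k] (H ⊗[k] (H ⊗[k] H))))) :=
  {t | ∃ a, ∃ s ∈ pure₅ k H, t = a ⊗ₜ s}

theorem span_pure₃ : Submodule.span k (pure₃ k H) = ⊤ := by
  rw [eq_top_iff]
  rintro t -
  induction t using tensor_induction₃ with
  | add s t hs ht => exact add_mem hs ht
  | pure a b c => exact Submodule.subset_span ⟨a, b, c, rfl⟩

variable {k H} in
theorem span_tmul {T : Type*} [Ring T] [Algebra k T] {s : Set T}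
    (hs : Submodule.span k s = ⊤) :
    Submodule.span k {t : H ⊗[k] T | ∃ a, ∃ x ∈ s, t = a ⊗ₜ x} = ⊤ := by
  rw [eq_top_iff]
  rintro t -
  induction t using TensorProduct.induction_on with
  | zero => exact zero_mem _
  | add s t hs ht => exact add_mem hs ht
  | tmul a x =>
    have hx : x ∈ Submodule.span k s := hs ▸ Submodule.mem_top
    induction hx using Submodule.span_induction with
    | zero => rw [TensorProduct.tmul_zero]; exact zero_mem _
    | add s t _ _ hs ht => rw [TensorProduct.tmul_add]; exact add_mem hs ht
    | smul r t _ ht => rw [TensorProduct.tmul_smul]; exact Submodule.smul_mem _ _ ht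
    | mem t ht => exact Submodule.subset_span ⟨a, t, ht, rfl⟩

theorem span_pure₄ : Submodule.span k (pure₄ k H) = ⊤ := span_tmul (span_pure₃ k H)

theorem span_pure₅ : Submodule.span k (pure₅ k H) = ⊤ :=
  span_tmul (s := pure₄ k H) (span_pure₄ k H)

theorem span_pure₆ : Submodule.span k (pure₆ k H) = ⊤ :=
  span_tmul (s := pure₅ k H) (span_pure₅ k H)

end Span
/-! ### The elements `p_R`, `p_L`, `q_R`, `q_L` and their commutation rules -/

section Operators

variable (k H : Type*) [Field k] [Ring H] [Algebra k H] [QuasiHopfAlgebra k H]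

/-- `x ⊗ y ↦ Δ(x) p_R (1 ⊗ S(y))` -/
noncomputable def opR : H ⊗[k] H →ₗ[k] H ⊗[k] H :=
  LinearMap.mul' k (H ⊗[k] H) ∘ₗ TensorProduct.map (Δ k H).toLinearMap
    (LinearMap.mulLeft k (pR k H) ∘ₗ TensorProduct.mk k H H 1 ∘ₗ (S k H).toLinearMap)

/-- `x ⊗ y ↦ Δ(y) p_L (S⁻¹(x) ⊗ 1)` -/
noncomputable def opL : H ⊗[k] H →ₗ[k] H ⊗[k] H :=
  LinearMap.mul' k (H ⊗[k] H) ∘ₗ TensorProduct.map (Δ k H).toLinearMap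
    (LinearMap.mulLeft k (pL k H) ∘ₗ (TensorProduct.mk k H H).flip 1 ∘ₗ
      (S k H).symm.toLinearMap) ∘ₗ swap k H

/-- `x ⊗ y ↦ (1 ⊗ S⁻¹(y)) q_R Δ(x)` -/
noncomputable def oqR : H ⊗[k] H →ₗ[k] H ⊗[k] H :=
  LinearMap.mul' k (H ⊗[k] H) ∘ₗ TensorProduct.map
    (LinearMap.mulRight k (qR k H) ∘ₗ TensorProduct.mk k H H 1 ∘ₗ (S k H).symm.toLinearMap)
    (Δ k H).toLinearMap ∘ₗ swap k H

/-- `x ⊗ y ↦ (S(x) ⊗ 1) q_L Δ(y)` -/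
noncomputable def oqL : H ⊗[k] H →ₗ[k] H ⊗[k] H :=
  LinearMap.mul' k (H ⊗[k] H) ∘ₗ TensorProduct.map
    (LinearMap.mulRight k (qL k H) ∘ₗ (TensorProduct.mk k H H).flip 1 ∘ₗ (S k H).toLinearMap)
    (Δ k H).toLinearMap

variable {k H}

@[simp] theorem opR_tmul (x y : H) :
    opR k H (x ⊗ₜ y) = Δ k H x * (pR k H * (1 ⊗ₜ S k H y)) := rfl

@[simp] theorem opL_tmul (x y : H) :
    opL k H (x ⊗ₜ y) = Δ k H y * (pL k H * ((S k H).symm x ⊗ₜ 1)) := rfl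

@[simp] theorem oqR_tmul (x y : H) :
    oqR k H (x ⊗ₜ y) = (1 ⊗ₜ (S k H).symm y) * qR k H * Δ k H x := rfl

@[simp] theorem oqL_tmul (x y : H) :
    oqL k H (x ⊗ₜ y) = (S k H x ⊗ₜ 1) * qL k H * Δ k H y := rfl

theorem opR_one : opR k H 1 = pR k H := by
  rw [Algebra.TensorProduct.one_def, opR_tmul, BimodDual.S_one, map_one,
    ← Algebra.TensorProduct.one_def, one_mul, mul_one]

theorem opL_one : opL k H 1 = pL k H := by
  rw [Algebra.TensorProduct.one_def, opL_tmul, BimodDual.S_symm_one, map_one,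
    ← Algebra.TensorProduct.one_def, one_mul, mul_one]

theorem oqR_one : oqR k H 1 = qR k H := by
  rw [Algebra.TensorProduct.one_def, oqR_tmul, BimodDual.S_symm_one, map_one,
    ← Algebra.TensorProduct.one_def, one_mul, mul_one]

theorem oqL_one : oqL k H 1 = qL k H := by
  rw [Algebra.TensorProduct.one_def, oqL_tmul, BimodDual.S_one, map_one,
    ← Algebra.TensorProduct.one_def, one_mul, mul_one]

/-- `a ⊗ b ⊗ c ↦ a ⊗ b β S(c)`, which maps `φ⁻¹` to `p_R` -/
noncomputable def evPR : H ⊗[k] (H ⊗[k] H) →ₗ[k] H ⊗[k] H :=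
  TensorProduct.map LinearMap.id betaMul

theorem evPR_tmul (a b c : H) : evPR (k := k) (a ⊗ₜ (b ⊗ₜ c)) = a ⊗ₜ (b * (β k H * S k H c)) := rfl

theorem evPR_Φi : evPR (Φi (leg₃₁ k H) (leg₃₂ k H) (leg₃₃ k H)) = pR k H := by
  rw [Φi, tri_legs]; rfl

theorem evPR_rightCollapse : RightCollapse (evPR (k := k) (H := H))
    (conv (leg₃₂ k H) (leg₃₃ k H) (comm₃₂₃ k H)) := by
  refine rightCollapse_of (span_pure₃ k H) ?_
  rintro _ ⟨x, y, z, rfl⟩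
  refine ⟨TensorProduct.mk k H H x ∘ₗ LinearMap.mulLeft k y ∘ₗ LinearMap.mulRight k (S k H z), ?_⟩
  intro a b
  simp [evPR_tmul, BimodDual.S_mul, mul_assoc]

/-- `Δ(a₁) p_R (1 ⊗ S(a₂)) = p_R (a ⊗ 1)` -/
theorem opR_comul (a : H) : opR k H (Δ k H a) = pR k H * (a ⊗ₜ 1) := by
  have h := evPR_rightCollapse.apply_conv_mul_Φi (comm₃₁₂ k H) (comm₃₁₃ k H) (comm₃₂₃ k H) a
  have e1 : ∀ s : H ⊗[k] (H ⊗[k] H), evPR (s * leg₃₁ k H a) = evPR s * (a ⊗ₜ 1) := by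
    intro s
    induction s using tensor_induction₃ with
    | add s t hs ht => simp only [add_mul, map_add, hs, ht]
    | pure x y z => simp [evPR_tmul]
  have e2 : ∀ (v : H ⊗[k] H) (y : H) (s : H ⊗[k] (H ⊗[k] H)),
      evPR (pair (leg₃₁ k H) (leg₃₂ k H) (comm₃₁₂ k H) v * leg₃₃ k H y * s) =
        v * (evPR s * (1 ⊗ₜ S k H y)) := by
    intro v y s
    induction v using tensor_induction₂ with
    | add s t hs ht => simp only [add_mul, map_add, hs, ht]
    | pure v w =>
      induction s using tensor_induction₃ with
      | add s t hs ht => simp only [mul_add, add_mul, map_add, hs, ht]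
      | pure a b c => simp [evPR_tmul, BimodDual.S_mul, mul_assoc]
  have e3 : ∀ v : H ⊗[k] H, evPR (pair (conv (leg₃₁ k H) (leg₃₂ k H) (comm₃₁₂ k H)) (leg₃₃ k H)
      ((comm₃₁₃ k H).conv_left (comm₃₂₃ k H)) v * Φi (leg₃₁ k H) (leg₃₂ k H) (leg₃₃ k H)) =
        opR k H v := by
    intro v
    induction v using tensor_induction₂ with
    | add s t hs ht => simp only [add_mul, map_add, hs, ht]
    | pure x y => rw [pair_tmul, conv_apply, e2, evPR_Φi, opR_tmul]
  rw [conv_apply, e3, e1, evPR_Φi] at h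
  exact h

/-- `a ⊗ b ⊗ c ↦ b S⁻¹(a β) ⊗ c`, which maps `φ` to `p_L` -/
noncomputable def evPL : H ⊗[k] (H ⊗[k] H) →ₗ[k] H ⊗[k] H :=
  TensorProduct.map
    (LinearMap.mul' k H ∘ₗ
      TensorProduct.map LinearMap.id
        ((S k H).symm.toLinearMap ∘ₗ LinearMap.mulRight k (β k H)) ∘ₗ
      (TensorProduct.comm k H H).toLinearMap)
    LinearMap.id ∘ₗ (TensorProduct.assoc k H H H).symm.toLinearMap

theorem evPL_tmul (a b c : H) :
    evPL (k := k) (a ⊗ₜ (b ⊗ₜ c)) = (b * (S k H).symm (a * β k H)) ⊗ₜ c := rfl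

theorem evPL_Φ : evPL (Φ (leg₃₁ k H) (leg₃₂ k H) (leg₃₃ k H)) = pL k H := by
  rw [Φ, tri_legs]; rfl

theorem evPL_rightCollapse : RightCollapse (evPL (k := k) (H := H))
    (conv (leg₃₁ k H) (leg₃₂ k H) (comm₃₁₂ k H)) := by
  refine rightCollapse_of (span_pure₃ k H) ?_
  rintro _ ⟨x, y, z, rfl⟩
  refine ⟨(TensorProduct.mk k H H).flip z ∘ₗ LinearMap.mulLeft k y ∘ₗ (S k H).symm.toLinearMap ∘ₗ
    LinearMap.mulLeft k x, ?_⟩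
  intro a b
  simp [evPL_tmul, BimodDual.S_symm_mul, mul_assoc]

/-- `Δ(a₂) p_L (S⁻¹(a₁) ⊗ 1) = p_L (1 ⊗ a)` -/
theorem opL_comul (a : H) : opL k H (Δ k H a) = pL k H * (1 ⊗ₜ a) := by
  have h := evPL_rightCollapse.apply_Φ_mul_conv (comm₃₁₂ k H) (comm₃₁₃ k H) (comm₃₂₃ k H) a
  have e1 : ∀ s : H ⊗[k] (H ⊗[k] H), evPL (s * leg₃₃ k H a) = evPL s * (1 ⊗ₜ a) := by
    intro s
    induction s using tensor_induction₃ with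
    | add s t hs ht => simp only [add_mul, map_add, hs, ht]
    | pure x y z => simp [evPL_tmul]
  have e2 : ∀ (v : H ⊗[k] H) (x : H) (s : H ⊗[k] (H ⊗[k] H)),
      evPL (leg₃₁ k H x * pair (leg₃₂ k H) (leg₃₃ k H) (comm₃₂₃ k H) v * s) =
        v * (evPL s * ((S k H).symm x ⊗ₜ 1)) := by
    intro v y s
    induction v using tensor_induction₂ with
    | add s t hs ht => simp only [mul_add, add_mul, map_add, hs, ht]
    | pure v w =>
      induction s using tensor_induction₃ with
      | add s t hs ht => simp only [mul_add, add_mul, map_add, hs, ht]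
      | pure a b c => simp [evPL_tmul, BimodDual.S_symm_mul, mul_assoc]
  have e3 : ∀ v : H ⊗[k] H, evPL (pair (leg₃₁ k H) (conv (leg₃₂ k H) (leg₃₃ k H) (comm₃₂₃ k H))
      ((comm₃₁₂ k H).conv_right (comm₃₁₃ k H)) v * Φ (leg₃₁ k H) (leg₃₂ k H) (leg₃₃ k H)) =
        opL k H v := by
    intro v
    induction v using tensor_induction₂ with
    | add s t hs ht => simp only [add_mul, map_add, hs, ht]
    | pure x y => rw [pair_tmul, conv_apply, e2, evPL_Φ, opL_tmul]
  rw [conv_apply, e3, e1, evPL_Φ] at h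
  exact h

/-- `a ⊗ b ⊗ c ↦ a ⊗ S⁻¹(α c) b`, which maps `φ` to `q_R` -/
noncomputable def evQR : H ⊗[k] (H ⊗[k] H) →ₗ[k] H ⊗[k] H :=
  TensorProduct.map LinearMap.id
    (LinearMap.mul' k H ∘ₗ
      TensorProduct.map ((S k H).symm.toLinearMap ∘ₗ LinearMap.mulLeft k (α k H)) LinearMap.id ∘ₗ
      (TensorProduct.comm k H H).toLinearMap)

theorem evQR_tmul (a b c : H) :
    evQR (k := k) (a ⊗ₜ (b ⊗ₜ c)) = a ⊗ₜ ((S k H).symm (α k H * c) * b) := rfl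

theorem evQR_Φ : evQR (Φ (leg₃₁ k H) (leg₃₂ k H) (leg₃₃ k H)) = qR k H := by
  rw [Φ, tri_legs]; rfl

theorem evQR_leftCollapse : LeftCollapse (evQR (k := k) (H := H))
    (conv (leg₃₂ k H) (leg₃₃ k H) (comm₃₂₃ k H)) := by
  refine leftCollapse_of (span_pure₃ k H) ?_
  rintro _ ⟨x, y, z, rfl⟩
  refine ⟨TensorProduct.mk k H H x ∘ₗ LinearMap.mulRight k y ∘ₗ (S k H).symm.toLinearMap ∘ₗ
    LinearMap.mulRight k z, ?_⟩
  intro a b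
  simp [evQR_tmul, BimodDual.S_symm_mul, mul_assoc]

/-- `(1 ⊗ S⁻¹(a₂)) q_R Δ(a₁) = (a ⊗ 1) q_R` -/
theorem oqR_comul (a : H) : oqR k H (Δ k H a) = (a ⊗ₜ 1) * qR k H := by
  have h := evQR_leftCollapse.apply_conv_mul_Φ (comm₃₁₂ k H) (comm₃₁₃ k H) (comm₃₂₃ k H) a
  have e1 : ∀ s : H ⊗[k] (H ⊗[k] H), evQR (leg₃₁ k H a * s) = (a ⊗ₜ 1) * evQR s := by
    intro s
    induction s using tensor_induction₃ with
    | add s t hs ht => simp only [mul_add, map_add, hs, ht]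
    | pure x y z => simp [evQR_tmul]
  have e2 : ∀ (v : H ⊗[k] H) (y : H) (s : H ⊗[k] (H ⊗[k] H)),
      evQR (s * (pair (leg₃₁ k H) (leg₃₂ k H) (comm₃₁₂ k H) v * leg₃₃ k H y)) =
        (1 ⊗ₜ (S k H).symm y) * evQR s * v := by
    intro v y s
    induction v using tensor_induction₂ with
    | add s t hs ht => simp only [mul_add, add_mul, map_add, hs, ht]
    | pure v w =>
      induction s using tensor_induction₃ with
      | add s t hs ht => simp only [mul_add, add_mul, map_add, hs, ht]
      | pure a b c => simp [evQR_tmul, BimodDual.S_symm_mul, mul_assoc]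
  have e3 : ∀ v : H ⊗[k] H, evQR (Φ (leg₃₁ k H) (leg₃₂ k H) (leg₃₃ k H) *
      pair (conv (leg₃₁ k H) (leg₃₂ k H) (comm₃₁₂ k H)) (leg₃₃ k H)
        ((comm₃₁₃ k H).conv_left (comm₃₂₃ k H)) v) = oqR k H v := by
    intro v
    induction v using tensor_induction₂ with
    | add s t hs ht => simp only [mul_add, map_add, hs, ht]
    | pure x y => rw [pair_tmul, conv_apply, e2, evQR_Φ, oqR_tmul]
  rw [conv_apply, e3, e1, evQR_Φ] at h
  exact h

/-- `a ⊗ b ⊗ c ↦ S(a) α b ⊗ c`, which maps `φ⁻¹` to `q_L` -/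
noncomputable def evQL : H ⊗[k] (H ⊗[k] H) →ₗ[k] H ⊗[k] H :=
  TensorProduct.map alphaMul LinearMap.id ∘ₗ (TensorProduct.assoc k H H H).symm.toLinearMap

theorem evQL_tmul (a b c : H) :
    evQL (k := k) (a ⊗ₜ (b ⊗ₜ c)) = (S k H a * (α k H * b)) ⊗ₜ c := rfl

theorem evQL_Φi : evQL (Φi (leg₃₁ k H) (leg₃₂ k H) (leg₃₃ k H)) = qL k H := by
  rw [Φi, tri_legs]; rfl

theorem evQL_leftCollapse : LeftCollapse (evQL (k := k) (H := H))
    (conv (leg₃₁ k H) (leg₃₂ k H) (comm₃₁₂ k H)) := by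
  refine leftCollapse_of (span_pure₃ k H) ?_
  rintro _ ⟨x, y, z, rfl⟩
  refine ⟨(TensorProduct.mk k H H).flip z ∘ₗ LinearMap.mulLeft k (S k H x) ∘ₗ
    LinearMap.mulRight k y, ?_⟩
  intro a b
  simp [evQL_tmul, BimodDual.S_mul, mul_assoc]

/-- `(S(a₁) ⊗ 1) q_L Δ(a₂) = (1 ⊗ a) q_L` -/
theorem oqL_comul (a : H) : oqL k H (Δ k H a) = (1 ⊗ₜ a) * qL k H := by
  have h := evQL_leftCollapse.apply_Φi_mul_conv (comm₃₁₂ k H) (comm₃₁₃ k H) (comm₃₂₃ k H) a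
  have e1 : ∀ s : H ⊗[k] (H ⊗[k] H), evQL (leg₃₃ k H a * s) = (1 ⊗ₜ a) * evQL s := by
    intro s
    induction s using tensor_induction₃ with
    | add s t hs ht => simp only [mul_add, map_add, hs, ht]
    | pure x y z => simp [evQL_tmul]
  have e2 : ∀ (v : H ⊗[k] H) (x : H) (s : H ⊗[k] (H ⊗[k] H)),
      evQL (s * (leg₃₁ k H x * pair (leg₃₂ k H) (leg₃₃ k H) (comm₃₂₃ k H) v)) =
        (S k H x ⊗ₜ 1) * evQL s * v := by
    intro v y s
    induction v using tensor_induction₂ with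
    | add s t hs ht => simp only [mul_add, map_add, hs, ht]
    | pure v w =>
      induction s using tensor_induction₃ with
      | add s t hs ht => simp only [mul_add, add_mul, map_add, hs, ht]
      | pure a b c => simp [evQL_tmul, BimodDual.S_mul, mul_assoc]
  have e3 : ∀ v : H ⊗[k] H, evQL (Φi (leg₃₁ k H) (leg₃₂ k H) (leg₃₃ k H) *
      pair (leg₃₁ k H) (conv (leg₃₂ k H) (leg₃₃ k H) (comm₃₂₃ k H))
        ((comm₃₁₂ k H).conv_right (comm₃₁₃ k H)) v) = oqL k H v := by
    intro v
    induction v using tensor_induction₂ with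
    | add s t hs ht => simp only [mul_add, map_add, hs, ht]
    | pure x y => rw [pair_tmul, conv_apply, e2, evQL_Φi, oqL_tmul]
  rw [conv_apply, e3, e1, evQL_Φi] at h
  exact h

end Operators
/-! ### The elements `p` and `q` are inverse to each other -/

section Inverse

variable {k H : Type*} [Field k] [Ring H] [Algebra k H] [QuasiHopfAlgebra k H]

/-- `a ⊗ b ⊗ c ↦ a β S(b) α c` -/
noncomputable def betaAlpha : H ⊗[k] (H ⊗[k] H) →ₗ[k] H :=
  LinearMap.mul' k H ∘ₗ TensorProduct.map LinearMap.id
    (LinearMap.mul' k H ∘ₗ TensorProduct.map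
      (LinearMap.mulLeft k (β k H) ∘ₗ (S k H).toLinearMap) (LinearMap.mulLeft k (α k H)))

theorem betaAlpha_tmul (a b c : H) :
    betaAlpha (k := k) (a ⊗ₜ (b ⊗ₜ c)) = a * (β k H * S k H b * (α k H * c)) := rfl

theorem betaAlpha_φ : betaAlpha (φ k H) = 1 := QuasiHopfAlgebra.reassoc_antipode

/-- `a ⊗ b ⊗ c ↦ S(a) α b β S(c)` -/
noncomputable def alphaBeta : H ⊗[k] (H ⊗[k] H) →ₗ[k] H :=
  LinearMap.mul' k H ∘ₗ TensorProduct.map (S k H).toLinearMap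
    (LinearMap.mul' k H ∘ₗ TensorProduct.map
      (LinearMap.mulLeft k (α k H)) (LinearMap.mulLeft k (β k H) ∘ₗ (S k H).toLinearMap))

theorem alphaBeta_tmul (a b c : H) :
    alphaBeta (k := k) (a ⊗ₜ (b ⊗ₜ c)) = S k H a * (α k H * b * (β k H * S k H c)) := rfl

theorem alphaBeta_φInv : alphaBeta (φInv k H) = 1 := QuasiHopfAlgebra.reassoc_inv_antipode

/-- `Δ(q_R¹) p_R (1 ⊗ S(q_R²)) = 1 ⊗ 1` -/
theorem opR_qR : opR k H (qR k H) = 1 := by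
  let E : H ⊗[k] (H ⊗[k] (H ⊗[k] H)) →ₗ[k] H ⊗[k] H := TensorProduct.map LinearMap.id betaAlpha
  have hE : ∀ a b c d : H, E (a ⊗ₜ (b ⊗ₜ (c ⊗ₜ d))) =
    a ⊗ₜ (b * (β k H * S k H c * (α k H * d))) := fun _ _ _ _ => rfl
  have hR : RightCollapse E (conv (leg₄₂ k H) (leg₄₃ k H) (comm₄₂₃ k H)) := by
    refine rightCollapse_of (span_pure₄ k H) ?_
    rintro _ ⟨x, _, ⟨y, z, w, rfl⟩, rfl⟩
    refine ⟨TensorProduct.mk k H H x ∘ₗ LinearMap.mulLeft k y ∘ₗ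
      LinearMap.mulRight k (S k H z * α k H * w), ?_⟩
    intro a b
    simp [hE, BimodDual.S_mul, mul_assoc]
  have hL : LeftCollapse E (conv (leg₄₃ k H) (leg₄₄ k H) (comm₄₃₄ k H)) := by
    refine leftCollapse_of (span_pure₄ k H) ?_
    rintro _ ⟨x, _, ⟨y, z, w, rfl⟩, rfl⟩
    refine ⟨TensorProduct.mk k H H x ∘ₗ LinearMap.mulLeft k (y * β k H * S k H z) ∘ₗ
      LinearMap.mulRight k w, ?_⟩
    intro a b
    simp [hE, BimodDual.S_mul, mul_assoc]
  have p := apply_pentagon_left (comm₄₁₂ k H) (comm₄₁₃ k H) (comm₄₁₄ k H) (comm₄₂₃ k H)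
    (comm₄₂₄ k H) (comm₄₃₄ k H) hR hL
  have e1 : ∀ (v : H ⊗[k] H) (y z : H) (s : H ⊗[k] (H ⊗[k] H)),
      E (pair (leg₄₁ k H) (leg₄₂ k H) (comm₄₁₂ k H) v * (leg₄₃ k H y * leg₄₄ k H z) *
        tri (leg₄₁ k H) (leg₄₂ k H) (leg₄₃ k H) s) =
        v * (evPR s * (1 ⊗ₜ S k H ((S k H).symm (α k H * z) * y))) := by
    intro v y z s
    induction v using tensor_induction₂ with
    | add s t hs ht => simp only [add_mul, map_add, hs, ht]
    | pure v w =>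
      induction s using tensor_induction₃ with
      | add s t hs ht => simp only [mul_add, add_mul, map_add, hs, ht]
      | pure a b c => simp [evPR_tmul, hE, BimodDual.S_mul, mul_assoc]
  have e2 : ∀ t : H ⊗[k] (H ⊗[k] H), E (tri (conv (leg₄₁ k H) (leg₄₂ k H) (comm₄₁₂ k H))
      (leg₄₃ k H) (leg₄₄ k H) t * Φi (leg₄₁ k H) (leg₄₂ k H) (leg₄₃ k H)) =
        opR k H (evQR t) := by
    intro t
    induction t using tensor_induction₃ with
    | add s t hs ht => simp only [add_mul, map_add, hs, ht]
    | pure x y z => rw [tri_tmul, conv_apply, Φi, e1]; rfl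
  refine (e2 (φ k H)).symm.trans (p.trans ?_)
  rw [Φ, tri_leg₄_last]
  exact congrArg (fun x => (1 : H) ⊗ₜ[k] x) betaAlpha_φ

/-- `(1 ⊗ S⁻¹(p_R²)) q_R Δ(p_R¹) = 1 ⊗ 1` -/
theorem oqR_pR : oqR k H (pR k H) = 1 := by
  let E : H ⊗[k] (H ⊗[k] (H ⊗[k] H)) →ₗ[k] H ⊗[k] H :=
    TensorProduct.map LinearMap.id ((S k H).symm.toLinearMap ∘ₗ alphaBeta)
  have hE : ∀ a b c d : H, E (a ⊗ₜ (b ⊗ₜ (c ⊗ₜ d))) =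
    a ⊗ₜ (S k H).symm (S k H b * (α k H * c * (β k H * S k H d))) := fun _ _ _ _ => rfl
  have hL : LeftCollapse E (conv (leg₄₂ k H) (leg₄₃ k H) (comm₄₂₃ k H)) := by
    refine leftCollapse_of (span_pure₄ k H) ?_
    rintro _ ⟨x, _, ⟨y, z, w, rfl⟩, rfl⟩
    refine ⟨TensorProduct.mk k H H x ∘ₗ (S k H).symm.toLinearMap ∘ₗ LinearMap.mulLeft k (S k H y) ∘ₗ
      LinearMap.mulRight k (z * β k H * S k H w), ?_⟩
    intro a b
    simp [hE, BimodDual.S_mul, mul_assoc]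
  have hR : RightCollapse E (conv (leg₄₃ k H) (leg₄₄ k H) (comm₄₃₄ k H)) := by
    refine rightCollapse_of (span_pure₄ k H) ?_
    rintro _ ⟨x, _, ⟨y, z, w, rfl⟩, rfl⟩
    refine ⟨TensorProduct.mk k H H x ∘ₗ (S k H).symm.toLinearMap ∘ₗ
      LinearMap.mulLeft k (S k H y * α k H * z) ∘ₗ LinearMap.mulRight k (S k H w), ?_⟩
    intro a b
    simp [hE, BimodDual.S_mul, mul_assoc]
  have p := apply_pentagon_left_inv (comm₄₁₂ k H) (comm₄₁₃ k H) (comm₄₁₄ k H) (comm₄₂₃ k H)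
    (comm₄₂₄ k H) (comm₄₃₄ k H) hL hR
  have e1 : ∀ (v : H ⊗[k] H) (y z : H) (s : H ⊗[k] (H ⊗[k] H)),
      E (tri (leg₄₁ k H) (leg₄₂ k H) (leg₄₃ k H) s *
        (pair (leg₄₁ k H) (leg₄₂ k H) (comm₄₁₂ k H) v * (leg₄₃ k H y * leg₄₄ k H z))) =
        (1 ⊗ₜ (S k H).symm (y * (β k H * S k H z))) * evQR s * v := by
    intro v y z s
    induction v using tensor_induction₂ with
    | add s t hs ht => simp only [add_mul, mul_add, map_add, hs, ht]
    | pure v w =>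
      induction s using tensor_induction₃ with
      | add s t hs ht => simp only [mul_add, add_mul, map_add, hs, ht]
      | pure a b c => simp [evQR_tmul, hE, BimodDual.S_mul, BimodDual.S_symm_mul, mul_assoc]
  have e2 : ∀ t : H ⊗[k] (H ⊗[k] H), E (Φ (leg₄₁ k H) (leg₄₂ k H) (leg₄₃ k H) *
      tri (conv (leg₄₁ k H) (leg₄₂ k H) (comm₄₁₂ k H)) (leg₄₃ k H) (leg₄₄ k H) t) =
        oqR k H (evPR t) := by
    intro t
    induction t using tensor_induction₃ with
    | add s t hs ht => simp only [mul_add, map_add, hs, ht]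
    | pure x y z => rw [tri_tmul, conv_apply, Φ, e1]; rfl
  refine (e2 (φInv k H)).symm.trans (p.trans ?_)
  rw [Φi, tri_leg₄_last]
  refine (congrArg (fun x => (1 : H) ⊗ₜ[k] (S k H).symm x) alphaBeta_φInv).trans ?_
  rw [BimodDual.S_symm_one]; rfl

/-- `Δ(q_L²) p_L (S⁻¹(q_L¹) ⊗ 1) = 1 ⊗ 1` -/
theorem opL_qL : opL k H (qL k H) = 1 := by
  let E : H ⊗[k] (H ⊗[k] (H ⊗[k] H)) →ₗ[k] H ⊗[k] H :=
    TensorProduct.map ((S k H).symm.toLinearMap ∘ₗ alphaBeta) LinearMap.id ∘ₗ lastOut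
  have hE : ∀ a b c d : H, E (a ⊗ₜ (b ⊗ₜ (c ⊗ₜ d))) =
    (S k H).symm (S k H a * (α k H * b * (β k H * S k H c))) ⊗ₜ d := fun _ _ _ _ => rfl
  have hL : LeftCollapse E (conv (leg₄₁ k H) (leg₄₂ k H) (comm₄₁₂ k H)) := by
    refine leftCollapse_of (span_pure₄ k H) ?_
    rintro _ ⟨x, _, ⟨y, z, w, rfl⟩, rfl⟩
    refine ⟨(TensorProduct.mk k H H).flip w ∘ₗ (S k H).symm.toLinearMap ∘ₗ
      LinearMap.mulLeft k (S k H x) ∘ₗ LinearMap.mulRight k (y * β k H * S k H z), ?_⟩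
    intro a b
    simp [hE, BimodDual.S_mul, mul_assoc]
  have hR : RightCollapse E (conv (leg₄₂ k H) (leg₄₃ k H) (comm₄₂₃ k H)) := by
    refine rightCollapse_of (span_pure₄ k H) ?_
    rintro _ ⟨x, _, ⟨y, z, w, rfl⟩, rfl⟩
    refine ⟨(TensorProduct.mk k H H).flip w ∘ₗ (S k H).symm.toLinearMap ∘ₗ
      LinearMap.mulLeft k (S k H x * α k H * y) ∘ₗ LinearMap.mulRight k (S k H z), ?_⟩
    intro a b
    simp [hE, BimodDual.S_mul, mul_assoc]
  have p := apply_pentagon_right (comm₄₁₂ k H) (comm₄₁₃ k H) (comm₄₁₄ k H) (comm₄₂₃ k H)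
    (comm₄₂₄ k H) (comm₄₃₄ k H) hL hR
  have e1 : ∀ (v : H ⊗[k] H) (x y : H) (s : H ⊗[k] (H ⊗[k] H)),
      E (leg₄₁ k H x * (leg₄₂ k H y * pair (leg₄₃ k H) (leg₄₄ k H) (comm₄₃₄ k H) v) *
        tri (leg₄₂ k H) (leg₄₃ k H) (leg₄₄ k H) s) =
        v * (evPL s * ((S k H).symm (S k H x * (α k H * y)) ⊗ₜ 1)) := by
    intro v x y s
    induction v using tensor_induction₂ with
    | add s t hs ht => simp only [mul_add, add_mul, map_add, hs, ht]
    | pure v w =>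
      induction s using tensor_induction₃ with
      | add s t hs ht => simp only [mul_add, add_mul, map_add, hs, ht]
      | pure a b c => simp [evPL_tmul, hE, BimodDual.S_mul, BimodDual.S_symm_mul, mul_assoc]
  have e2 : ∀ t : H ⊗[k] (H ⊗[k] H), E (tri (leg₄₁ k H) (leg₄₂ k H)
      (conv (leg₄₃ k H) (leg₄₄ k H) (comm₄₃₄ k H)) t * Φ (leg₄₂ k H) (leg₄₃ k H) (leg₄₄ k H)) =
        opL k H (evQL t) := by
    intro t
    induction t using tensor_induction₃ with
    | add s t hs ht => simp only [add_mul, map_add, hs, ht]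
    | pure x y z => rw [tri_tmul, conv_apply, Φ, e1]; rfl
  refine (e2 (φInv k H)).symm.trans (p.trans ?_)
  rw [Φi, LinearMap.comp_apply, lastOut_tri_leg₄]
  refine (congrArg (fun x => (S k H).symm x ⊗ₜ[k] (1 : H)) alphaBeta_φInv).trans ?_
  rw [BimodDual.S_symm_one]; rfl

/-- `(S(p_L¹) ⊗ 1) q_L Δ(p_L²) = 1 ⊗ 1` -/
theorem oqL_pL : oqL k H (pL k H) = 1 := by
  let E : H ⊗[k] (H ⊗[k] (H ⊗[k] H)) →ₗ[k] H ⊗[k] H :=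
    TensorProduct.map betaAlpha LinearMap.id ∘ₗ lastOut
  have hE : ∀ a b c d : H, E (a ⊗ₜ (b ⊗ₜ (c ⊗ₜ d))) =
    (a * (β k H * S k H b * (α k H * c))) ⊗ₜ d := fun _ _ _ _ => rfl
  have hL : LeftCollapse E (conv (leg₄₂ k H) (leg₄₃ k H) (comm₄₂₃ k H)) := by
    refine leftCollapse_of (span_pure₄ k H) ?_
    rintro _ ⟨x, _, ⟨y, z, w, rfl⟩, rfl⟩
    refine ⟨(TensorProduct.mk k H H).flip w ∘ₗ
      LinearMap.mulLeft k (x * β k H * S k H y) ∘ₗ LinearMap.mulRight k z, ?_⟩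
    intro a b
    simp [hE, BimodDual.S_mul, mul_assoc]
  have hR : RightCollapse E (conv (leg₄₁ k H) (leg₄₂ k H) (comm₄₁₂ k H)) := by
    refine rightCollapse_of (span_pure₄ k H) ?_
    rintro _ ⟨x, _, ⟨y, z, w, rfl⟩, rfl⟩
    refine ⟨(TensorProduct.mk k H H).flip w ∘ₗ
      LinearMap.mulLeft k x ∘ₗ LinearMap.mulRight k (S k H y * α k H * z), ?_⟩
    intro a b
    simp [hE, BimodDual.S_mul, mul_assoc]
  have p := apply_pentagon_right_inv (comm₄₁₂ k H) (comm₄₁₃ k H) (comm₄₁₄ k H) (comm₄₂₃ k H)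
    (comm₄₂₄ k H) (comm₄₃₄ k H) hL hR
  have e1 : ∀ (v : H ⊗[k] H) (x y : H) (s : H ⊗[k] (H ⊗[k] H)),
      E (tri (leg₄₂ k H) (leg₄₃ k H) (leg₄₄ k H) s *
        (leg₄₁ k H x * (leg₄₂ k H y * pair (leg₄₃ k H) (leg₄₄ k H) (comm₄₃₄ k H) v))) =
        (S k H (y * (S k H).symm (x * β k H)) ⊗ₜ 1) * evQL s * v := by
    intro v x y s
    induction v using tensor_induction₂ with
    | add s t hs ht => simp only [mul_add, map_add, hs, ht]
    | pure v w =>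
      induction s using tensor_induction₃ with
      | add s t hs ht => simp only [mul_add, add_mul, map_add, hs, ht]
      | pure a b c => simp [evQL_tmul, hE, BimodDual.S_mul, mul_assoc]
  have e2 : ∀ t : H ⊗[k] (H ⊗[k] H), E (Φi (leg₄₂ k H) (leg₄₃ k H) (leg₄₄ k H) *
      tri (leg₄₁ k H) (leg₄₂ k H) (conv (leg₄₃ k H) (leg₄₄ k H) (comm₄₃₄ k H)) t) =
        oqL k H (evPL t) := by
    intro t
    induction t using tensor_induction₃ with
    | add s t hs ht => simp only [mul_add, map_add, hs, ht]
    | pure x y z => rw [tri_tmul, conv_apply, Φi, e1]; rfl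
  refine (e2 (φ k H)).symm.trans (p.trans ?_)
  rw [Φ, LinearMap.comp_apply, lastOut_tri_leg₄]
  exact congrArg (fun x => x ⊗ₜ[k] (1 : H)) betaAlpha_φ

end Inverse
/-! ### Contractions of `p` and `q` with the counit and the antipode -/

section Counit

variable {k H : Type*} [Field k] [Ring H] [Algebra k H] [QuasiHopfAlgebra k H]

variable (k H) in
/-- `a ⊗ b ↦ ε(a) b` -/
noncomputable def epsL : H ⊗[k] H →ₗ[k] H :=
  (TensorProduct.lid k H).toLinearMap ∘ₗ TensorProduct.map (ε k H).toLinearMap LinearMap.id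

variable (k H) in
/-- `a ⊗ b ↦ ε(b) a` -/
noncomputable def epsR : H ⊗[k] H →ₗ[k] H :=
  (TensorProduct.rid k H).toLinearMap ∘ₗ TensorProduct.map LinearMap.id (ε k H).toLinearMap

@[simp] theorem epsL_tmul (a b : H) : epsL k H (a ⊗ₜ b) = ε k H a • b := rfl

@[simp] theorem epsR_tmul (a b : H) : epsR k H (a ⊗ₜ b) = ε k H b • a := rfl

theorem epsL_comul (a : H) : epsL k H (Δ k H a) = a := QuasiBialgebra.counit_left a

theorem epsR_comul (a : H) : epsR k H (Δ k H a) = a := QuasiBialgebra.counit_right a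

theorem epsL_map (G : H ⊗[k] H →ₗ[k] H) (t : H ⊗[k] (H ⊗[k] H)) :
    epsL k H (TensorProduct.map LinearMap.id G t) =
      G (tri (triv k H _) (leg₂₁ k H) (leg₂₂ k H) t) := by
  induction t using tensor_induction₃ with
  | add s t hs ht => simp only [map_add, hs, ht]
  | pure a b c => simp [triv_apply, ← Algebra.smul_def, ← TensorProduct.smul_tmul']

theorem epsR_map (G : H ⊗[k] H →ₗ[k] H) (t : H ⊗[k] (H ⊗[k] H)) :
    epsR k H (TensorProduct.map G LinearMap.id ((TensorProduct.assoc k H H H).symm t)) =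
      G (tri (leg₂₁ k H) (leg₂₂ k H) (triv k H _) t) := by
  induction t using tensor_induction₃ with
  | add s t hs ht => simp only [map_add, hs, ht]
  | pure a b c =>
    simp [triv_apply, ← Algebra.commutes, ← Algebra.smul_def, ← TensorProduct.smul_tmul']

theorem epsL_pR : epsL k H (pR k H) = β k H := by
  refine (epsL_map betaMul (φInv k H)).trans ?_
  rw [← Φi, Φi_triv_left (comm₂₁₂ k H), betaMul_one]

theorem epsR_qL : epsR k H (qL k H) = α k H := by
  refine (epsR_map alphaMul (φInv k H)).trans ?_
  rw [← Φi, Φi_triv_right (comm₂₁₂ k H), alphaMul_one]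

theorem epsL_qR : epsL k H (qR k H) = (S k H).symm (α k H) := by
  refine (epsL_map _ (φ k H)).trans ?_
  rw [← Φ, Φ_triv_left (comm₂₁₂ k H), Algebra.TensorProduct.one_def]
  simp

theorem epsR_pL : epsR k H (pL k H) = (S k H).symm (β k H) := by
  refine (epsR_map _ (φ k H)).trans ?_
  rw [← Φ, Φ_triv_right (comm₂₁₂ k H), Algebra.TensorProduct.one_def]
  simp

theorem alphaMul_pR : alphaMul (pR k H) = 1 := by
  rw [← alphaBeta_φInv (k := k) (H := H)]
  change alphaMul (evPR (φInv k H)) = _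
  induction φInv k H using tensor_induction₃ with
  | add s t hs ht => simp only [map_add, hs, ht]
  | pure a b c => rw [evPR_tmul, alphaMul_tmul, alphaBeta_tmul]; simp only [mul_assoc]

theorem alphaMul_pL : alphaMul (pL k H) = 1 := by
  rw [← betaAlpha_φ (k := k) (H := H)]
  change alphaMul (evPL (φ k H)) = _
  induction φ k H using tensor_induction₃ with
  | add s t hs ht => simp only [map_add, hs, ht]
  | pure a b c =>
    rw [evPL_tmul, alphaMul_tmul, betaAlpha_tmul, BimodDual.S_mul, LinearEquiv.apply_symm_apply]
    simp only [mul_assoc]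

theorem betaMul_qL : betaMul (qL k H) = 1 := by
  rw [← alphaBeta_φInv (k := k) (H := H)]
  change betaMul (evQL (φInv k H)) = _
  induction φInv k H using tensor_induction₃ with
  | add s t hs ht => simp only [map_add, hs, ht]
  | pure a b c => rw [evQL_tmul, betaMul_tmul, alphaBeta_tmul]; simp only [mul_assoc]

theorem betaMul_qR : betaMul (qR k H) = 1 := by
  rw [← betaAlpha_φ (k := k) (H := H)]
  change betaMul (evQR (φ k H)) = _
  induction φ k H using tensor_induction₃ with
  | add s t hs ht => simp only [map_add, hs, ht]
  | pure a b c =>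
    rw [evQR_tmul, betaMul_tmul, betaAlpha_tmul, BimodDual.S_mul, LinearEquiv.apply_symm_apply]
    simp only [mul_assoc]

end Counit

/-! ### Biinvariant forms and bimodule maps -/

section TensorAction

set_option linter.unusedSectionVars false

variable {k H P Q : Type*} [Field k] [Ring H] [Algebra k H]
  [AddCommGroup P] [Module k P] [Module H P] [Module Hᵐᵒᵖ P] [SMulCommClass H Hᵐᵒᵖ P]
  [IsScalarTower k H P] [IsScalarTower k Hᵐᵒᵖ P]
  [AddCommGroup Q] [Module k Q] [Module H Q] [Module Hᵐᵒᵖ Q] [SMulCommClass H Hᵐᵒᵖ Q]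
  [IsScalarTower k H Q] [IsScalarTower k Hᵐᵒᵖ Q]

variable (k H P Q) in
/-- The left action of `H ⊗ H` on `P ⊗ Q`. -/
noncomputable abbrev lAct₂ : H ⊗[k] H →ₗ[k] P ⊗[k] Q →ₗ[k] P ⊗[k] Q :=
  tensorAct (lAct k H P) (lAct k H Q)

variable (k H P Q) in
/-- The right action of `H ⊗ H` on `P ⊗ Q`. -/
noncomputable abbrev rAct₂ : H ⊗[k] H →ₗ[k] P ⊗[k] Q →ₗ[k] P ⊗[k] Q :=
  tensorAct (rAct k H P) (rAct k H Q)

@[simp] theorem lAct_apply (a : H) (x : P) : lAct k H P a x = a • x := rfl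

@[simp] theorem rAct_apply (a : H) (x : P) : rAct k H P a x = MulOpposite.op a • x := rfl

@[simp] theorem tensorAct_tmul {A B : Type*} [Ring A] [Algebra k A] [Ring B] [Algebra k B]
    (l : A →ₗ[k] P →ₗ[k] P) (r : B →ₗ[k] Q →ₗ[k] Q) (a : A) (b : B) (x : P) (y : Q) :
    tensorAct l r (a ⊗ₜ b) (x ⊗ₜ y) = l a x ⊗ₜ r b y := by
  simp [tensorAct]

theorem lAct₂_mul (u v : H ⊗[k] H) (z : P ⊗[k] Q) :
    lAct₂ k H P Q (u * v) z = lAct₂ k H P Q u (lAct₂ k H P Q v z) := by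
  induction z using TensorProduct.induction_on with
  | zero => simp only [map_zero]
  | add s t hs ht => simp only [map_add, hs, ht]
  | tmul x y =>
    induction u using tensor_induction₂ with
    | add s t hs ht => simp only [add_mul, map_add, LinearMap.add_apply, hs, ht]
    | pure a b =>
      induction v using tensor_induction₂ with
      | add s t hs ht => simp only [mul_add, map_add, LinearMap.add_apply, hs, ht]
      | pure c d => simp [mul_smul]

theorem rAct₂_mul (u v : H ⊗[k] H) (z : P ⊗[k] Q) :
    rAct₂ k H P Q (u * v) z = rAct₂ k H P Q v (rAct₂ k H P Q u z) := by
  induction z using TensorProduct.induction_on with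
  | zero => simp only [map_zero]
  | add s t hs ht => simp only [map_add, hs, ht]
  | tmul x y =>
    induction u using tensor_induction₂ with
    | add s t hs ht => simp only [add_mul, map_add, LinearMap.add_apply, hs, ht]
    | pure a b =>
      induction v using tensor_induction₂ with
      | add s t hs ht => simp only [mul_add, map_add, LinearMap.add_apply, hs, ht]
      | pure c d => simp [mul_smul]

theorem lAct₂_rAct₂ (u v : H ⊗[k] H) (z : P ⊗[k] Q) :
    lAct₂ k H P Q u (rAct₂ k H P Q v z) = rAct₂ k H P Q v (lAct₂ k H P Q u z) := by
  induction z using TensorProduct.induction_on with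
  | zero => simp only [map_zero]
  | add s t hs ht => simp only [map_add, hs, ht]
  | tmul x y =>
    induction u using tensor_induction₂ with
    | add s t hs ht => simp only [map_add, LinearMap.add_apply, hs, ht]
    | pure a b =>
      induction v using tensor_induction₂ with
      | add s t hs ht => simp only [map_add, LinearMap.add_apply, hs, ht]
      | pure c d => simp [smul_comm]

theorem lAct₂_one (z : P ⊗[k] Q) : lAct₂ k H P Q 1 z = z := by
  induction z using TensorProduct.induction_on with
  | zero => simp only [map_zero]
  | add s t hs ht => simp only [map_add, hs, ht]
  | tmul x y => simp [Algebra.TensorProduct.one_def]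

theorem rAct₂_one (z : P ⊗[k] Q) : rAct₂ k H P Q 1 z = z := by
  induction z using TensorProduct.induction_on with
  | zero => simp only [map_zero]
  | add s t hs ht => simp only [map_add, hs, ht]
  | tmul x y => simp [Algebra.TensorProduct.one_def]

end TensorAction

section Forms

set_option linter.unusedSectionVars false

variable {k H K M : Type*} [Field k] [Ring H] [Algebra k H] [QuasiHopfAlgebra k H]
  [AddCommGroup K] [Module k K] [Module H K] [Module Hᵐᵒᵖ K] [SMulCommClass H Hᵐᵒᵖ K]
  [IsScalarTower k H K] [IsScalarTower k Hᵐᵒᵖ K]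
  [AddCommGroup M] [Module k M] [Module H M] [Module Hᵐᵒᵖ M] [SMulCommClass H Hᵐᵒᵖ M]
  [IsScalarTower k H M] [IsScalarTower k Hᵐᵒᵖ M] {σ : K ⊗[k] M →ₗ[k] k}

theorem IsBiinvariant.lAct₂_comul (hσ : IsBiinvariant H σ) (a : H) (z : K ⊗[k] M) :
    σ (lAct₂ k H K M (Δ k H a) z) = ε k H a * σ z := by
  induction z using TensorProduct.induction_on with
  | zero => simp only [map_zero, mul_zero]
  | add s t hs ht => simp only [map_add, hs, ht, mul_add]
  | tmul x y => exact (hσ a x y).2.symm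

theorem IsBiinvariant.rAct₂_comul (hσ : IsBiinvariant H σ) (a : H) (z : K ⊗[k] M) :
    σ (rAct₂ k H K M (Δ k H a) z) = ε k H a * σ z := by
  induction z using TensorProduct.induction_on with
  | zero => simp only [map_zero, mul_zero]
  | add s t hs ht => simp only [map_add, hs, ht, mul_add]
  | tmul x y => exact (hσ a x y).1

/-- A biinvariant form does not see the factor `Δ(u¹)` of `opR u`, except for its counit. The next
three lemmas are variants. -/
theorem IsBiinvariant.opR (hσ : IsBiinvariant H σ) (u : H ⊗[k] H) (z : K ⊗[k] M) :
    σ (lAct₂ k H K M (opR k H u) z) =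
      σ (lAct₂ k H K M (pR k H * (1 ⊗ₜ S k H (epsL k H u))) z) := by
  induction u using tensor_induction₂ with
  | add s t hs ht =>
    simp only [map_add, TensorProduct.tmul_add, mul_add, LinearMap.add_apply, hs, ht]
  | pure a b =>
    rw [opR_tmul, lAct₂_mul, hσ.lAct₂_comul, epsL_tmul]
    simp

theorem IsBiinvariant.opL (hσ : IsBiinvariant H σ) (u : H ⊗[k] H) (z : K ⊗[k] M) :
    σ (lAct₂ k H K M (opL k H u) z) =
      σ (lAct₂ k H K M (pL k H * ((S k H).symm (epsR k H u) ⊗ₜ 1)) z) := by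
  induction u using tensor_induction₂ with
  | add s t hs ht =>
    simp only [map_add, TensorProduct.add_tmul, mul_add, LinearMap.add_apply, hs, ht]
  | pure a b =>
    rw [opL_tmul, lAct₂_mul, hσ.lAct₂_comul, epsR_tmul]
    simp [← TensorProduct.smul_tmul']

theorem IsBiinvariant.oqR (hσ : IsBiinvariant H σ) (u : H ⊗[k] H) (z : K ⊗[k] M) :
    σ (rAct₂ k H K M (oqR k H u) z) =
      σ (rAct₂ k H K M ((1 ⊗ₜ (S k H).symm (epsL k H u)) * qR k H) z) := by
  induction u using tensor_induction₂ with
  | add s t hs ht =>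
    simp only [map_add, TensorProduct.tmul_add, add_mul, LinearMap.add_apply, hs, ht]
  | pure a b =>
    rw [oqR_tmul, rAct₂_mul, hσ.rAct₂_comul, epsL_tmul]
    simp

theorem IsBiinvariant.oqL (hσ : IsBiinvariant H σ) (u : H ⊗[k] H) (z : K ⊗[k] M) :
    σ (rAct₂ k H K M (oqL k H u) z) =
      σ (rAct₂ k H K M ((S k H (epsR k H u) ⊗ₜ 1) * qL k H) z) := by
  induction u using tensor_induction₂ with
  | add s t hs ht =>
    simp only [map_add, TensorProduct.add_tmul, add_mul, LinearMap.add_apply, hs, ht]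
  | pure a b =>
    rw [oqL_tmul, rAct₂_mul, hσ.rAct₂_comul, epsR_tmul]
    simp [← TensorProduct.smul_tmul']

/-- Under a biinvariant form, `p (S⁻¹(a) ⊗ 1)` and `p (1 ⊗ a)` agree for both choices of `p`; this
is why `f_σ` is a map of left modules. -/
theorem IsBiinvariant.mul_p (hσ : IsBiinvariant H σ) {p : H ⊗[k] H}
    (hp : p ∈ ({pL k H, pR k H} : Set (H ⊗[k] H))) (a : H) (z : K ⊗[k] M) :
    σ (lAct₂ k H K M (p * ((S k H).symm a ⊗ₜ 1)) z) = σ (lAct₂ k H K M (p * (1 ⊗ₜ a)) z) := by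
  rcases hp with rfl | rfl
  · have := hσ.opL (Δ k H a) z
    rw [opL_comul, epsR_comul] at this
    exact this.symm
  · have := hσ.opR (Δ k H ((S k H).symm a)) z
    rwa [opR_comul, epsL_comul, LinearEquiv.apply_symm_apply] at this

/-- Under a biinvariant form, `p (S⁻¹(α) ⊗ 1)` acts as `1`. -/
theorem IsBiinvariant.mul_p_alpha (hσ : IsBiinvariant H σ) {p : H ⊗[k] H}
    (hp : p ∈ ({pL k H, pR k H} : Set (H ⊗[k] H))) (z : K ⊗[k] M) :
    σ (lAct₂ k H K M (p * ((S k H).symm (α k H) ⊗ₜ 1)) z) = σ z := by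
  have h := hσ.mul_p hp (α k H) z
  rcases hp with rfl | rfl
  · have := hσ.opL (qL k H) z
    rw [opL_qL, epsR_qL, lAct₂_one] at this
    exact this.symm
  · have := hσ.opR (qR k H) z
    rw [opR_qR, epsL_qR, lAct₂_one, LinearEquiv.apply_symm_apply] at this
    rw [h, this]

/-- Under a biinvariant form, `(S(b) ⊗ 1) q` and `(1 ⊗ b) q` agree for both choices of `q`; this is
why `f_σ` is a map of right modules. -/
theorem IsBiinvariant.q_mul (hσ : IsBiinvariant H σ) {q : H ⊗[k] H}
    (hq : q ∈ ({qL k H, qR k H} : Set (H ⊗[k] H))) (b : H) (z : K ⊗[k] M) :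
    σ (rAct₂ k H K M ((S k H b ⊗ₜ 1) * q) z) = σ (rAct₂ k H K M ((1 ⊗ₜ b) * q) z) := by
  rcases hq with rfl | rfl
  · have := hσ.oqL (Δ k H b) z
    rw [oqL_comul, epsR_comul] at this
    exact this.symm
  · have := hσ.oqR (Δ k H (S k H b)) z
    rwa [oqR_comul, epsL_comul, LinearEquiv.symm_apply_apply] at this

/-- Under a biinvariant form, `(β ⊗ 1) q` acts as `1`. -/
theorem IsBiinvariant.beta_mul_q (hσ : IsBiinvariant H σ) {q : H ⊗[k] H}
    (hq : q ∈ ({qL k H, qR k H} : Set (H ⊗[k] H))) (z : K ⊗[k] M) :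
    σ (rAct₂ k H K M ((β k H ⊗ₜ 1) * q) z) = σ z := by
  have h := hσ.q_mul hq ((S k H).symm (β k H)) z
  rw [LinearEquiv.apply_symm_apply] at h
  rcases hq with rfl | rfl
  · have := hσ.oqL (pL k H) z
    rw [oqL_pL, epsR_pL, rAct₂_one, LinearEquiv.apply_symm_apply] at this
    exact this.symm
  · have := hσ.oqR (pR k H) z
    rw [oqR_pR, epsL_pR, rAct₂_one] at this
    rw [h, this]

theorem formOfMap_tmul (f : M →ₗ[k] BimodDual k H K) (x : K) (m : M) :
    formOfMap f (x ⊗ₜ m) = BimodDual.equiv k H K (f m)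
      ((S k H).symm (α k H) • MulOpposite.op (β k H) • x) := rfl

theorem mapOfForm_apply (p q : H ⊗[k] H) (σ : K ⊗[k] M →ₗ[k] k) (m : M) (x : K) :
    BimodDual.equiv k H K (mapOfForm p q σ m) x =
      σ (lAct₂ k H K M p (rAct₂ k H K M q (x ⊗ₜ m))) := rfl

/-- For a bimodule map `f`, the form `Σ_f` sees `p · (x ⊗ m) · q` only through `S(p₁) α p₂` and
`q₁ β S(q₂)`. -/
theorem formOfMap_act {f : M →ₗ[k] BimodDual k H K} (hf : IsBimoduleMap H f)
    (p q : H ⊗[k] H) (x : K) (m : M) :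
    formOfMap f (lAct₂ k H K M p (rAct₂ k H K M q (x ⊗ₜ m))) =
      BimodDual.equiv k H K (f m)
        ((S k H).symm (alphaMul p) • MulOpposite.op (betaMul q) • x) := by
  induction p using tensor_induction₂ with
  | add s t hs ht => simp only [map_add, LinearMap.add_apply, add_smul, hs, ht]
  | pure a b =>
    induction q using tensor_induction₂ with
    | add s t hs ht =>
      simp only [map_add, LinearMap.add_apply, MulOpposite.op_add, add_smul, smul_add, hs, ht]
    | pure c d =>
      simp only [tensorAct_tmul, lAct_apply, rAct_apply, formOfMap_tmul, hf.1, hf.2,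
        BimodDual.smul_apply, BimodDual.op_smul_apply, alphaMul_tmul, betaMul_tmul,
        BimodDual.S_symm_mul, LinearEquiv.symm_apply_apply, MulOpposite.unop_op,
        MulOpposite.op_mul, mul_smul]
      simp only [smul_comm (_ : H) (_ : Hᵐᵒᵖ)]

theorem formOfMap_isBiinvariant {f : M →ₗ[k] BimodDual k H K} (hf : IsBimoduleMap H f) :
    IsBiinvariant H (formOfMap f) := by
  intro a x m
  have h1 := formOfMap_act hf 1 (Δ k H a) x m
  have h2 := formOfMap_act hf (Δ k H a) 1 x m
  rw [lAct₂_one, alphaMul_one, betaMul_comul, MulOpposite.op_smul, smul_assoc,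
    smul_comm _ (ε k H a), LinearMap.map_smul] at h1
  rw [rAct₂_one, alphaMul_comul, betaMul_one, LinearEquiv.map_smul, smul_assoc,
    LinearMap.map_smul] at h2
  exact ⟨h1, h2.symm⟩

theorem mapOfForm_formOfMap {f : M →ₗ[k] BimodDual k H K} (hf : IsBimoduleMap H f)
    {p q : H ⊗[k] H} (hp : p ∈ ({pL k H, pR k H} : Set (H ⊗[k] H)))
    (hq : q ∈ ({qL k H, qR k H} : Set (H ⊗[k] H))) : mapOfForm p q (formOfMap f) = f := by
  ext m
  refine BimodDual.ext_equiv fun x => ?_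
  have h1 : alphaMul p = 1 := by
    rcases hp with rfl | rfl
    exacts [alphaMul_pL, alphaMul_pR]
  have h2 : betaMul q = 1 := by
    rcases hq with rfl | rfl
    exacts [betaMul_qL, betaMul_qR]
  rw [mapOfForm_apply, formOfMap_act hf, h1, h2, BimodDual.S_symm_one, MulOpposite.op_one,
    one_smul, one_smul]

theorem formOfMap_mapOfForm (hσ : IsBiinvariant H σ)
    {p q : H ⊗[k] H} (hp : p ∈ ({pL k H, pR k H} : Set (H ⊗[k] H)))
    (hq : q ∈ ({qL k H, qR k H} : Set (H ⊗[k] H))) : formOfMap (mapOfForm p q σ) = σ := by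
  refine TensorProduct.ext' fun x m => ?_
  have h : ((S k H).symm (α k H) • MulOpposite.op (β k H) • x) ⊗ₜ[k] m =
      lAct₂ k H K M ((S k H).symm (α k H) ⊗ₜ 1) (rAct₂ k H K M (β k H ⊗ₜ 1) (x ⊗ₜ m)) := by simp
  rw [formOfMap_tmul, mapOfForm_apply, h, ← lAct₂_rAct₂, ← rAct₂_mul, ← lAct₂_mul,
    hσ.mul_p_alpha hp, hσ.beta_mul_q hq]

theorem mapOfForm_isBimoduleMap (hσ : IsBiinvariant H σ)
    {p q : H ⊗[k] H} (hp : p ∈ ({pL k H, pR k H} : Set (H ⊗[k] H)))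
    (hq : q ∈ ({qL k H, qR k H} : Set (H ⊗[k] H))) : IsBimoduleMap H (mapOfForm p q σ) := by
  refine ⟨fun a m => BimodDual.ext_equiv fun x => ?_, fun b m => BimodDual.ext_equiv fun x => ?_⟩
  · rw [BimodDual.smul_apply, mapOfForm_apply, mapOfForm_apply]
    have h1 : x ⊗ₜ[k] (a • m) = lAct₂ k H K M (1 ⊗ₜ a) (x ⊗ₜ m) := by simp
    have h2 : ((S k H).symm a • x) ⊗ₜ[k] m =
      lAct₂ k H K M ((S k H).symm a ⊗ₜ 1) (x ⊗ₜ m) := by simp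
    rw [h1, h2, ← lAct₂_rAct₂, ← lAct₂_rAct₂, ← lAct₂_mul, ← lAct₂_mul, hσ.mul_p hp]
  · rw [BimodDual.op_smul_apply, mapOfForm_apply, mapOfForm_apply, MulOpposite.unop_op]
    have h1 : x ⊗ₜ[k] (MulOpposite.op b • m) = rAct₂ k H K M (1 ⊗ₜ b) (x ⊗ₜ m) := by simp
    have h2 : (MulOpposite.op (S k H b) • x) ⊗ₜ[k] m =
      rAct₂ k H K M (S k H b ⊗ₜ 1) (x ⊗ₜ m) := by simp
    rw [h1, h2, ← rAct₂_mul, ← rAct₂_mul, lAct₂_rAct₂, lAct₂_rAct₂, hσ.q_mul hq]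

end Forms
/-! ### The Drinfeld twist -/

section Twist

variable {k H : Type*} [Field k] [Ring H] [Algebra k H] [QuasiHopfAlgebra k H]

variable (k H) in
/-- The antiautomorphism `τ(x ⊗ y) = S(y) ⊗ S(x)` of the algebra `H ⊗ H`. -/
noncomputable def tau : H ⊗[k] H →ₗ[k] H ⊗[k] H := SS k H ∘ₗ swap k H

@[simp] theorem tau_tmul (x y : H) : tau k H (x ⊗ₜ y) = S k H y ⊗ₜ S k H x := rfl

theorem tau_mul (u v : H ⊗[k] H) : tau k H (u * v) = tau k H v * tau k H u := by
  induction u using tensor_induction₂ with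
  | add s t hs ht => simp only [add_mul, mul_add, map_add, hs, ht]
  | pure a b =>
    induction v using tensor_induction₂ with
    | add s t hs ht => simp only [add_mul, mul_add, map_add, hs, ht]
    | pure c d => simp [BimodDual.S_mul]

theorem tau_one : tau k H 1 = 1 := by
  simp [Algebra.TensorProduct.one_def, BimodDual.S_one]

/-- `a ⊗ b ⊗ c ⊗ d ↦ S(b) α c ⊗ S(a) α d` -/
noncomputable def evGamma : H ⊗[k] (H ⊗[k] (H ⊗[k] H)) →ₗ[k] H ⊗[k] H :=
  LinearMap.mul' k (H ⊗[k] H) ∘ₗ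
    TensorProduct.map (SS k H ∘ₗ swap k H) (LinearMap.mulLeft k (α k H ⊗ₜ[k] α k H)) ∘ₗ
      (TensorProduct.assoc k H H (H ⊗[k] H)).symm.toLinearMap

@[simp] theorem evGamma_tmul (a b c d : H) : evGamma (k := k) (a ⊗ₜ (b ⊗ₜ (c ⊗ₜ d))) =
    (S k H b * (α k H * c)) ⊗ₜ (S k H a * (α k H * d)) := by
  simp [evGamma, SS, swap]

theorem tri_conv_leg₄ (t : H ⊗[k] (H ⊗[k] H)) :
    tri (leg₄₁ k H) (leg₄₂ k H) (conv (leg₄₃ k H) (leg₄₄ k H) (comm₄₃₄ k H)) t =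
      Algebra.TensorProduct.map (AlgHom.id k H)
        (Algebra.TensorProduct.map (AlgHom.id k H) (Δ k H)) t := by
  induction t using tensor_induction₃ with
  | add s t hs ht => simp only [map_add, hs, ht]
  | pure a b c =>
    simp only [tri_tmul, conv_apply, Algebra.TensorProduct.map_tmul, AlgHom.id_apply]
    induction Δ k H c using tensor_induction₂ with
    | add s t hs ht => simp only [map_add, mul_add, TensorProduct.tmul_add, hs, ht]
    | pure x y => simp

variable (k H) in
/-- The element `(1 ⊗ φ⁻¹) (id ⊗ id ⊗ Δ)(φ)`, which defines `γ`. -/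
noncomputable def omega : H ⊗[k] (H ⊗[k] (H ⊗[k] H)) :=
  Φi (leg₄₂ k H) (leg₄₃ k H) (leg₄₄ k H) *
    Φ (leg₄₁ k H) (leg₄₂ k H) (conv (leg₄₃ k H) (leg₄₄ k H) (comm₄₃₄ k H))

theorem evGamma_omega : evGamma (omega k H) = γ k H := by
  rw [omega, Φi, Φ, tri_leg₄_last, tri_conv_leg₄]; rfl

theorem evGamma_leftCollapse_inner : LeftCollapse (evGamma (k := k) (H := H))
    (conv (leg₄₂ k H) (leg₄₃ k H) (comm₄₂₃ k H)) := by
  refine leftCollapse_of (span_pure₄ k H) ?_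
  rintro _ ⟨x, _, ⟨y, z, w, rfl⟩, rfl⟩
  refine ⟨(TensorProduct.mk k H H).flip (S k H x * (α k H * w)) ∘ₗ
    LinearMap.mulLeft k (S k H y) ∘ₗ LinearMap.mulRight k z, ?_⟩
  intro a b
  simp [BimodDual.S_mul, mul_assoc]

theorem evGamma_leftCollapse_outer : LeftCollapse (evGamma (k := k) (H := H))
    (conv (leg₄₁ k H) (leg₄₄ k H) (comm₄₁₄ k H)) := by
  refine leftCollapse_of (span_pure₄ k H) ?_
  rintro _ ⟨x, _, ⟨y, z, w, rfl⟩, rfl⟩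
  refine ⟨TensorProduct.mk k H H (S k H y * (α k H * z)) ∘ₗ
    LinearMap.mulLeft k (S k H x) ∘ₗ LinearMap.mulRight k w, ?_⟩
  intro a b
  simp [BimodDual.S_mul, mul_assoc]

/-- `x ⊗ y ↦ τ(Δ(x)) γ Δ(y)` -/
noncomputable def gammaMul : H ⊗[k] H →ₗ[k] H ⊗[k] H :=
  LinearMap.mul' k (H ⊗[k] H) ∘ₗ TensorProduct.map (tau k H ∘ₗ (Δ k H).toLinearMap)
    (LinearMap.mulLeft k (γ k H) ∘ₗ (Δ k H).toLinearMap)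

theorem gammaMul_tmul (x y : H) :
    gammaMul (k := k) (x ⊗ₜ y) = tau k H (Δ k H x) * (γ k H * Δ k H y) := rfl

theorem gammaMul_one : gammaMul (1 : H ⊗[k] H) = γ k H := by
  rw [Algebra.TensorProduct.one_def, gammaMul_tmul, map_one, tau_one, one_mul, mul_one]

theorem evGamma_mul_pair (r : H ⊗[k] (H ⊗[k] (H ⊗[k] H))) (v w : H ⊗[k] H) :
    evGamma (r * (pair (leg₄₁ k H) (leg₄₂ k H) (comm₄₁₂ k H) v *
      pair (leg₄₃ k H) (leg₄₄ k H) (comm₄₃₄ k H) w)) = tau k H v * (evGamma r * w) := by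
  induction v using tensor_induction₂ with
  | add s t hs ht => simp only [add_mul, mul_add, map_add, hs, ht]
  | pure a b =>
    induction w using tensor_induction₂ with
    | add s t hs ht => simp only [mul_add, map_add, hs, ht]
    | pure c d =>
      have hr : r ∈ Submodule.span k (pure₄ k H) := span_pure₄ k H ▸ Submodule.mem_top
      induction hr using Submodule.span_induction with
      | zero => simp
      | add s t _ _ hs ht => simp only [add_mul, mul_add, map_add, hs, ht]
      | smul c t _ ht => simp only [smul_mul_assoc, mul_smul_comm, map_smul, ht]
      | mem t ht =>
        obtain ⟨x, _, ⟨y, z, w, rfl⟩, rfl⟩ := ht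
        simp [BimodDual.S_mul, mul_assoc]

/-- `τ(Δ(a₁)) γ Δ(a₂) = ε(a) γ` -/
theorem gammaMul_comul (a : H) : gammaMul (Δ k H a) = ε k H a • γ k H := by
  have c1_34 := (comm₄₁₃ k H).conv_right (comm₄₁₄ k H) (c := comm₄₃₄ k H)
  have c2_34 := (comm₄₂₃ k H).conv_right (comm₄₂₄ k H) (c := comm₄₃₄ k H)
  have c23_4 := (comm₄₂₄ k H).conv_left (comm₄₃₄ k H) (c := comm₄₂₃ k H)
  have c1_23 := (comm₄₁₂ k H).conv_right (comm₄₁₃ k H) (c := comm₄₂₃ k H)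
  have e1 : ∀ v, gammaMul v = evGamma (omega k H * pair (conv _ _ (comm₄₁₂ k H))
      (conv _ _ (comm₄₃₄ k H)) (c1_34.conv_left c2_34) v) := by
    intro v
    induction v using tensor_induction₂ with
    | add s t hs ht => simp only [mul_add, map_add, hs, ht]
    | pure x y =>
      rw [pair_tmul, conv_apply, conv_apply, evGamma_mul_pair, evGamma_omega, gammaMul_tmul]
  have i1 := conv_assoc_mul_Φ (comm₄₁₂ k H) c1_34 c2_34 a
  have i2 : Φi (leg₄₂ k H) (leg₄₃ k H) (leg₄₄ k H) * conv (leg₄₁ k H) (conv _ _ c2_34)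
      ((comm₄₁₂ k H).conv_right c1_34) a = conv (leg₄₁ k H) (conv _ _ c23_4)
      (c1_23.conv_right (comm₄₁₄ k H)) a * Φi (leg₄₂ k H) (leg₄₃ k H) (leg₄₄ k H) :=
    conv_intertwine (fun b => (tri_commute (fun b' => comm₄₁₂ k H b b') (fun b' => comm₄₁₃ k H b b')
        (fun b' => comm₄₁₄ k H b b') _).symm)
      (fun b => (conv_assoc_mul_Φi (comm₄₂₃ k H) (comm₄₂₄ k H) (comm₄₃₄ k H) b).symm) _ _ a
  have e2 := EqUnder.conv₂ (EqUnder.conv_left evGamma_leftCollapse_inner.eqUnder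
    (fun _ => Submonoid.mem_top _) c23_4) c1_23.mem_cent (c1_23.conv_right (comm₄₁₄ k H))
      (comm₄₁₄ k H) a
  rw [e1, ← conv_apply, omega, mul_assoc, ← i1, ← mul_assoc, i2, mul_assoc, e2.apply_left,
    evGamma_leftCollapse_outer, ← evGamma_omega, omega]

theorem twist_eq : twist k H = gammaMul (pR k H) := rfl

/-- `a ⊗ b ⊗ c ↦ τ(Δ(a)) γ Δ(b β S(c))`, which maps `φ⁻¹` to the twist -/
noncomputable def evTwist : H ⊗[k] (H ⊗[k] H) →ₗ[k] H ⊗[k] H := gammaMul ∘ₗ evPR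

theorem evTwist_tmul (a b c : H) : evTwist (k := k) (a ⊗ₜ (b ⊗ₜ c)) =
    tau k H (Δ k H a) * (γ k H * Δ k H (b * (β k H * S k H c))) := rfl

theorem evTwist_Φi : evTwist (Φi (leg₃₁ k H) (leg₃₂ k H) (leg₃₃ k H)) = twist k H := by
  rw [evTwist, LinearMap.comp_apply, evPR_Φi, twist_eq]

/-- `f Δ(S(a)) = τ(Δ(a)) f` for the Drinfeld twist `f` -/
theorem twist_mul_comul (a : H) :
    twist k H * Δ k H (S k H a) = tau k H (Δ k H a) * twist k H := by
  have hL : LeftCollapse (evTwist (k := k) (H := H))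
      (conv (leg₃₁ k H) (leg₃₂ k H) (comm₃₁₂ k H)) := by
    refine leftCollapse_of_factor (m := gammaMul)
      (fun a => by rw [gammaMul_comul, gammaMul_one]) (span_pure₃ k H) ?_
    rintro _ ⟨x, y, z, rfl⟩
    refine ⟨LinearMap.mulLeft k (tau k H (Δ k H x)) ∘ₗ
      LinearMap.mulRight k (Δ k H (y * (β k H * S k H z))), ?_⟩
    intro a b
    simp [evTwist_tmul, gammaMul_tmul, tau_mul, mul_assoc]
  have hR : RightCollapse (evTwist (k := k) (H := H))
      (conv (leg₃₂ k H) (leg₃₃ k H) (comm₃₂₃ k H)) := by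
    refine rightCollapse_of (span_pure₃ k H) ?_
    rintro _ ⟨x, y, z, rfl⟩
    refine ⟨LinearMap.mulLeft k (tau k H (Δ k H x) * γ k H) ∘ₗ (Δ k H).toLinearMap ∘ₗ
      LinearMap.mulLeft k y ∘ₗ LinearMap.mulRight k (S k H z), ?_⟩
    intro a b
    simp [evTwist_tmul, BimodDual.S_mul, mul_assoc]
  have h := hR.apply_conv_mul_Φi (comm₃₁₂ k H) (comm₃₁₃ k H) (comm₃₂₃ k H) a
  rw [(EqUnder.conv_left hL.eqUnder (fun _ => Submonoid.mem_top _)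
    ((comm₃₁₃ k H).conv_left (comm₃₂₃ k H)) a).apply_left] at h
  have e1 : ∀ s, evTwist (leg₃₃ k H a * s) = evTwist s * Δ k H (S k H a) := by
    intro s
    induction s using tensor_induction₃ with
    | add s t hs ht => simp only [add_mul, mul_add, map_add, hs, ht]
    | pure x y z => simp [evTwist_tmul, BimodDual.S_mul, mul_assoc]
  have e2 : ∀ s, evTwist (s * leg₃₁ k H a) = tau k H (Δ k H a) * evTwist s := by
    intro s
    induction s using tensor_induction₃ with
    | add s t hs ht => simp only [add_mul, mul_add, map_add, hs, ht]
    | pure x y z => simp [evTwist_tmul, tau_mul, mul_assoc]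
  rwa [e1, e2, evTwist_Φi] at h

/-- `f Δ(α) = γ` -/
theorem twist_mul_comul_alpha : twist k H * Δ k H (α k H) = γ k H := by
  let E : H ⊗[k] (H ⊗[k] (H ⊗[k] H)) →ₗ[k] H ⊗[k] H :=
    gammaMul ∘ₗ TensorProduct.map LinearMap.id betaAlpha
  have hE : ∀ a b c d : H, E (a ⊗ₜ (b ⊗ₜ (c ⊗ₜ d))) =
    tau k H (Δ k H a) * (γ k H * Δ k H (b * (β k H * S k H c * (α k H * d)))) :=
      fun _ _ _ _ => rfl
  have hR : RightCollapse E (conv (leg₄₂ k H) (leg₄₃ k H) (comm₄₂₃ k H)) := by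
    refine rightCollapse_of (span_pure₄ k H) ?_
    rintro _ ⟨x, _, ⟨y, z, w, rfl⟩, rfl⟩
    refine ⟨LinearMap.mulLeft k (tau k H (Δ k H x) * γ k H) ∘ₗ (Δ k H).toLinearMap ∘ₗ
      LinearMap.mulLeft k y ∘ₗ LinearMap.mulRight k (S k H z * α k H * w), ?_⟩
    intro a b
    simp [hE, BimodDual.S_mul, mul_assoc]
  have hL : LeftCollapse E (conv (leg₄₃ k H) (leg₄₄ k H) (comm₄₃₄ k H)) := by
    refine leftCollapse_of (span_pure₄ k H) ?_
    rintro _ ⟨x, _, ⟨y, z, w, rfl⟩, rfl⟩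
    refine ⟨LinearMap.mulLeft k (tau k H (Δ k H x) * γ k H) ∘ₗ (Δ k H).toLinearMap ∘ₗ
      LinearMap.mulLeft k (y * β k H * S k H z) ∘ₗ LinearMap.mulRight k w, ?_⟩
    intro a b
    simp [hE, BimodDual.S_mul, mul_assoc]
  have hL' : LeftCollapse E (conv (leg₄₁ k H) (leg₄₂ k H) (comm₄₁₂ k H)) := by
    refine leftCollapse_of_factor (m := gammaMul)
      (fun a => by rw [gammaMul_comul, gammaMul_one]) (span_pure₄ k H) ?_
    rintro _ ⟨x, _, ⟨y, z, w, rfl⟩, rfl⟩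
    refine ⟨LinearMap.mulLeft k (tau k H (Δ k H x)) ∘ₗ
      LinearMap.mulRight k (Δ k H (y * (β k H * S k H z * (α k H * w)))), ?_⟩
    intro a b
    simp [hE, gammaMul_tmul, tau_mul, mul_assoc]
  have p := apply_pentagon_left (comm₄₁₂ k H) (comm₄₁₃ k H) (comm₄₁₄ k H) (comm₄₂₃ k H)
    (comm₄₂₄ k H) (comm₄₃₄ k H) hR hL
  rw [(EqUnder.Φ₁ hL'.eqUnder (fun _ => Submonoid.mem_top _) (fun _ => Submonoid.mem_top _)
    (comm₄₃₄ k H)).apply_left, one_mul] at p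
  have e1 : ∀ s, E (tri (leg₄₁ k H) (leg₄₂ k H) (leg₄₃ k H) s) = evTwist s * Δ k H (α k H) := by
    intro s
    induction s using tensor_induction₃ with
    | add s t hs ht => simp only [add_mul, map_add, hs, ht]
    | pure x y z =>
      simp [hE, evTwist_tmul, mul_assoc, Algebra.TensorProduct.one_def]
  rw [Φi, e1, ← tri_legs (φInv k H), ← Φi, evTwist_Φi, Φ, tri_leg₄_last] at p
  refine p.trans ((congrArg (fun x => gammaMul ((1 : H) ⊗ₜ[k] x)) betaAlpha_φ).trans ?_)
  exact gammaMul_one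

end Twist
/-! ### The twist and the elements `p` and `q` -/

section TwistInverse

variable {k H : Type*} [Field k] [Ring H] [Algebra k H] [QuasiHopfAlgebra k H]

/-- This lemma and the next three record how `opR` and `oqR` respond to multiplication of their
arguments. -/
theorem opR_mul_comul (u : H ⊗[k] H) (a : H) :
    opR k H (u * Δ k H a) = opR k H u * (a ⊗ₜ 1) := by
  induction u using tensor_induction₂ with
  | add s t hs ht => simp only [add_mul, map_add, hs, ht]
  | pure x y =>
    have e : ∀ v : H ⊗[k] H, opR k H ((x ⊗ₜ y) * v) = Δ k H x * opR k H v * (1 ⊗ₜ S k H y) := by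
      intro v
      induction v using tensor_induction₂ with
      | add s t hs ht => simp only [add_mul, mul_add, map_add, hs, ht]
      | pure z w => simp [BimodDual.S_mul, mul_assoc]
    rw [e, opR_comul]
    simp [mul_assoc]

theorem opR_tmul_one_mul (u : H ⊗[k] H) (b : H) :
    opR k H ((b ⊗ₜ 1) * u) = Δ k H b * opR k H u := by
  induction u using tensor_induction₂ with
  | add s t hs ht => simp only [mul_add, map_add, hs, ht]
  | pure x y => simp [mul_assoc]

theorem oqR_comul_mul (u : H ⊗[k] H) (a : H) :
    oqR k H (Δ k H a * u) = (a ⊗ₜ 1) * oqR k H u := by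
  induction u using tensor_induction₂ with
  | add s t hs ht => simp only [mul_add, map_add, hs, ht]
  | pure x y =>
    have e : ∀ v : H ⊗[k] H, oqR k H (v * (x ⊗ₜ y)) =
        (1 ⊗ₜ (S k H).symm y) * oqR k H v * Δ k H x := by
      intro v
      induction v using tensor_induction₂ with
      | add s t hs ht => simp only [add_mul, mul_add, map_add, hs, ht]
      | pure z w => simp [BimodDual.S_symm_mul, ← mul_assoc]
    rw [e, oqR_comul, oqR_tmul]
    simp only [← mul_assoc, Algebra.TensorProduct.tmul_mul_tmul, one_mul, mul_one]

theorem oqR_mul_tmul_one (u : H ⊗[k] H) (b : H) :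
    oqR k H (u * (b ⊗ₜ 1)) = oqR k H u * Δ k H b := by
  induction u using tensor_induction₂ with
  | add s t hs ht => simp only [add_mul, map_add, hs, ht]
  | pure x y => simp [mul_assoc]

/-- `a ⊗ b ⊗ c ⊗ d ⊗ e ↦ S(b) α c ⊗ S(a) α d β S(e)` -/
noncomputable def evGammaBeta : H ⊗[k] (H ⊗[k] (H ⊗[k] (H ⊗[k] H))) →ₗ[k] H ⊗[k] H :=
  evGamma ∘ₗ TensorProduct.map LinearMap.id (TensorProduct.map LinearMap.id
    (TensorProduct.map LinearMap.id betaMul))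

theorem evGammaBeta_tmul (a b c d e : H) :
    evGammaBeta (k := k) (a ⊗ₜ (b ⊗ₜ (c ⊗ₜ (d ⊗ₜ e)))) =
      (S k H b * (α k H * c)) ⊗ₜ (S k H a * (α k H * (d * (β k H * S k H e)))) := by
  simp [evGammaBeta, betaMul_tmul, mul_assoc]

theorem evGammaBeta_quad_mul (r : H ⊗[k] (H ⊗[k] (H ⊗[k] H))) (v w : H ⊗[k] H) (z : H)
    (s : H ⊗[k] (H ⊗[k] H)) :
    evGammaBeta (quad (comm₅₁₂ k H) (comm₅₁₃ k H) (comm₅₁₄ k H) (comm₅₂₃ k H) (comm₅₂₄ k H)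
      (comm₅₃₄ k H) r * (pair (leg₅₁ k H) (leg₅₂ k H) (comm₅₁₂ k H) v *
        (pair (leg₅₃ k H) (leg₅₄ k H) (comm₅₃₄ k H) w * leg₅₅ k H z)) *
        tri (leg₅₃ k H) (leg₅₄ k H) (leg₅₅ k H) s) =
      tau k H v * (evGamma r * (w * (evPR s * (1 ⊗ₜ S k H z)))) := by
  induction v using tensor_induction₂ with
  | add s t hs ht => simp only [add_mul, mul_add, map_add, hs, ht]
  | pure a b =>
    induction w using tensor_induction₂ with
    | add s t hs ht => simp only [mul_add, add_mul, map_add, hs, ht]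
    | pure c d =>
      induction s using tensor_induction₃ with
      | add s t hs ht => simp only [mul_add, add_mul, map_add, hs, ht]
      | pure e f g =>
        have hr : r ∈ Submodule.span k (pure₄ k H) := span_pure₄ k H ▸ Submodule.mem_top
        induction hr using Submodule.span_induction with
        | zero => simp
        | add s t _ _ hs ht => simp only [add_mul, mul_add, map_add, hs, ht]
        | smul c t _ ht => simp only [smul_mul_assoc, mul_smul_comm, map_smul, ht]
        | mem t ht =>
          obtain ⟨x, _, ⟨y, z, w, rfl⟩, rfl⟩ := ht
          simp [evGammaBeta_tmul, evPR_tmul, BimodDual.S_mul, mul_assoc]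

theorem quad_leg₅_omega : quad (comm₅₁₂ k H) (comm₅₁₃ k H) (comm₅₁₄ k H) (comm₅₂₃ k H)
    (comm₅₂₄ k H) (comm₅₃₄ k H) (omega k H) = Φi (leg₅₂ k H) (leg₅₃ k H) (leg₅₄ k H) *
      Φ (leg₅₁ k H) (leg₅₂ k H) (conv (leg₅₃ k H) (leg₅₄ k H) (comm₅₃₄ k H)) := by
  set G := quad (comm₅₁₂ k H) (comm₅₁₃ k H) (comm₅₁₄ k H) (comm₅₂₃ k H)
    (comm₅₂₄ k H) (comm₅₃₄ k H)
  have e1 : G.comp (leg₄₁ k H) = leg₅₁ k H := by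
    ext a; simp [G, Algebra.TensorProduct.one_def]
  have e2 : G.comp (leg₄₂ k H) = leg₅₂ k H := by
    ext a; simp [G, Algebra.TensorProduct.one_def]
  have e3 : G.comp (leg₄₃ k H) = leg₅₃ k H := by
    ext a; simp [G, Algebra.TensorProduct.one_def]
  have e4 : G.comp (leg₄₄ k H) = leg₅₄ k H := by
    ext a; simp [G, Algebra.TensorProduct.one_def]
  rw [omega, map_mul]
  exact congrArg₂ (· * ·) (map_tri G e2 e3 e4 _)
    (map_tri G e1 e2 (comp_conv G e3 e4 (comm₄₃₄ k H) (comm₅₃₄ k H)) _)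

/-- `f Δ(q_L¹) p_R (1 ⊗ S(q_L²)) = τ(q_R)` -/
theorem twist_mul_opR_qL : twist k H * opR k H (qL k H) = tau k H (qR k H) := by
  have hL : LeftCollapse (evGammaBeta (k := k) (H := H))
      (conv (leg₅₂ k H) (leg₅₃ k H) (comm₅₂₃ k H)) := by
    refine leftCollapse_of (span_pure₅ k H) ?_
    rintro _ ⟨x, _, ⟨y, _, ⟨z, w, v, rfl⟩, rfl⟩, rfl⟩
    refine ⟨(TensorProduct.mk k H H).flip (S k H x * (α k H * (w * (β k H * S k H v)))) ∘ₗ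
      LinearMap.mulLeft k (S k H y) ∘ₗ LinearMap.mulRight k z, ?_⟩
    intro a b
    simp [evGammaBeta_tmul, BimodDual.S_mul, mul_assoc]
  have hR : RightCollapse (evGammaBeta (k := k) (H := H))
      (conv (leg₅₄ k H) (leg₅₅ k H) (comm₅₄₅ k H)) := by
    refine rightCollapse_of (span_pure₅ k H) ?_
    rintro _ ⟨x, _, ⟨y, _, ⟨z, w, v, rfl⟩, rfl⟩, rfl⟩
    refine ⟨TensorProduct.mk k H H (S k H y * (α k H * z)) ∘ₗ
      LinearMap.mulLeft k (S k H x * (α k H * w)) ∘ₗ LinearMap.mulRight k (S k H v), ?_⟩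
    intro a b
    simp [evGammaBeta_tmul, BimodDual.S_mul, mul_assoc]
  have p := apply_five (comm₅₁₂ k H) (comm₅₁₃ k H) (comm₅₁₄ k H) (comm₅₁₅ k H) (comm₅₂₃ k H)
    (comm₅₂₄ k H) (comm₅₂₅ k H) (comm₅₃₄ k H) (comm₅₃₅ k H) (comm₅₄₅ k H) hL hR
  have e1 : ∀ t : H ⊗[k] (H ⊗[k] H), evGammaBeta (Φi (leg₅₂ k H) (leg₅₃ k H) (leg₅₄ k H) *
      Φ (leg₅₁ k H) (leg₅₂ k H) (conv (leg₅₃ k H) (leg₅₄ k H) (comm₅₃₄ k H)) *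
        tri (conv (leg₅₁ k H) (leg₅₂ k H) (comm₅₁₂ k H))
          (conv (leg₅₃ k H) (leg₅₄ k H) (comm₅₃₄ k H)) (leg₅₅ k H) t *
            Φi (leg₅₃ k H) (leg₅₄ k H) (leg₅₅ k H)) = twist k H * opR k H (evQL t) := by
    intro t
    induction t using tensor_induction₃ with
    | add s t hs ht => simp only [mul_add, add_mul, map_add, hs, ht]
    | pure x y z =>
      rw [← quad_leg₅_omega, tri_tmul, conv_apply, conv_apply, Φi, evGammaBeta_quad_mul,
        evGamma_omega, evQL_tmul, opR_tmul, map_mul, map_mul, ← tri_legs (φInv k H), ← Φi, evPR_Φi,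
        ← twist_mul_comul_alpha]
      simp only [← mul_assoc, twist_mul_comul]
  have e2 : ∀ s t : H ⊗[k] (H ⊗[k] H), evGammaBeta (tri (leg₅₁ k H) (leg₅₄ k H) (leg₅₅ k H) s *
      tri (leg₅₁ k H) (leg₅₂ k H) (leg₅₃ k H) t) =
        tau k H (evQR t) * (1 ⊗ₜ alphaBeta s) := by
    intro s t
    induction s using tensor_induction₃ with
    | add s t hs ht => simp only [mul_add, add_mul, map_add, hs, ht, TensorProduct.tmul_add]
    | pure x y z =>
      induction t using tensor_induction₃ with
      | add s t hs ht => simp only [mul_add, add_mul, map_add, hs, ht]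
      | pure a b c =>
        simp [evGammaBeta_tmul, evQR_tmul, alphaBeta_tmul, BimodDual.S_mul, mul_assoc]
  have p' := (e1 (φInv k H)).symm.trans (p.trans (e2 _ _))
  rw [alphaBeta_φInv, ← Algebra.TensorProduct.one_def, mul_one] at p'
  rw [← evQL_Φi, ← evQR_Φ, Φi, Φ, tri_legs, tri_legs]
  exact p'

/-- `τ((1 ⊗ S⁻¹(u²)) q_R Δ(u¹)) = f Δ(S(u¹)) W (u² ⊗ 1)`, where `W = Δ(q_L¹) p_R (1 ⊗ S(q_L²))` -/
theorem tau_oqR (u : H ⊗[k] H) :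
    tau k H (oqR k H u) = twist k H * opR k H (oqL k H u) := by
  induction u using tensor_induction₂ with
  | add s t hs ht => simp only [mul_add, map_add, hs, ht]
  | pure x y =>
    rw [oqR_tmul, oqL_tmul, opR_mul_comul, opR_tmul_one_mul, tau_mul, tau_mul,
      ← twist_mul_opR_qL, ← mul_assoc, ← mul_assoc, ← twist_mul_comul]
    simp [mul_assoc, BimodDual.S_one]

/-- `tau_oqR` at `u = p_R` gives a right inverse of the Drinfeld twist. -/
theorem twist_mul_opR_oqL_pR : twist k H * opR k H (oqL k H (pR k H)) = 1 := by
  rw [← tau_oqR, oqR_pR, tau_one]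

end TwistInverse
/-! ### Invertibility of the twist and the elements `U` and `V` -/

section TwistUnit

variable {k H : Type*} [Field k] [Ring H] [Algebra k H] [QuasiHopfAlgebra k H]

/-- `a ⊗ b ⊗ c ⊗ d ↦ a β S(d) ⊗ b β S(c)` -/
noncomputable def evDelta : H ⊗[k] (H ⊗[k] (H ⊗[k] H)) →ₗ[k] H ⊗[k] H :=
  LinearMap.mul' k (H ⊗[k] H) ∘ₗ
    TensorProduct.map (LinearMap.mulRight k (β k H ⊗ₜ[k] β k H)) (tau k H) ∘ₗ
      (TensorProduct.assoc k H H (H ⊗[k] H)).symm.toLinearMap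

@[simp] theorem evDelta_tmul (a b c d : H) : evDelta (k := k) (a ⊗ₜ (b ⊗ₜ (c ⊗ₜ d))) =
    (a * (β k H * S k H d)) ⊗ₜ (b * (β k H * S k H c)) := by
  simp [evDelta, mul_assoc]

variable (k H) in
/-- The element `δ = A β S(D) ⊗ B β S(C)` of `H ⊗ H`, where
`A ⊗ B ⊗ C ⊗ D = (Δ ⊗ id ⊗ id)(φ) (φ⁻¹ ⊗ 1)`. -/
noncomputable def δ : H ⊗[k] H :=
  evDelta (Φ (conv (leg₄₁ k H) (leg₄₂ k H) (comm₄₁₂ k H)) (leg₄₃ k H) (leg₄₄ k H) *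
    Φi (leg₄₁ k H) (leg₄₂ k H) (leg₄₃ k H))

/-- `a₁ ⊗ ⋯ ⊗ a₆ ↦ a₁ β S(a₄) α a₅ ⊗ a₂ β S(a₃) α a₆` -/
noncomputable def evSix :
    H ⊗[k] (H ⊗[k] (H ⊗[k] (H ⊗[k] (H ⊗[k] H)))) →ₗ[k] H ⊗[k] H :=
  LinearMap.mul' k (H ⊗[k] H) ∘ₗ TensorProduct.map
    ((TensorProduct.mk k H H).flip 1 ∘ₗ LinearMap.mulRight k (β k H))
    (LinearMap.mul' k (H ⊗[k] H) ∘ₗ TensorProduct.map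
      (TensorProduct.mk k H H 1 ∘ₗ LinearMap.mulRight k (β k H))
      (LinearMap.mul' k (H ⊗[k] H) ∘ₗ TensorProduct.map
        (TensorProduct.mk k H H 1 ∘ₗ LinearMap.mulRight k (α k H) ∘ₗ (S k H).toLinearMap)
        (LinearMap.mul' k (H ⊗[k] H) ∘ₗ TensorProduct.map
          ((TensorProduct.mk k H H).flip 1 ∘ₗ LinearMap.mulRight k (α k H) ∘ₗ
            (S k H).toLinearMap)
          LinearMap.id)))

theorem evSix_tmul (a b c d e f : H) :
    evSix (k := k) (a ⊗ₜ (b ⊗ₜ (c ⊗ₜ (d ⊗ₜ (e ⊗ₜ f))))) =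
      (a * (β k H * (S k H d * (α k H * e)))) ⊗ₜ (b * (β k H * (S k H c * (α k H * f)))) := by
  simp [evSix, mul_assoc]

theorem evSix_quad_mul (a : H ⊗[k] (H ⊗[k] (H ⊗[k] H))) (u v w : H ⊗[k] H)
    (b : H ⊗[k] (H ⊗[k] (H ⊗[k] H))) :
    evSix (quad (comm₆₃₄ k H) (comm₆₃₅ k H) (comm₆₃₆ k H) (comm₆₄₅ k H) (comm₆₄₆ k H)
      (comm₆₅₆ k H) a * (pair (leg₆₁ k H) (leg₆₂ k H) (comm₆₁₂ k H) u *
        (pair (leg₆₃ k H) (leg₆₄ k H) (comm₆₃₄ k H) v *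
          pair (leg₆₅ k H) (leg₆₆ k H) (comm₆₅₆ k H) w)) *
        quad (comm₆₁₂ k H) (comm₆₁₃ k H) (comm₆₁₄ k H) (comm₆₂₃ k H) (comm₆₂₄ k H)
          (comm₆₃₄ k H) b) =
      u * (evDelta b * (tau k H v * (evGamma a * w))) := by
  induction u using tensor_induction₂ with
  | add s t hs ht => simp only [add_mul, mul_add, map_add, hs, ht]
  | pure u₁ u₂ =>
    induction v using tensor_induction₂ with
    | add s t hs ht => simp only [mul_add, add_mul, map_add, hs, ht]
    | pure v₁ v₂ =>
      induction w using tensor_induction₂ with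
      | add s t hs ht => simp only [mul_add, add_mul, map_add, hs, ht]
      | pure w₁ w₂ =>
        have ha : a ∈ Submodule.span k (pure₄ k H) := span_pure₄ k H ▸ Submodule.mem_top
        induction ha using Submodule.span_induction with
        | zero => simp
        | add s t _ _ hs ht => simp only [add_mul, mul_add, map_add, hs, ht]
        | smul c t _ ht => simp only [smul_mul_assoc, mul_smul_comm, map_smul, ht]
        | mem a ha =>
          obtain ⟨x, _, ⟨y, z, w, rfl⟩, rfl⟩ := ha
          have hb : b ∈ Submodule.span k (pure₄ k H) := span_pure₄ k H ▸ Submodule.mem_top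
          induction hb using Submodule.span_induction with
          | zero => simp
          | add s t _ _ hs ht => simp only [add_mul, mul_add, map_add, hs, ht]
          | smul c t _ ht => simp only [smul_mul_assoc, mul_smul_comm, map_smul, ht]
          | mem b hb =>
            obtain ⟨x', _, ⟨y', z', w', rfl⟩, rfl⟩ := hb
            simp [evSix_tmul, BimodDual.S_mul, mul_assoc]

theorem quad_leg₆_omega : quad (comm₆₃₄ k H) (comm₆₃₅ k H) (comm₆₃₆ k H) (comm₆₄₅ k H)
    (comm₆₄₆ k H) (comm₆₅₆ k H) (omega k H) = Φi (leg₆₄ k H) (leg₆₅ k H) (leg₆₆ k H) *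
      Φ (leg₆₃ k H) (leg₆₄ k H) (conv (leg₆₅ k H) (leg₆₆ k H) (comm₆₅₆ k H)) := by
  set G := quad (comm₆₃₄ k H) (comm₆₃₅ k H) (comm₆₃₆ k H) (comm₆₄₅ k H)
    (comm₆₄₆ k H) (comm₆₅₆ k H)
  have e1 : G.comp (leg₄₁ k H) = leg₆₃ k H := by
    ext a; simp [G, Algebra.TensorProduct.one_def]
  have e2 : G.comp (leg₄₂ k H) = leg₆₄ k H := by
    ext a; simp [G, Algebra.TensorProduct.one_def]
  have e3 : G.comp (leg₄₃ k H) = leg₆₅ k H := by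
    ext a; simp [G, Algebra.TensorProduct.one_def]
  have e4 : G.comp (leg₄₄ k H) = leg₆₆ k H := by
    ext a; simp [G, Algebra.TensorProduct.one_def]
  rw [omega, map_mul]
  exact congrArg₂ (· * ·) (map_tri G e2 e3 e4 _)
    (map_tri G e1 e2 (comp_conv G e3 e4 (comm₄₃₄ k H) (comm₆₅₆ k H)) _)

theorem quad_leg₆_delta : quad (comm₆₁₂ k H) (comm₆₁₃ k H) (comm₆₁₄ k H) (comm₆₂₃ k H)
    (comm₆₂₄ k H) (comm₆₃₄ k H)
      (Φ (conv (leg₄₁ k H) (leg₄₂ k H) (comm₄₁₂ k H)) (leg₄₃ k H) (leg₄₄ k H) *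
        Φi (leg₄₁ k H) (leg₄₂ k H) (leg₄₃ k H)) =
      Φ (conv (leg₆₁ k H) (leg₆₂ k H) (comm₆₁₂ k H)) (leg₆₃ k H) (leg₆₄ k H) *
        Φi (leg₆₁ k H) (leg₆₂ k H) (leg₆₃ k H) := by
  set G := quad (comm₆₁₂ k H) (comm₆₁₃ k H) (comm₆₁₄ k H) (comm₆₂₃ k H)
    (comm₆₂₄ k H) (comm₆₃₄ k H)
  have e1 : G.comp (leg₄₁ k H) = leg₆₁ k H := by
    ext a; simp [G, Algebra.TensorProduct.one_def]
  have e2 : G.comp (leg₄₂ k H) = leg₆₂ k H := by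
    ext a; simp [G, Algebra.TensorProduct.one_def]
  have e3 : G.comp (leg₄₃ k H) = leg₆₃ k H := by
    ext a; simp [G, Algebra.TensorProduct.one_def]
  have e4 : G.comp (leg₄₄ k H) = leg₆₄ k H := by
    ext a; simp [G, Algebra.TensorProduct.one_def]
  rw [map_mul]
  exact congrArg₂ (· * ·)
    (map_tri G (comp_conv G e1 e2 (comm₄₁₂ k H) (comm₆₁₂ k H)) e3 e4 _) (map_tri G e1 e2 e3 _)

/-- `x ⊗ y ↦ Δ(x) δ τ(Δ(y))` -/
noncomputable def deltaMul : H ⊗[k] H →ₗ[k] H ⊗[k] H :=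
  LinearMap.mul' k (H ⊗[k] H) ∘ₗ TensorProduct.map (Δ k H).toLinearMap
    (LinearMap.mulLeft k (δ k H) ∘ₗ tau k H ∘ₗ (Δ k H).toLinearMap)

theorem deltaMul_tmul (x y : H) :
    deltaMul (k := k) (x ⊗ₜ y) = Δ k H x * (δ k H * tau k H (Δ k H y)) := rfl

/-- The element `Δ(q_R¹) δ τ(Δ(q_R²))` is a left inverse of the Drinfeld twist. -/
theorem deltaMul_qR_mul_twist : deltaMul (qR k H) * twist k H = 1 := by
  have hL45 : LeftCollapse (evSix (k := k) (H := H))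
      (conv (leg₆₄ k H) (leg₆₅ k H) (comm₆₄₅ k H)) := by
    refine leftCollapse_of (span_pure₆ k H) ?_
    rintro _ ⟨a, _, ⟨b, _, ⟨c, _, ⟨d, e, f, rfl⟩, rfl⟩, rfl⟩, rfl⟩
    refine ⟨(TensorProduct.mk k H H).flip (b * (β k H * (S k H c * (α k H * f)))) ∘ₗ
      LinearMap.mulLeft k (a * (β k H * S k H d)) ∘ₗ LinearMap.mulRight k e, ?_⟩
    intro x y
    simp [evSix_tmul, BimodDual.S_mul, mul_assoc]
  have hL36 : LeftCollapse (evSix (k := k) (H := H))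
      (conv (leg₆₃ k H) (leg₆₆ k H) (comm₆₃₆ k H)) := by
    refine leftCollapse_of (span_pure₆ k H) ?_
    rintro _ ⟨a, _, ⟨b, _, ⟨c, _, ⟨d, e, f, rfl⟩, rfl⟩, rfl⟩, rfl⟩
    refine ⟨TensorProduct.mk k H H (a * (β k H * (S k H d * (α k H * e)))) ∘ₗ
      LinearMap.mulLeft k (b * (β k H * S k H c)) ∘ₗ LinearMap.mulRight k f, ?_⟩
    intro x y
    simp [evSix_tmul, BimodDual.S_mul, mul_assoc]
  have hR23 : RightCollapse (evSix (k := k) (H := H))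
      (conv (leg₆₂ k H) (leg₆₃ k H) (comm₆₂₃ k H)) := by
    refine rightCollapse_of (span_pure₆ k H) ?_
    rintro _ ⟨a, _, ⟨b, _, ⟨c, _, ⟨d, e, f, rfl⟩, rfl⟩, rfl⟩, rfl⟩
    refine ⟨TensorProduct.mk k H H (a * (β k H * (S k H d * (α k H * e)))) ∘ₗ
      LinearMap.mulLeft k b ∘ₗ LinearMap.mulRight k (S k H c * (α k H * f)), ?_⟩
    intro x y
    simp [evSix_tmul, BimodDual.S_mul, mul_assoc]
  have hR14 : RightCollapse (evSix (k := k) (H := H))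
      (conv (leg₆₁ k H) (leg₆₄ k H) (comm₆₁₄ k H)) := by
    refine rightCollapse_of (span_pure₆ k H) ?_
    rintro _ ⟨a, _, ⟨b, _, ⟨c, _, ⟨d, e, f, rfl⟩, rfl⟩, rfl⟩, rfl⟩
    refine ⟨(TensorProduct.mk k H H).flip (b * (β k H * (S k H c * (α k H * f)))) ∘ₗ
      LinearMap.mulLeft k a ∘ₗ LinearMap.mulRight k (S k H d * (α k H * e)), ?_⟩
    intro x y
    simp [evSix_tmul, BimodDual.S_mul, mul_assoc]
  have p := apply_six (comm₆₁₂ k H) (comm₆₁₃ k H) (comm₆₁₄ k H) (comm₆₁₅ k H) (comm₆₁₆ k H)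
    (comm₆₂₃ k H) (comm₆₂₄ k H) (comm₆₂₅ k H) (comm₆₂₆ k H) (comm₆₃₄ k H) (comm₆₃₅ k H)
    (comm₆₃₆ k H) (comm₆₄₅ k H) (comm₆₄₆ k H) (comm₆₅₆ k H) hL45 hL36 hR23 hR14
  have e1 : ∀ t : H ⊗[k] (H ⊗[k] H), evSix (Φi (leg₆₄ k H) (leg₆₅ k H) (leg₆₆ k H) *
      Φ (leg₆₃ k H) (leg₆₄ k H) (conv (leg₆₅ k H) (leg₆₆ k H) (comm₆₅₆ k H)) *
        tri (conv (leg₆₁ k H) (leg₆₂ k H) (comm₆₁₂ k H))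
          (conv (leg₆₃ k H) (leg₆₄ k H) (comm₆₃₄ k H))
          (conv (leg₆₅ k H) (leg₆₆ k H) (comm₆₅₆ k H)) t *
        (Φ (conv (leg₆₁ k H) (leg₆₂ k H) (comm₆₁₂ k H)) (leg₆₃ k H) (leg₆₄ k H) *
          Φi (leg₆₁ k H) (leg₆₂ k H) (leg₆₃ k H))) = deltaMul (evQR t) * twist k H := by
    intro t
    induction t using tensor_induction₃ with
    | add s t hs ht => simp only [mul_add, add_mul, map_add, hs, ht]
    | pure x y z =>
      have e : γ k H * Δ k H z =
          tau k H (Δ k H ((S k H).symm (α k H * z))) * twist k H := by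
        rw [← twist_mul_comul, LinearEquiv.apply_symm_apply, map_mul, ← mul_assoc,
          twist_mul_comul_alpha]
      rw [← quad_leg₆_omega, ← quad_leg₆_delta, tri_tmul, conv_apply, conv_apply, conv_apply,
        evSix_quad_mul, evGamma_omega, ← δ, e, evQR_tmul, deltaMul_tmul,
        map_mul (Δ k H), tau_mul]
      simp only [mul_assoc]
  have e2 : ∀ s t : H ⊗[k] (H ⊗[k] H), evSix (tri (leg₆₂ k H) (leg₆₃ k H) (leg₆₆ k H) s *
      tri (leg₆₁ k H) (leg₆₄ k H) (leg₆₅ k H) t) = betaAlpha t ⊗ₜ betaAlpha s := by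
    intro s t
    induction s using tensor_induction₃ with
    | add s t hs ht => simp only [add_mul, map_add, hs, ht, TensorProduct.tmul_add]
    | pure x y z =>
      induction t using tensor_induction₃ with
      | add s t hs ht => simp only [mul_add, map_add, hs, ht, TensorProduct.add_tmul]
      | pure a b c => simp [evSix_tmul, betaAlpha_tmul, mul_assoc]
  have p' := (e1 (φ k H)).symm.trans (p.trans (e2 _ _))
  rw [betaAlpha_φ, ← Algebra.TensorProduct.one_def] at p'
  rwa [← evQR_Φ, Φ, tri_legs]

theorem isUnit_twist : IsUnit (twist k H) :=
  isUnit_iff_exists_and_exists.2 ⟨⟨_, twist_mul_opR_oqL_pR⟩, ⟨_, deltaMul_qR_mul_twist⟩⟩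

/-- `U = Δ(q_L¹) p_R (1 ⊗ S(q_L²))` -/
theorem U_eq : U k H = opR k H (qL k H) := by
  have e : U k H = Ring.inverse (twist k H) * tau k H (qR k H) := rfl
  rw [e, ← twist_mul_opR_qL, ← mul_assoc, Ring.inverse_mul_cancel _ isUnit_twist, one_mul]

theorem tau_V : tau k H (V k H) = twist k H * pR k H := by
  have e : ∀ u : H ⊗[k] H, tau k H (SSInv k H (swap k H u)) = u := by
    intro u
    induction u using tensor_induction₂ with
    | add s t hs ht => simp only [map_add, hs, ht]
    | pure a b => simp [swap, SSInv]
  rw [V, twistH, tau_mul, e, e]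

theorem tau_injective : Function.Injective (tau k H) := by
  refine Function.LeftInverse.injective (g := fun u => SSInv k H (swap k H u)) fun u => ?_
  induction u using tensor_induction₂ with
  | add s t hs ht => simp only [map_add, hs, ht]
  | pure a b => simp [swap, SSInv]

/-- `V = (1 ⊗ S⁻¹(p_L²)) q_R Δ(p_L¹)` -/
theorem V_eq : V k H = oqR k H (pL k H) := by
  apply tau_injective
  rw [tau_V, tau_oqR, oqL_pL, opR_one]

end TwistUnit
/-! ### Cocentral forms and the dual coaction -/

section DualCoactionForms

set_option linter.unusedSectionVars false

variable {k H K M : Type*} [Field k] [Ring H] [Algebra k H] [QuasiHopfAlgebra k H]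
  [AddCommGroup K] [Module k K] [Module H K] [Module Hᵐᵒᵖ K] [SMulCommClass H Hᵐᵒᵖ K]
  [IsScalarTower k H K] [IsScalarTower k Hᵐᵒᵖ K]
  [AddCommGroup M] [Module k M] [Module H M] [Module Hᵐᵒᵖ M] [SMulCommClass H Hᵐᵒᵖ M]
  [IsScalarTower k H M] [IsScalarTower k Hᵐᵒᵖ M]

theorem oqR_mul_one_tmul (u : H ⊗[k] H) (a : H) :
    oqR k H (u * (1 ⊗ₜ a)) = (1 ⊗ₜ (S k H).symm a) * oqR k H u := by
  induction u using tensor_induction₂ with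
  | add s t hs ht => simp only [add_mul, mul_add, map_add, hs, ht]
  | pure x y => simp [BimodDual.S_symm_mul, ← mul_assoc]

theorem opR_one_tmul_mul (u : H ⊗[k] H) (b : H) :
    opR k H ((1 ⊗ₜ b) * u) = opR k H u * (1 ⊗ₜ S k H b) := by
  induction u using tensor_induction₂ with
  | add s t hs ht => simp only [add_mul, mul_add, map_add, hs, ht]
  | pure x y => simp [BimodDual.S_mul, mul_assoc]

/-- The evaluation `ψ ⊗ a ↦ ψ(x) a` of `K* ⊗ H` at a vector `x`. -/
noncomputable def evalAt (x : K) : BimodDual k H K ⊗[k] H →ₗ[k] H :=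
  (TensorProduct.lid k H).toLinearMap ∘ₗ TensorProduct.map
    (LinearMap.applyₗ x ∘ₗ (BimodDual.equiv k H K).toLinearMap) LinearMap.id

/-- The contraction `a ⊗ x ↦ ψ(x) a` of `H ⊗ K` with a linear form `ψ`. -/
noncomputable def slice (ψ : BimodDual k H K) : H ⊗[k] K →ₗ[k] H :=
  (TensorProduct.rid k H).toLinearMap ∘ₗ
    TensorProduct.map LinearMap.id (BimodDual.equiv k H K ψ)

theorem evalAt_tmul (x : K) (ψ : BimodDual k H K) (a : H) :
    evalAt x (ψ ⊗ₜ[k] a) = BimodDual.equiv k H K ψ x • a := rfl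

theorem slice_tmul (ψ : BimodDual k H K) (a : H) (x : K) :
    slice ψ (a ⊗ₜ[k] x) = BimodDual.equiv k H K ψ x • a := rfl

theorem dualTensorEquiv_apply (fin : Module.Finite k H ∨ Module.Finite k K)
    (w : BimodDual k H K ⊗[k] H) (x : K) : dualTensorEquiv fin w x = evalAt x w := by
  induction w using TensorProduct.induction_on with
  | zero => simp only [map_zero, LinearMap.zero_apply]
  | add s t hs ht => simp only [map_add, LinearMap.add_apply, hs, ht]
  | tmul ψ a => rfl

theorem eq_of_evalAt_eq (fin : Module.Finite k H ∨ Module.Finite k K)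
    {w w' : BimodDual k H K ⊗[k] H} (h : ∀ x, evalAt x w = evalAt x w') : w = w' :=
  (dualTensorEquiv fin).injective (LinearMap.ext fun x => by
    rw [dualTensorEquiv_apply, dualTensorEquiv_apply, h])

theorem evalAt_dualCoaction (Λ : LeftCoaction k H K) (fin : Module.Finite k H ∨ Module.Finite k K)
    (ψ : BimodDual k H K) (x : K) :
    evalAt x (dualCoaction Λ fin ψ) = slice ψ (barCoaction Λ x) := by
  rw [← dualTensorEquiv_apply fin, dualCoaction, LinearMap.comp_apply, LinearEquiv.coe_coe,
    LinearEquiv.apply_symm_apply]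
  rfl

theorem evalAt_act (x : K) (a b c d : H) (w : BimodDual k H K ⊗[k] H) :
    evalAt x (lAct₂ k H _ H (a ⊗ₜ b) (rAct₂ k H _ H (c ⊗ₜ d) w)) =
      b * evalAt ((S k H).symm a • MulOpposite.op (S k H c) • x) w * d := by
  induction w using TensorProduct.induction_on with
  | zero => simp only [map_zero, mul_zero, zero_mul]
  | add s t hs ht => simp only [map_add, hs, ht, mul_add, add_mul]
  | tmul ψ h =>
    simp only [tensorAct_tmul, lAct_apply, rAct_apply, evalAt_tmul, BimodDual.smul_apply,
      BimodDual.op_smul_apply, MulOpposite.unop_op, smul_eq_mul, MulOpposite.smul_eq_mul_unop,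
      mul_smul_comm, smul_mul_assoc, mul_assoc]
    rw [smul_comm (_ : H) (_ : Hᵐᵒᵖ)]

theorem slice_act (ψ : BimodDual k H K) (b d : H) (z : H ⊗[k] K) :
    slice ψ (lAct₂ k H H K (b ⊗ₜ 1) (rAct₂ k H H K (d ⊗ₜ 1) z)) = b * slice ψ z * d := by
  induction z using TensorProduct.induction_on with
  | zero => simp only [map_zero, mul_zero, zero_mul]
  | add s t hs ht => simp only [map_add, hs, ht, mul_add, add_mul]
  | tmul h y => simp [slice_tmul, mul_assoc]

theorem slice_smul (ψ : BimodDual k H K) (a : H) (z : H ⊗[k] K) :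
    slice (a • ψ) z = slice ψ (lAct₂ k H H K (1 ⊗ₜ (S k H).symm a) z) := by
  induction z using TensorProduct.induction_on with
  | zero => simp only [map_zero]
  | add s t hs ht => simp only [map_add, hs, ht]
  | tmul h y => simp [slice_tmul, BimodDual.smul_apply]

theorem slice_op_smul (ψ : BimodDual k H K) (b : H) (z : H ⊗[k] K) :
    slice (MulOpposite.op b • ψ) z = slice ψ (rAct₂ k H H K (1 ⊗ₜ S k H b) z) := by
  induction z using TensorProduct.induction_on with
  | zero => simp only [map_zero]
  | add s t hs ht => simp only [map_add, hs, ht]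
  | tmul h y => simp [slice_tmul, BimodDual.op_smul_apply]

/-- The effect of `u · (-) · v` on the dual coaction. It rests on `V = oqR(p_L)` and
`U = opR(q_L)`. -/
theorem evalAt_act_dualCoaction (Λ : LeftCoaction k H K)
    (fin : Module.Finite k H ∨ Module.Finite k K) (ψ : BimodDual k H K) (x : K) (u v : H ⊗[k] H) :
    evalAt x (lAct₂ k H _ H u (rAct₂ k H _ H v (dualCoaction Λ fin ψ))) =
      slice ψ (lAct₂ k H H K (oqR k H (opL k H u)) (rAct₂ k H H K (opR k H (oqL k H v))
        (Λ.coact x))) := by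
  induction u using tensor_induction₂ with
  | add s t hs ht => simp only [map_add, LinearMap.add_apply, hs, ht]
  | pure a b =>
    induction v using tensor_induction₂ with
    | add s t hs ht => simp only [map_add, LinearMap.add_apply, hs, ht]
    | pure c d =>
      rw [evalAt_act, evalAt_dualCoaction, ← slice_act, opL_tmul, oqR_comul_mul, oqR_mul_tmul_one,
        oqL_tmul, opR_mul_comul, opR_tmul_one_mul, ← V_eq, ← U_eq, barCoaction,
        LinearMap.comp_apply, LinearMap.comp_apply, Λ.coact_smul, Λ.coact_op_smul]
      simp only [lAct₂_mul, rAct₂_mul, lAct₂_rAct₂]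

/-- `ρ_{K*}(a · ψ) = Δ(a) · ρ_{K*}(ψ)` -/
theorem dualCoaction_smul (Λ : LeftCoaction k H K) (fin : Module.Finite k H ∨ Module.Finite k K)
    (a : H) (ψ : BimodDual k H K) :
    dualCoaction Λ fin (a • ψ) = lAct₂ k H _ H (Δ k H a) (dualCoaction Λ fin ψ) := by
  refine eq_of_evalAt_eq fin fun x => ?_
  have h := evalAt_act_dualCoaction Λ fin ψ x (Δ k H a) 1
  have h' := evalAt_act_dualCoaction Λ fin (a • ψ) x 1 1
  rw [rAct₂_one] at h h'
  rw [lAct₂_one, opL_one, slice_smul, ← lAct₂_mul, ← oqR_mul_one_tmul] at h'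
  rw [h, h', opL_comul]

/-- `ρ_{K*}(ψ · b) = ρ_{K*}(ψ) · Δ(b)` -/
theorem dualCoaction_op_smul (Λ : LeftCoaction k H K)
    (fin : Module.Finite k H ∨ Module.Finite k K) (b : H) (ψ : BimodDual k H K) :
    dualCoaction Λ fin (MulOpposite.op b • ψ) =
      rAct₂ k H _ H (Δ k H b) (dualCoaction Λ fin ψ) := by
  refine eq_of_evalAt_eq fin fun x => ?_
  have h := evalAt_act_dualCoaction Λ fin ψ x 1 (Δ k H b)
  have h' := evalAt_act_dualCoaction Λ fin (MulOpposite.op b • ψ) x 1 1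
  rw [lAct₂_one] at h h'
  rw [rAct₂_one, oqL_one, slice_op_smul, ← lAct₂_rAct₂, ← rAct₂_mul, ← opR_one_tmul_mul] at h'
  rw [h, h', oqL_comul]

/-- A map `W` with `W(a · m · b) = Δ(a) · W(m) · Δ(b)` is determined by the values
`q_L · W(m) · p_L`: by `oqL_pL` and `opL_qL`,
`W(m) = (S(p_L¹) ⊗ 1) · q_L · W(p_L² · m · q_L²) · p_L · (S⁻¹(q_L¹) ⊗ 1)`. -/
theorem eq_of_qL_act_pL {N : Type*} [AddCommGroup N] [Module k N] [Module H N] [Module Hᵐᵒᵖ N]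
    [SMulCommClass H Hᵐᵒᵖ N] [IsScalarTower k H N] [IsScalarTower k Hᵐᵒᵖ N]
    {W W' : M →ₗ[k] N ⊗[k] H}
    (hl : ∀ (a : H) m, W (a • m) = lAct₂ k H N H (Δ k H a) (W m))
    (hr : ∀ (b : H) m, W (MulOpposite.op b • m) = rAct₂ k H N H (Δ k H b) (W m))
    (hl' : ∀ (a : H) m, W' (a • m) = lAct₂ k H N H (Δ k H a) (W' m))
    (hr' : ∀ (b : H) m, W' (MulOpposite.op b • m) = rAct₂ k H N H (Δ k H b) (W' m))
    (h : ∀ m, lAct₂ k H N H (qL k H) (rAct₂ k H N H (pL k H) (W m)) =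
      lAct₂ k H N H (qL k H) (rAct₂ k H N H (pL k H) (W' m))) : W = W' := by
  ext m
  have key : ∀ u v : H ⊗[k] H, lAct₂ k H N H (oqL k H u) (rAct₂ k H N H (opL k H v) (W m)) =
      lAct₂ k H N H (oqL k H u) (rAct₂ k H N H (opL k H v) (W' m)) := by
    intro u v
    induction u using tensor_induction₂ with
    | add s t hs ht => simp only [map_add, LinearMap.add_apply, hs, ht]
    | pure a b =>
      induction v using tensor_induction₂ with
      | add s t hs ht => simp only [map_add, LinearMap.add_apply, hs, ht]
      | pure c d =>
        have e := congrArg (fun z => lAct₂ k H N H (S k H a ⊗ₜ 1)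
          (rAct₂ k H N H ((S k H).symm c ⊗ₜ 1) z)) (h (b • MulOpposite.op d • m))
        simp only [hl, hr, hl', hr'] at e
        simp only [oqL_tmul, opL_tmul, lAct₂_mul, rAct₂_mul]
        simp only [lAct₂_rAct₂] at e ⊢
        exact e
  have := key (pL k H) (qL k H)
  rwa [oqL_pL, opL_qL, lAct₂_one, lAct₂_one, rAct₂_one, rAct₂_one] at this

/-- For `s = φ`, `t = φ⁻¹` this computes the left-hand side of cocentrality of `Σ_f`. -/
theorem cocentral_left_formOfMap {f : M →ₗ[k] BimodDual k H K} (hf : IsBimoduleMap H f)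
    (s t : H ⊗[k] (H ⊗[k] H)) (w : H ⊗[k] K) (m : M) :
    TensorProduct.rid k H (TensorProduct.map LinearMap.id (formOfMap f)
      (tensorAct (lAct k H H) (tensorAct (lAct k H K) (lAct k H M)) s
        (tensorAct (rAct k H H) (tensorAct (rAct k H K) (rAct k H M)) t
          (TensorProduct.assoc k H K M (w ⊗ₜ[k] m))))) =
      slice (f m) (lAct₂ k H H K (evQR s) (rAct₂ k H H K (evPR t) w)) := by
  induction w using TensorProduct.induction_on with
  | zero => simp only [map_zero, TensorProduct.zero_tmul]
  | add w w' hw hw' => simp only [map_add, TensorProduct.add_tmul, hw, hw']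
  | tmul h y =>
    induction s using tensor_induction₃ with
    | add s s' hs hs' => simp only [map_add, LinearMap.add_apply, hs, hs']
    | pure a b c =>
      induction t using tensor_induction₃ with
      | add t t' ht ht' => simp only [map_add, LinearMap.add_apply, ht, ht']
      | pure a' b' c' =>
        have e := formOfMap_act hf (b ⊗ₜ c) (b' ⊗ₜ c') y m
        rw [alphaMul_tmul, betaMul_tmul, mul_assoc, BimodDual.S_symm_mul,
          LinearEquiv.symm_apply_apply, mul_assoc] at e
        simp only [tensorAct_tmul, lAct_apply, rAct_apply] at e
        simp only [TensorProduct.assoc_tmul, tensorAct_tmul, lAct_apply, rAct_apply,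
          TensorProduct.map_tmul, TensorProduct.rid_tmul, e, evQR_tmul, evPR_tmul, slice_tmul,
          LinearMap.id_apply]

/-- For `s = φ⁻¹`, `t = φ` this computes the right-hand side of cocentrality of `Σ_f`. -/
theorem cocentral_right_formOfMap {f : M →ₗ[k] BimodDual k H K} (hf : IsBimoduleMap H f)
    (s t : H ⊗[k] (H ⊗[k] H)) (x : K) (w : M ⊗[k] H) :
    TensorProduct.lid k H (TensorProduct.map (formOfMap f) LinearMap.id
      ((TensorProduct.assoc k K M H).symm
        (tensorAct (lAct k H K) (tensorAct (lAct k H M) (lAct k H H)) s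
          (tensorAct (rAct k H K) (tensorAct (rAct k H M) (rAct k H H)) t
            (x ⊗ₜ[k] w))))) =
      evalAt x (lAct₂ k H _ H (evQL s) (rAct₂ k H _ H (evPL t)
        (TensorProduct.map f LinearMap.id w))) := by
  induction w using TensorProduct.induction_on with
  | zero => simp only [map_zero, TensorProduct.tmul_zero]
  | add w w' hw hw' => simp only [map_add, TensorProduct.tmul_add, hw, hw']
  | tmul m h =>
    induction s using tensor_induction₃ with
    | add s s' hs hs' => simp only [map_add, LinearMap.add_apply, hs, hs']
    | pure a b c =>
      induction t using tensor_induction₃ with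
      | add t t' ht ht' => simp only [map_add, LinearMap.add_apply, ht, ht']
      | pure a' b' c' =>
        have e := formOfMap_act hf (a ⊗ₜ b) (a' ⊗ₜ b') x m
        rw [alphaMul_tmul, betaMul_tmul, mul_assoc] at e
        simp only [tensorAct_tmul, lAct_apply, rAct_apply] at e
        rw [TensorProduct.map_tmul, evQL_tmul, evPL_tmul, evalAt_act, BimodDual.S_mul,
          LinearEquiv.apply_symm_apply, evalAt_tmul]
        simp only [tensorAct_tmul, lAct_apply, rAct_apply, TensorProduct.assoc_symm_tmul,
          TensorProduct.map_tmul, TensorProduct.lid_tmul, e,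
          LinearMap.id_apply, smul_eq_mul, MulOpposite.smul_eq_mul_unop, MulOpposite.unop_op,
          mul_smul_comm, smul_mul_assoc, mul_assoc]

/-- Both sides of cocentrality of `Σ_f` are values of elements of `K* ⊗ H`: the left one of
`q_L · ρ_{K*}(f(m)) · p_L`, the right one of `q_L · (f ⊗ id)(ρ(m)) · p_L`. -/
theorem isCocentral_formOfMap_iff (Λ : LeftCoaction k H K) (ρ : RightCoaction k H M)
    (fin : Module.Finite k H ∨ Module.Finite k K) {f : M →ₗ[k] BimodDual k H K}
    (hf : IsBimoduleMap H f) :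
    IsCocentral Λ ρ (formOfMap f) ↔ IsQuasiHopfMorphism ρ.coact (dualCoaction Λ fin) f := by
  have eQR : evQR (φ k H) = qR k H := rfl
  have ePR : evPR (φInv k H) = pR k H := rfl
  have eQL : evQL (φInv k H) = qL k H := rfl
  have ePL : evPL (φ k H) = pL k H := rfl
  have e1 : IsCocentral Λ ρ (formOfMap f) ↔ ∀ x m,
      evalAt x (lAct₂ k H _ H (qL k H) (rAct₂ k H _ H (pL k H) (dualCoaction Λ fin (f m)))) =
        evalAt x (lAct₂ k H _ H (qL k H) (rAct₂ k H _ H (pL k H)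
          (TensorProduct.map f LinearMap.id (ρ.coact m)))) := by
    refine forall_congr' fun x => forall_congr' fun m => ?_
    rw [cocentral_left_formOfMap hf, cocentral_right_formOfMap hf, evalAt_act_dualCoaction,
      opL_qL, oqL_pL, eQR, ePR, eQL, ePL, oqR_one, opR_one]
  rw [e1, IsQuasiHopfMorphism, and_iff_right hf]
  constructor
  · intro h
    have n1 : ∀ u (w : M ⊗[k] H), TensorProduct.map f LinearMap.id (lAct₂ k H M H u w) =
        lAct₂ k H _ H u (TensorProduct.map f LinearMap.id w) := by
      intro u w
      induction w using TensorProduct.induction_on with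
      | zero => simp only [map_zero]
      | add s t hs ht => simp only [map_add, hs, ht]
      | tmul m a =>
        induction u using tensor_induction₂ with
        | add s t hs ht => simp only [map_add, LinearMap.add_apply, hs, ht]
        | pure b c => simp [hf.1]
    have n2 : ∀ u (w : M ⊗[k] H), TensorProduct.map f LinearMap.id (rAct₂ k H M H u w) =
        rAct₂ k H _ H u (TensorProduct.map f LinearMap.id w) := by
      intro u w
      induction w using TensorProduct.induction_on with
      | zero => simp only [map_zero]
      | add s t hs ht => simp only [map_add, hs, ht]
      | tmul m a =>
        induction u using tensor_induction₂ with
        | add s t hs ht => simp only [map_add, LinearMap.add_apply, hs, ht]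
        | pure b c => simp [hf.2]
    refine eq_of_qL_act_pL ?_ ?_ ?_ ?_ fun m => eq_of_evalAt_eq fin fun x => (h x m).symm
    · intro a m
      rw [LinearMap.comp_apply, LinearMap.comp_apply, ρ.coact_smul, n1]
    · intro b m
      rw [LinearMap.comp_apply, LinearMap.comp_apply, ρ.coact_op_smul, n2]
    · intro a m
      rw [LinearMap.comp_apply, LinearMap.comp_apply, hf.1, dualCoaction_smul]
    · intro b m
      rw [LinearMap.comp_apply, LinearMap.comp_apply, hf.2, dualCoaction_op_smul]
  · intro h x m
    have := LinearMap.congr_fun h m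
    rw [LinearMap.comp_apply, LinearMap.comp_apply] at this
    rw [this]

end DualCoactionForms
end QuasiHopf

theorem theorem7 {k H K M : Type*} [Field k] [Ring H] [Algebra k H] [QuasiHopfAlgebra k H]
    [AddCommGroup K] [Module k K] [Module H K] [Module Hᵐᵒᵖ K] [SMulCommClass H Hᵐᵒᵖ K]
    [IsScalarTower k H K] [IsScalarTower k Hᵐᵒᵖ K]
    [AddCommGroup M] [Module k M] [Module H M] [Module Hᵐᵒᵖ M] [SMulCommClass H Hᵐᵒᵖ M]
    [IsScalarTower k H M] [IsScalarTower k Hᵐᵒᵖ M]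
    (Λ : LeftCoaction k H K) (ρ : RightCoaction k H M) :
    -- `f ↦ Σ_f` is a bijection from bimodule maps `M → K*` onto biinvariant forms on `K ⊗ M`
    (Set.BijOn formOfMap {f : M →ₗ[k] BimodDual k H K | IsBimoduleMap H f}
      {σ : K ⊗[k] M →ₗ[k] k | IsBiinvariant H σ} ∧
    -- for each choice of `p` and `q`, the inverse is `σ ↦ f_σ`
    (∀ p ∈ ({pL k H, pR k H} : Set (H ⊗[k] H)), ∀ q ∈ ({qL k H, qR k H} : Set (H ⊗[k] H)),
      Set.MapsTo (mapOfForm p q) {σ : K ⊗[k] M →ₗ[k] k | IsBiinvariant H σ}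
        {f : M →ₗ[k] BimodDual k H K | IsBimoduleMap H f} ∧
      Set.InvOn (mapOfForm p q) formOfMap {f : M →ₗ[k] BimodDual k H K | IsBimoduleMap H f}
        {σ : K ⊗[k] M →ₗ[k] k | IsBiinvariant H σ}) ∧
    -- `f_σ` does not depend on these choices
    (∀ σ : K ⊗[k] M →ₗ[k] k, IsBiinvariant H σ →
      ∀ p ∈ ({pL k H, pR k H} : Set (H ⊗[k] H)), ∀ p' ∈ ({pL k H, pR k H} : Set (H ⊗[k] H)),
      ∀ q ∈ ({qL k H, qR k H} : Set (H ⊗[k] H)), ∀ q' ∈ ({qL k H, qR k H} : Set (H ⊗[k] H)),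
        mapOfForm p q σ = mapOfForm p' q' σ)) ∧
    -- cocentrality of `Σ_f`, when `H` or `K` is finite-dimensional
    (∀ (fin : Module.Finite k H ∨ Module.Finite k K) (f : M →ₗ[k] BimodDual k H K),
      IsBimoduleMap H f →
        (IsCocentral Λ ρ (formOfMap f) ↔
          IsQuasiHopfMorphism ρ.coact (dualCoaction Λ fin) f)) := by
  have mt : Set.MapsTo formOfMap {f : M →ₗ[k] BimodDual k H K | IsBimoduleMap H f}
      {σ : K ⊗[k] M →ₗ[k] k | IsBiinvariant H σ} := fun _ hf => formOfMap_isBiinvariant hf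
  have inv : ∀ p ∈ ({pL k H, pR k H} : Set (H ⊗[k] H)),
      ∀ q ∈ ({qL k H, qR k H} : Set (H ⊗[k] H)),
      Set.MapsTo (mapOfForm p q) {σ : K ⊗[k] M →ₗ[k] k | IsBiinvariant H σ}
        {f : M →ₗ[k] BimodDual k H K | IsBimoduleMap H f} ∧
      Set.InvOn (mapOfForm p q) formOfMap {f : M →ₗ[k] BimodDual k H K | IsBimoduleMap H f}
        {σ : K ⊗[k] M →ₗ[k] k | IsBiinvariant H σ} := fun p hp q hq =>
    ⟨fun _ hσ => mapOfForm_isBimoduleMap hσ hp hq,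
      fun _ hf => mapOfForm_formOfMap hf hp hq, fun _ hσ => formOfMap_mapOfForm hσ hp hq⟩
  refine ⟨⟨?_, inv, ?_⟩, fun fin f hf => isCocentral_formOfMap_iff Λ ρ fin hf⟩
  · obtain ⟨h, h'⟩ := inv (pL k H) (Or.inl rfl) (qL k H) (Or.inl rfl)
    exact h'.bijOn mt h
  · intro σ hσ p hp p' hp' q hq q' hq'
    -- both maps are preimages of `σ` under `f ↦ Σ_f`
    rw [← mapOfForm_formOfMap (mapOfForm_isBimoduleMap hσ hp' hq') hp hq,
      formOfMap_mapOfForm hσ hp' hq']
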